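/- Let $\mathcal K$ and $\mathcal L$ be simplicial complexes on finite linearly ordered sets $V$ and $W$ (always $\varnothing\in\mathcal K$, $\varnothing\in\mathcal L$; elements of $V$, $W$ need not be vertices), and let $\mathcal K*\mathcal L=\{S\sqcup T: S\in\mathcal K,\ T\in\mathcal L\}$ be their join on $V\sqcup W$, ordered with $V$ before $W$. Let $R$ be a commutative ring of coefficients. For $I\subset V$ let $\mathcal K_I=\{S\in\mathcal K: S\subset I\}$, let $\widetilde H^p$, $\widetilde H_p$ denote reduced simplicial (co)homology over $R$ (with $\widetilde H^{-1}(\{\varnothing\})=\widetilde H_{-1}(\{\varnothing\})=R$), and let $\varepsilon(i,I)=(-1)^{\#\{j\in I:\,j<i\}}$. The (co)homology of the moment-angle complex $\mathcal Z_{\mathcal K}$ is understood through its Hochster decomposition as the bigraded module $$H^{-k,2\ell}(\mathcal Z_{\mathcal K})=\bigoplus_{I\subset V,\ |I|=\ell}\widetilde H^{\ell-k-1}(\mathcal K_I),\qquad H_{-k,2\ell}(\mathcal Z_{\mathcal K})=\bigoplus_{I\subset V,\ |I|=\ell}\widetilde H_{\ell-k-1}(\mathcal K_I).$$ The bigraded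 complex $\mathit{CH}^*(\mathcal Z_{\mathcal K})=(H^*(\mathcal Z_{\mathcal K}),d')$ has the differential $d'$ of bidegree $(1,-2)$ given on $\widetilde H^p(\mathcal K_I)$ by $d'=(-1)^{p+1}\sum_{i\in I}\varepsilon(i,I)\,\psi_{p;i,I}$, where $\psi_{p;i,I}\colon\widetilde H^p(\mathcal K_I)\to\widetilde H^p(\mathcal K_{I\setminus\{i\}})$ is induced by inclusion; the bigraded complex $\mathit{CH}_*(\mathcal Z_{\mathcal K})=(H_*(\mathcal Z_{\mathcal K}),\partial')$ has the differential $\partial'$ of bidegree $(-1,2)$ given on $\widetilde H_p(\mathcal K_I)$ by $\partial'=(-1)^{p+1}\sum_{j\in V\setminus I}\varepsilon(j,I)\,\phi_{p;I,j}$, where $\phi_{p;I,j}\colon\widetilde H_p(\mathcal K_I)\to\widetilde H_p(\mathcal K_{I\cup\{j\}})$ is induced by inclusion. Their bigraded homology modules are the double cohomology $\mathit{HH}^*(\mathcal Z_{\mathcal K})$ and the double homology $\mathit{HH}_*(\mathcal Z_{\mathcal K})$. Tensor products of bigraded complexes carry the differential $d(x\otimes y)=dx\otimes y+(-1)^{|x|}x\otimes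 dy$, with $|x|$ the total degree. **Theorem.** 1. If $H^*(\mathcal Z_{\mathcal K})$ or $H^*(\mathcal Z_{\mathcal L})$ is projective over $R$, then there is an isomorphism of bigraded cochain complexes $$\mathit{CH}^*(\mathcal Z_{\mathcal K*\mathcal L})\cong \mathit{CH}^*(\mathcal Z_{\mathcal K})\otimes_R \mathit{CH}^*(\mathcal Z_{\mathcal L}).$$ 2. If the coefficients form a field $F$, then $\mathit{HH}^*(\mathcal Z_{\mathcal K*\mathcal L})\cong \mathit{HH}^*(\mathcal Z_{\mathcal K})\otimes_F \mathit{HH}^*(\mathcal Z_{\mathcal L})$ as bigraded vector spaces. 3. If $H_*(\mathcal Z_{\mathcal K})$ or $H_*(\mathcal Z_{\mathcal L})$ is projective over $R$, then there is an isomorphism of bigraded chain complexes $$\mathit{CH}_*(\mathcal Z_{\mathcal K*\mathcal L})\cong \mathit{CH}_*(\mathcal Z_{\mathcal K})\otimes_R \mathit{CH}_*(\mathcal Z_{\mathcal L}).$$ 4. If the coefficients form a field $F$, then $\mathit{HH}_*(\mathcal Z_{\mathcal K*\mathcal L})\cong \mathit{HH}_*(\mathcal Z_{\mathcal K})\otimes_F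 \mathit{HH}_*(\mathcal Z_{\mathcal L})$ as bigraded vector spaces. -/

import Mathlib

open CategoryTheory

universe u

namespace DoubleCohomology

/-! ### Signs -/

/-- `ε(j, I) = (-1) ^ #{i ∈ I | i < j}`. -/
def eps {V : Type} [LinearOrder V] (j : V) (I : Finset V) : ℤ :=
  (-1) ^ (I.filter (fun i => i < j)).card

theorem sum_erase_eq_zero {V : Type} [DecidableEq V] {M : Type*} [AddCommGroup M]
    (s : Finset V) (g : V → V → M)
    (hg : ∀ i ∈ s, ∀ j ∈ s, i ≠ j → g i j + g j i = 0) :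
    ∑ i ∈ s, ∑ j ∈ s.erase i, g i j = 0 := by
  rw [Finset.sum_sigma']
  refine Finset.sum_involution (fun x _ => ⟨x.2, x.1⟩) ?_ ?_ ?_ ?_
  · rintro ⟨i, j⟩ h
    simp only [Finset.mem_sigma, Finset.mem_erase] at h
    exact hg i h.1 j h.2.2 (Ne.symm h.2.1)
  · rintro ⟨i, j⟩ h _ h'
    simp only [Finset.mem_sigma, Finset.mem_erase] at h
    simp only [Sigma.mk.injEq] at h'
    exact h.2.1 h'.1
  · rintro ⟨i, j⟩ h
    simp only [Finset.mem_sigma, Finset.mem_erase] at h ⊢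
    exact ⟨h.2.2, Ne.symm h.2.1, h.1⟩
  · rintro ⟨i, j⟩ h
    rfl

theorem eps_insert_of_lt {V : Type} [LinearOrder V] {i j : V} {I : Finset V}
    (hi : i ∉ I) (h : i < j) : eps j (insert i I) = - eps j I := by
  unfold eps
  rw [Finset.filter_insert, if_pos h, Finset.card_insert_of_notMem (by simp [hi]), pow_succ]
  ring

theorem eps_insert_of_not_lt {V : Type} [LinearOrder V] {i j : V} {I : Finset V}
    (h : ¬ i < j) : eps j (insert i I) = eps j I := by
  unfold eps
  rw [Finset.filter_insert, if_neg h]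

/-- The two orders of adding `i` and `j` to `I` carry opposite signs. -/
theorem eps_anti {V : Type} [LinearOrder V] {i j : V} {I : Finset V}
    (hi : i ∉ I) (hj : j ∉ I) (hij : i ≠ j) :
    eps i I * eps j (insert i I) = -(eps j I * eps i (insert j I)) := by
  rcases lt_or_gt_of_ne hij with h | h
  · rw [eps_insert_of_lt hi h, eps_insert_of_not_lt (not_lt.2 h.le)]; ring
  · rw [eps_insert_of_lt hj h, eps_insert_of_not_lt (not_lt.2 h.le)]; ring

theorem eps_insert_self {V : Type} [LinearOrder V] (i : V) (I : Finset V) :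
    eps i (insert i I) = eps i I := eps_insert_of_not_lt (lt_irrefl i)

theorem eps_erase_self {V : Type} [LinearOrder V] (i : V) (I : Finset V) :
    eps i (I.erase i) = eps i I := by
  unfold eps
  congr 2
  ext x
  simp only [Finset.mem_filter, Finset.mem_erase]
  exact ⟨fun h => ⟨h.1.2, h.2⟩, fun h => ⟨⟨h.2.ne, h.1⟩, h.2⟩⟩

/-- The two orders of removing `i` and `j` from `I` carry opposite signs. -/
theorem eps_anti_erase {V : Type} [LinearOrder V] {i j : V} {I : Finset V}
    (hi : i ∈ I) (hj : j ∈ I) (hij : i ≠ j) :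
    eps i I * eps j (I.erase i) = -(eps j I * eps i (I.erase j)) := by
  have h := eps_anti (I := (I.erase i).erase j) (i := i) (j := j) (by simp) (by simp) hij
  have e1 : insert i ((I.erase i).erase j) = I.erase j := by
    rw [Finset.erase_right_comm, Finset.insert_erase]
    simp [hi, hij]
  have e2 : insert j ((I.erase i).erase j) = I.erase i :=
    Finset.insert_erase (by simp [hj, hij.symm])
  rw [e1, e2, eps_erase_self j (I.erase i), Finset.erase_right_comm,
    eps_erase_self i (I.erase j), eps_erase_self j I, eps_erase_self i I] at h
  linear_combination h

/-! ### Simplicial complexes -/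

/-- The simplices of `K` of dimension `p`, where `p = -1` gives the empty simplex, which always
belongs to `K` (Mathlib's `K.faces` consists of the nonempty simplices). -/
abbrev Simp {V : Type} (K : PreAbstractSimplicialComplex V) (p : ℤ) : Type :=
  {L : Finset V // (L = ∅ ∨ L ∈ K.faces) ∧ (L.card : ℤ) = p + 1}

theorem simp_subset {V : Type} (K : PreAbstractSimplicialComplex V) {S T : Finset V}
    (hT : T = ∅ ∨ T ∈ K.faces) (h : S ⊆ T) : S = ∅ ∨ S ∈ K.faces := by
  rcases S.eq_empty_or_nonempty with hS | hS
  · exact Or.inl hS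
  · rcases hT with rfl | hT
    · exact Or.inl (Finset.subset_empty.1 h)
    · exact Or.inr ((K.isRelLowerSet_faces hT).2 h hS)

theorem erase_mem {V : Type} [DecidableEq V] (K : PreAbstractSimplicialComplex V) {p p' : ℤ}
    (hp : p + 1 = p') (L : Simp K p') {j : V} (hj : j ∈ L.1) :
    (L.1.erase j = ∅ ∨ L.1.erase j ∈ K.faces) ∧ ((L.1.erase j).card : ℤ) = p + 1 := by
  refine ⟨simp_subset K L.2.1 (Finset.erase_subset _ _), ?_⟩
  have h1 := Finset.card_erase_add_one hj
  have h2 := L.2.2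
  omega

/-- The full subcomplex `K_I`. -/
def full {V : Type} (K : PreAbstractSimplicialComplex V) (I : Finset V) :
    PreAbstractSimplicialComplex V where
  faces := {S | S ∈ K.faces ∧ S ⊆ I}
  isRelLowerSet_faces := by
    rintro S ⟨hS, hI⟩
    exact ⟨(K.isRelLowerSet_faces hS).1,
      fun T hT hne => ⟨(K.isRelLowerSet_faces hS).2 hT hne, hT.trans hI⟩⟩

theorem full_mono {V : Type} (K : PreAbstractSimplicialComplex V) {I J : Finset V} (h : I ⊆ J) :
    full K I ≤ full K J :=
  fun _ hS => ⟨hS.1, hS.2.trans h⟩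

/-- The part of `S ⊆ V ⊔ W` in `V`. -/
def leftPart {V W : Type} [Fintype V] [DecidableEq V] [DecidableEq W]
    (S : Finset (Lex (V ⊕ W))) : Finset V :=
  Finset.univ.filter (fun v => toLex (Sum.inl v) ∈ S)

/-- The part of `S ⊆ V ⊔ W` in `W`. -/
def rightPart {V W : Type} [Fintype W] [DecidableEq V] [DecidableEq W]
    (S : Finset (Lex (V ⊕ W))) : Finset W :=
  Finset.univ.filter (fun w => toLex (Sum.inr w) ∈ S)

/-- The join `K * L = {S ⊔ T | S ∈ K, T ∈ L}` (empty simplices included), on the disjoint union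
`V ⊔ W`, linearly ordered with the elements of `V` before those of `W`. -/
def join {V W : Type} [Fintype V] [LinearOrder V] [Fintype W] [LinearOrder W]
    (K : PreAbstractSimplicialComplex V) (L : PreAbstractSimplicialComplex W) :
    PreAbstractSimplicialComplex (Lex (V ⊕ W)) where
  faces := {S | S.Nonempty ∧ (leftPart S = ∅ ∨ leftPart S ∈ K.faces) ∧
    (rightPart S = ∅ ∨ rightPart S ∈ L.faces)}
  isRelLowerSet_faces := by
    rintro S ⟨hS, hK, hL⟩
    refine ⟨hS, fun T hT hne => ⟨hne, simp_subset K hK ?_, simp_subset L hL ?_⟩⟩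
    · exact Finset.monotone_filter_right _ (fun v _ hv => hT hv)
    · exact Finset.monotone_filter_right _ (fun v _ hv => hT hv)

/-! ### Reduced simplicial cochains and cohomology -/

section Cohomology

variable (R : Type u) [CommRing R] {V : Type} [LinearOrder V]

open Classical in
/-- The value of a `p`-cochain on a finite set, zero if the set is not a `p`-simplex. -/
noncomputable def evalAt (K : PreAbstractSimplicialComplex V) (p : ℤ) (S : Finset V) :
    (Simp K p → R) →ₗ[R] R :=
  if h : (S = ∅ ∨ S ∈ K.faces) ∧ (S.card : ℤ) = p + 1 then LinearMap.proj ⟨S, h⟩ else 0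

/-- `(dα)(L) = ∑_{j ∈ L} ε(j, L) α(L \ {j})`, as a map from `p`- to `p'`-cochains;
it is zero unless `p' = p + 1`. -/
noncomputable def coboundary (K : PreAbstractSimplicialComplex V) (p p' : ℤ) :
    (Simp K p → R) →ₗ[R] (Simp K p' → R) :=
  LinearMap.pi fun L => ∑ j ∈ L.1, eps j L.1 • evalAt R K p (L.1.erase j)

/-- The augmented simplicial cochain complex of `K`, with `R` in degree `-1`. -/
noncomputable def cochains (K : PreAbstractSimplicialComplex V) :
    CochainComplex (ModuleCat.{u} R) ℤ where
  X p := ModuleCat.of R (Simp K p → R)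
  d p p' := ModuleCat.ofHom (coboundary R K p p')
  shape p p' hp := by
    rw [← ModuleCat.ofHom_zero]
    congr 1
    ext α L
    simp only [coboundary, LinearMap.pi_apply, LinearMap.sum_apply, LinearMap.zero_apply,
      Pi.zero_apply]
    refine Finset.sum_eq_zero fun j hj => ?_
    rw [evalAt, dif_neg]
    · simp
    · rintro ⟨-, h⟩
      have h1 := Finset.card_erase_add_one hj
      have h2 := L.2.2
      apply hp
      change p + 1 = p'
      omega
  d_comp_d' p p' p'' hp hp' := by
    change p + 1 = p' at hp
    change p' + 1 = p'' at hp'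
    rw [← ModuleCat.ofHom_comp, ← ModuleCat.ofHom_zero]
    congr 1
    refine LinearMap.ext fun α => funext fun L => ?_
    have : ∀ j ∈ L.1, (eps j L.1 • evalAt R K p' (L.1.erase j)) (coboundary R K p p' α) =
        ∑ i ∈ L.1.erase j, (eps j L.1 * eps i (L.1.erase j)) •
          evalAt R K p ((L.1.erase j).erase i) α := by
      intro j hj
      rw [evalAt, dif_pos (erase_mem K hp' L hj)]
      simp [coboundary, Finset.mul_sum, mul_assoc]
    simp only [LinearMap.comp_apply, LinearMap.zero_apply, Pi.zero_apply]
    rw [coboundary, LinearMap.pi_apply, LinearMap.sum_apply, Finset.sum_congr rfl this]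
    refine sum_erase_eq_zero L.1 _ fun i hi j hj hij => ?_
    rw [eps_anti_erase hi hj hij, Finset.erase_right_comm, neg_smul, neg_add_cancel]

/-- Restriction of cochains to a subcomplex. -/
noncomputable def restrict {K' K : PreAbstractSimplicialComplex V} (h : K' ≤ K) :
    cochains R K ⟶ cochains R K' where
  f p := ModuleCat.ofHom (X := Simp K p → R) (Y := Simp K' p → R)
    (LinearMap.funLeft R R fun L => ⟨L.1, L.2.1.imp id (fun hL => h hL), L.2.2⟩)
  comm' p p' hp := by
    change p + 1 = p' at hp
    change ModuleCat.ofHom _ ≫ ModuleCat.ofHom (coboundary R K' p p') =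
      ModuleCat.ofHom (coboundary R K p p') ≫ ModuleCat.ofHom _
    rw [← ModuleCat.ofHom_comp, ← ModuleCat.ofHom_comp]
    congr 1
    refine LinearMap.ext fun α => funext fun L => ?_
    simp only [LinearMap.comp_apply, coboundary, LinearMap.pi_apply, LinearMap.sum_apply,
      LinearMap.funLeft_apply, LinearMap.smul_apply]
    refine Finset.sum_congr rfl fun j hj => ?_
    have h1 := erase_mem K' hp L hj
    rw [evalAt, dif_pos h1, evalAt, dif_pos ⟨h1.1.imp id (fun hL => h hL), h1.2⟩]
    rfl

theorem restrict_comp {K'' K' K : PreAbstractSimplicialComplex V} (h : K' ≤ K) (h' : K'' ≤ K') :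
    restrict R h ≫ restrict R h' = restrict R (h'.trans h) := rfl

/-- `H̃^p(K_I; R)`. -/
noncomputable abbrev redCohomology (K : PreAbstractSimplicialComplex V) (p : ℤ) (I : Finset V) :
    ModuleCat.{u} R :=
  (cochains R (full K I)).homology p

/-- The map `H̃^p(K_J; R) → H̃^p(K_I; R)` induced by the inclusion `K_I ⊆ K_J`. -/
noncomputable def psi (K : PreAbstractSimplicialComplex V) (p : ℤ) {I J : Finset V} (h : I ⊆ J) :
    redCohomology R K p J →ₗ[R] redCohomology R K p I :=
  (HomologicalComplex.homologyMap (restrict R (full_mono K h)) p).hom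

theorem psi_psi (K : PreAbstractSimplicialComplex V) (p : ℤ) {I J T : Finset V}
    (h : I ⊆ J) (h' : J ⊆ T) (x : redCohomology R K p T) :
    psi R K p h (psi R K p h' x) = psi R K p (h.trans h') x := by
  unfold psi
  rw [← restrict_comp R (full_mono K h') (full_mono K h), HomologicalComplex.homologyMap_comp]
  rfl

end Cohomology

/-! ### Reduced simplicial chains and homology -/

section Homology

variable (R : Type u) [CommRing R] {V : Type} [LinearOrder V]

open Classical in
/-- The basis `p`-chain given by a finite set, zero if the set is not a `p`-simplex. -/
noncomputable def basisChain (K : PreAbstractSimplicialComplex V) (p : ℤ) (S : Finset V) :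
    Simp K p →₀ R :=
  if h : (S = ∅ ∨ S ∈ K.faces) ∧ (S.card : ℤ) = p + 1 then Finsupp.single ⟨S, h⟩ 1 else 0

/-- `∂L = ∑_{j ∈ L} ε(j, L) (L \ {j})`, as a map from `p`- to `p'`-chains;
it is zero unless `p = p' + 1`. -/
noncomputable def boundary (K : PreAbstractSimplicialComplex V) (p p' : ℤ) :
    (Simp K p →₀ R) →ₗ[R] (Simp K p' →₀ R) :=
  Finsupp.linearCombination R fun L => ∑ j ∈ L.1, eps j L.1 • basisChain R K p' (L.1.erase j)

theorem boundary_single (K : PreAbstractSimplicialComplex V) (p p' : ℤ) (L : Simp K p) :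
    boundary R K p p' (Finsupp.single L 1) =
      ∑ j ∈ L.1, eps j L.1 • basisChain R K p' (L.1.erase j) := by
  rw [boundary, Finsupp.linearCombination_single, one_smul]

/-- The augmented simplicial chain complex of `K`, with `R` in degree `-1`. -/
noncomputable def chains (K : PreAbstractSimplicialComplex V) :
    ChainComplex (ModuleCat.{u} R) ℤ where
  X p := ModuleCat.of R (Simp K p →₀ R)
  d p p' := ModuleCat.ofHom (boundary R K p p')
  shape p p' hp := by
    rw [← ModuleCat.ofHom_zero]
    congr 1
    refine Finsupp.lhom_ext' fun L => LinearMap.ext_ring ?_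
    simp only [LinearMap.comp_apply, Finsupp.lsingle_apply, LinearMap.zero_apply]
    rw [boundary_single]
    refine Finset.sum_eq_zero fun j hj => ?_
    rw [basisChain, dif_neg]
    · simp
    · rintro ⟨-, h⟩
      have h1 := Finset.card_erase_add_one hj
      have h2 := L.2.2
      apply hp
      change p' + 1 = p
      omega
  d_comp_d' p p' p'' hp hp' := by
    change p' + 1 = p at hp
    change p'' + 1 = p' at hp'
    rw [← ModuleCat.ofHom_comp, ← ModuleCat.ofHom_zero]
    congr 1
    refine Finsupp.lhom_ext' fun L => LinearMap.ext_ring ?_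
    simp only [LinearMap.comp_apply, Finsupp.lsingle_apply, LinearMap.zero_apply]
    rw [boundary_single, map_sum]
    have : ∀ j ∈ L.1, boundary R K p' p'' (eps j L.1 • basisChain R K p' (L.1.erase j)) =
        ∑ i ∈ L.1.erase j, (eps j L.1 * eps i (L.1.erase j)) •
          basisChain R K p'' ((L.1.erase j).erase i) := by
      intro j hj
      rw [basisChain, dif_pos (erase_mem K hp L hj), map_zsmul, boundary_single, Finset.smul_sum]
      simp only [mul_smul]
    rw [Finset.sum_congr rfl this]
    refine sum_erase_eq_zero L.1 _ fun i hi j hj hij => ?_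
    rw [eps_anti_erase hi hj hij, Finset.erase_right_comm, neg_smul, neg_add_cancel]

/-- The chain map induced by the inclusion of a subcomplex. -/
noncomputable def extend {K' K : PreAbstractSimplicialComplex V} (h : K' ≤ K) :
    chains R K' ⟶ chains R K where
  f p := ModuleCat.ofHom (X := Simp K' p →₀ R) (Y := Simp K p →₀ R)
    (Finsupp.lmapDomain R R fun L => ⟨L.1, L.2.1.imp id (fun hL => h hL), L.2.2⟩)
  comm' p p' hp := by
    change p' + 1 = p at hp
    change ModuleCat.ofHom _ ≫ ModuleCat.ofHom (boundary R K p p') =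
      ModuleCat.ofHom (boundary R K' p p') ≫ ModuleCat.ofHom _
    rw [← ModuleCat.ofHom_comp, ← ModuleCat.ofHom_comp]
    congr 1
    refine Finsupp.lhom_ext' fun L => LinearMap.ext_ring ?_
    simp only [LinearMap.comp_apply, Finsupp.lsingle_apply]
    rw [boundary_single, Finsupp.lmapDomain_apply, Finsupp.mapDomain_single, boundary_single,
      map_sum]
    refine Finset.sum_congr rfl fun j hj => ?_
    have h1 := erase_mem K' hp L hj
    rw [map_zsmul, basisChain, basisChain, dif_pos h1,
      dif_pos ⟨h1.1.imp id (fun hL => h hL), h1.2⟩, Finsupp.lmapDomain_apply,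
      Finsupp.mapDomain_single]

theorem extend_comp {K'' K' K : PreAbstractSimplicialComplex V} (h : K' ≤ K) (h' : K'' ≤ K') :
    extend R h' ≫ extend R h = extend R (h'.trans h) := by
  ext p : 1
  change ModuleCat.ofHom _ ≫ ModuleCat.ofHom _ = ModuleCat.ofHom _
  rw [← ModuleCat.ofHom_comp]
  congr 1
  refine Finsupp.lhom_ext' fun L => LinearMap.ext_ring ?_
  simp [Finsupp.lmapDomain_apply, Finsupp.mapDomain_single]

/-- `H̃_p(K_I; R)`. -/
noncomputable abbrev redHomology (K : PreAbstractSimplicialComplex V) (p : ℤ) (I : Finset V) :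
    ModuleCat.{u} R :=
  (chains R (full K I)).homology p

/-- The map `H̃_p(K_I; R) → H̃_p(K_J; R)` induced by the inclusion `K_I ⊆ K_J`. -/
noncomputable def phi (K : PreAbstractSimplicialComplex V) (p : ℤ) {I J : Finset V} (h : I ⊆ J) :
    redHomology R K p I →ₗ[R] redHomology R K p J :=
  (HomologicalComplex.homologyMap (extend R (full_mono K h)) p).hom

theorem phi_phi (K : PreAbstractSimplicialComplex V) (p : ℤ) {I J T : Finset V}
    (h : I ⊆ J) (h' : J ⊆ T) (x : redHomology R K p I) :
    phi R K p h' (phi R K p h x) = phi R K p (h.trans h') x := by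
  unfold phi
  rw [← extend_comp R (full_mono K h') (full_mono K h), HomologicalComplex.homologyMap_comp]
  rfl

end Homology

/-! ### The bigraded complexes `CH^*(Z_K)` and `CH_*(Z_K)` -/

/-- Bidegrees `(-k, 2ℓ)` with a differential of bidegree `(1, -2)`. -/
abbrev cohShape : ComplexShape (ℤ × ℤ) := ComplexShape.up' ((1, -2) : ℤ × ℤ)

/-- Bidegrees `(-k, 2ℓ)` with a differential of bidegree `(-1, 2)`. -/
abbrev homShape : ComplexShape (ℤ × ℤ) := ComplexShape.up' ((-1, 2) : ℤ × ℤ)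

/-- The sign `(-1) ^ (a + b)` given by the total degree of a bidegree `(a, b)`. -/
def totalSign : Multiplicative (ℤ × ℤ) →* ℤˣ :=
  MonoidHom.mk' (fun n => (n.toAdd.1 + n.toAdd.2).negOnePow) (by
    intro m n
    rw [← Int.negOnePow_add]
    congr 1
    simp only [toAdd_mul, Prod.fst_add, Prod.snd_add]
    ring)

theorem totalSign_succ (p q δ : ℤ × ℤ) (hδ : Odd (δ.1 + δ.2)) (h : p + δ = q) :
    totalSign (Multiplicative.ofAdd q) = - totalSign (Multiplicative.ofAdd p) := by
  subst h
  change ((p + δ).1 + (p + δ).2).negOnePow = -(p.1 + p.2).negOnePow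
  have : (p + δ).1 + (p + δ).2 = (p.1 + p.2) + (δ.1 + δ.2) := by
    simp only [Prod.fst_add, Prod.snd_add]; ring
  rw [this, Int.negOnePow_add, Int.negOnePow_odd _ hδ]
  simp

/-- In tensor products, `d(x ⊗ y) = dx ⊗ y + (-1) ^ |x| x ⊗ dy` with `|x|` the total degree. -/
instance : cohShape.TensorSigns where
  ε' := totalSign
  rel_add p q r h := by
    change p + (1, -2) = q at h
    change p + r + (1, -2) = q + r
    rw [← h]; abel
  add_rel p q r h := by
    change p + (1, -2) = q at h
    change r + p + (1, -2) = r + q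
    rw [← h]; abel
  ε'_succ p q h := totalSign_succ p q (1, -2) ⟨-1, by norm_num⟩ h

/-- In tensor products, `d(x ⊗ y) = dx ⊗ y + (-1) ^ |x| x ⊗ dy` with `|x|` the total degree. -/
instance : homShape.TensorSigns where
  ε' := totalSign
  rel_add p q r h := by
    change p + (-1, 2) = q at h
    change p + r + (-1, 2) = q + r
    rw [← h]; abel
  add_rel p q r h := by
    change p + (-1, 2) = q at h
    change r + p + (-1, 2) = r + q
    rw [← h]; abel
  ε'_succ p q h := totalSign_succ p q (-1, 2) ⟨0, by norm_num⟩ h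

/-- The bidegree `(-k, 2ℓ)` of the summand `H̃^p(K_I)` (or `H̃_p(K_I)`) of the (co)homology of
the moment-angle complex: `ℓ = |I|` and `p = ℓ - k - 1`. -/
def bideg {V : Type} (x : ℤ × Finset V) : ℤ × ℤ :=
  (x.1 + 1 - (x.2.card : ℤ), 2 * (x.2.card : ℤ))

theorem bideg_insert {V : Type} [DecidableEq V] (p : ℤ) {i : V} {I : Finset V} (h : i ∉ I) :
    bideg (p, insert i I) + (1, -2) = bideg (p, I) := by
  simp only [bideg, Finset.card_insert_of_notMem h, Prod.mk_add_mk, Prod.mk.injEq]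
  push_cast
  constructor <;> ring

theorem bideg_erase {V : Type} [DecidableEq V] (p : ℤ) {i : V} {I : Finset V} (h : i ∈ I) :
    bideg (p, I.erase i) + (-1, 2) = bideg (p, I) := by
  have h1 := Finset.card_erase_add_one h
  simp only [bideg, ← h1, Prod.mk_add_mk, Prod.mk.injEq]
  push_cast
  constructor <;> ring

section CH

variable (R : Type u) [CommRing R] {V : Type} [LinearOrder V]
  (K : PreAbstractSimplicialComplex V)

/-- The component `H^{-k,2ℓ}(Z_K) = ⨁_{|I| = ℓ} H̃^{ℓ-k-1}(K_I)` in bidegree `n = (-k, 2ℓ)`.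
For finite `V` the product is over a finite set of pairs `(p, I)`, hence a direct sum. -/
abbrev CohX (n : ℤ × ℤ) : Type u :=
  ∀ x : {x : ℤ × Finset V // bideg x = n}, redCohomology R K x.1.1 x.1.2

open Classical in
/-- The map `H̃^p(K_J) → H̃^p(K_I)` precomposed with the projection to `H̃^p(K_J)`,
for a summand of bidegree `n`; zero if `H̃^p(K_J)` is not such a summand. -/
noncomputable def psiProj (n : ℤ × ℤ) (p : ℤ) {I J : Finset V} (hIJ : I ⊆ J) :
    CohX R K n →ₗ[R] redCohomology R K p I :=
  if h : bideg (p, J) = n then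
    psi R K p hIJ ∘ₗ LinearMap.proj (φ := fun x : {x : ℤ × Finset V // bideg x = n} =>
      redCohomology R K x.1.1 x.1.2) ⟨(p, J), h⟩
  else 0

/-- The differential `d' = (-1) ^ (p + 1) ∑_{i ∈ J} ε(i, J) ψ_{p;i,J}` on `H̃^p(K_J)`, written
through its components `H̃^p(K_{I ∪ {i}}) → H̃^p(K_I)`; it is zero unless `n' = n + (1, -2)`. -/
noncomputable def dPrime [Fintype V] (n n' : ℤ × ℤ) : CohX R K n →ₗ[R] CohX R K n' :=
  LinearMap.pi fun y => ∑ i ∈ (Finset.univ \ y.1.2 : Finset V),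
    (((y.1.1 + 1).negOnePow : ℤ) * eps i (insert i y.1.2)) •
      psiProj R K n y.1.1 (Finset.subset_insert i y.1.2)

theorem psiProj_congr (n : ℤ × ℤ) (p : ℤ) {I J J' : Finset V} (h : J = J') (hIJ : I ⊆ J) :
    psiProj R K n p hIJ = psiProj R K n p (h ▸ hIJ : I ⊆ J') := by
  subst h; rfl

theorem psi_psiProj (n : ℤ × ℤ) (p : ℤ) {I J T : Finset V} (h : I ⊆ J) (h' : J ⊆ T)
    (x : CohX R K n) :
    psi R K p h (psiProj R K n p h' x) = psiProj R K n p (h.trans h') x := by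
  unfold psiProj
  split_ifs with hb
  · exact psi_psi R K p h h' _
  · simp

/-- The cochain complex `CH^*(Z_K) = (H^*(Z_K), d')`, bigraded. -/
noncomputable def CHcoh [Fintype V] : HomologicalComplex (ModuleCat.{u} R) cohShape where
  X n := ModuleCat.of R (CohX R K n)
  d n n' := ModuleCat.ofHom (dPrime R K n n')
  shape n n' hn := by
    rw [← ModuleCat.ofHom_zero]
    congr 1
    refine LinearMap.ext fun x => funext fun y => ?_
    simp only [dPrime, LinearMap.pi_apply, LinearMap.sum_apply, LinearMap.zero_apply,
      Pi.zero_apply]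
    refine Finset.sum_eq_zero fun i hi => ?_
    rw [psiProj, dif_neg]
    · simp
    · intro h
      apply hn
      change n + (1, -2) = n'
      rw [← h, bideg_insert _ (Finset.mem_sdiff.1 hi).2]
      exact y.2
  d_comp_d' n n' n'' hn hn' := by
    change n + (1, -2) = n' at hn
    change n' + (1, -2) = n'' at hn'
    rw [← ModuleCat.ofHom_comp, ← ModuleCat.ofHom_zero]
    congr 1
    refine LinearMap.ext fun x => funext fun ⟨⟨p, I⟩, hy⟩ => ?_
    have key : ∀ i ∈ (Finset.univ \ I : Finset V),
        ((((p + 1).negOnePow : ℤ) * eps i (insert i I)) •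
          psiProj R K n' p (Finset.subset_insert i I)) (dPrime R K n n' x) =
        ∑ j ∈ (Finset.univ \ I : Finset V).erase i,
          (eps i I * eps j (insert i I)) • psiProj R K n p
            ((Finset.subset_insert i I).trans (Finset.subset_insert j (insert i I))) x := by
      intro i hi
      have hiI := (Finset.mem_sdiff.1 hi).2
      have hb : bideg (p, insert i I) = n' := by
        have := bideg_insert p hiI
        rw [hy, ← hn'] at this
        exact add_right_cancel this
      rw [LinearMap.smul_apply, psiProj, dif_pos hb, LinearMap.comp_apply, LinearMap.proj_apply,
        dPrime, LinearMap.pi_apply, LinearMap.sum_apply, map_sum, Finset.smul_sum]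
      have hs : (Finset.univ \ insert i I : Finset V) = (Finset.univ \ I).erase i := by
        ext v; simp [not_or]
      rw [hs]
      refine Finset.sum_congr rfl fun j hj => ?_
      rw [LinearMap.smul_apply, map_zsmul, psi_psiProj, smul_smul, eps_insert_self,
        eps_insert_self]
      congr 1
      have : ((p + 1).negOnePow : ℤ) * ((p + 1).negOnePow : ℤ) = 1 := by
        rw [← Units.val_mul, Int.units_mul_self, Units.val_one]
      linear_combination (eps i I * eps j (insert i I)) * this
    rw [LinearMap.comp_apply, LinearMap.zero_apply, Pi.zero_apply]
    rw [dPrime, LinearMap.pi_apply, LinearMap.sum_apply]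
    refine (Finset.sum_congr rfl key).trans ?_
    refine sum_erase_eq_zero _ _ fun i hi j hj hij => ?_
    rw [eps_anti (Finset.mem_sdiff.1 hi).2 (Finset.mem_sdiff.1 hj).2 hij,
      psiProj_congr R K n p (Finset.insert_comm j i I), neg_smul, neg_add_cancel]

/-- The double cohomology `HH^*(Z_K) = H(CH^*(Z_K))`, bigraded. -/
noncomputable def HHcoh [Fintype V] : GradedObject (ℤ × ℤ) (ModuleCat.{u} R) :=
  fun n => (CHcoh R K).homology n

/-- The component `H_{-k,2ℓ}(Z_K) = ⨁_{|I| = ℓ} H̃_{ℓ-k-1}(K_I)` in bidegree `n = (-k, 2ℓ)`.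
For finite `V` the product is over a finite set of pairs `(p, I)`, hence a direct sum. -/
abbrev HomX (n : ℤ × ℤ) : Type u :=
  ∀ x : {x : ℤ × Finset V // bideg x = n}, redHomology R K x.1.1 x.1.2

open Classical in
/-- The map `H̃_p(K_I) → H̃_p(K_J)` precomposed with the projection to `H̃_p(K_I)`,
for a summand of bidegree `n`; zero if `H̃_p(K_I)` is not such a summand. -/
noncomputable def phiProj (n : ℤ × ℤ) (p : ℤ) {I J : Finset V} (hIJ : I ⊆ J) :
    HomX R K n →ₗ[R] redHomology R K p J :=
  if h : bideg (p, I) = n then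
    phi R K p hIJ ∘ₗ LinearMap.proj (φ := fun x : {x : ℤ × Finset V // bideg x = n} =>
      redHomology R K x.1.1 x.1.2) ⟨(p, I), h⟩
  else 0

/-- The differential `∂' = (-1) ^ (p + 1) ∑_{j ∉ I} ε(j, I) φ_{p;I,j}` on `H̃_p(K_I)`, written
through its components `H̃_p(K_{J \ {j}}) → H̃_p(K_J)`; it is zero unless `n' = n + (-1, 2)`. -/
noncomputable def partialPrime (n n' : ℤ × ℤ) : HomX R K n →ₗ[R] HomX R K n' :=
  LinearMap.pi fun y => ∑ j ∈ y.1.2,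
    (((y.1.1 + 1).negOnePow : ℤ) * eps j (y.1.2.erase j)) •
      phiProj R K n y.1.1 (Finset.erase_subset j y.1.2)

theorem phiProj_congr (n : ℤ × ℤ) (p : ℤ) {I I' J : Finset V} (h : I = I') (hIJ : I ⊆ J) :
    phiProj R K n p hIJ = phiProj R K n p (h ▸ hIJ : I' ⊆ J) := by
  subst h; rfl

theorem phi_phiProj (n : ℤ × ℤ) (p : ℤ) {I J T : Finset V} (h : I ⊆ J) (h' : J ⊆ T)
    (x : HomX R K n) :
    phi R K p h' (phiProj R K n p h x) = phiProj R K n p (h.trans h') x := by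
  unfold phiProj
  split_ifs with hb
  · exact phi_phi R K p h h' _
  · simp

/-- The chain complex `CH_*(Z_K) = (H_*(Z_K), ∂')`, bigraded. -/
noncomputable def CHhom : HomologicalComplex (ModuleCat.{u} R) homShape where
  X n := ModuleCat.of R (HomX R K n)
  d n n' := ModuleCat.ofHom (partialPrime R K n n')
  shape n n' hn := by
    rw [← ModuleCat.ofHom_zero]
    congr 1
    refine LinearMap.ext fun x => funext fun y => ?_
    simp only [partialPrime, LinearMap.pi_apply, LinearMap.sum_apply, LinearMap.zero_apply,
      Pi.zero_apply]
    refine Finset.sum_eq_zero fun i hi => ?_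
    rw [phiProj, dif_neg]
    · simp
    · intro h
      apply hn
      change n + (-1, 2) = n'
      rw [← h, bideg_erase _ hi]
      exact y.2
  d_comp_d' n n' n'' hn hn' := by
    change n + (-1, 2) = n' at hn
    change n' + (-1, 2) = n'' at hn'
    rw [← ModuleCat.ofHom_comp, ← ModuleCat.ofHom_zero]
    congr 1
    refine LinearMap.ext fun x => funext fun ⟨⟨p, J⟩, hy⟩ => ?_
    have key : ∀ i ∈ J,
        ((((p + 1).negOnePow : ℤ) * eps i (J.erase i)) •
          phiProj R K n' p (Finset.erase_subset i J)) (partialPrime R K n n' x) =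
        ∑ j ∈ J.erase i,
          (eps i J * eps j (J.erase i)) • phiProj R K n p
            ((Finset.erase_subset j (J.erase i)).trans (Finset.erase_subset i J)) x := by
      intro i hi
      have hb : bideg (p, J.erase i) = n' := by
        have := bideg_erase p hi
        rw [hy, ← hn'] at this
        exact add_right_cancel this
      rw [LinearMap.smul_apply, phiProj, dif_pos hb, LinearMap.comp_apply, LinearMap.proj_apply,
        partialPrime, LinearMap.pi_apply, LinearMap.sum_apply, map_sum, Finset.smul_sum]
      refine Finset.sum_congr rfl fun j hj => ?_
      rw [LinearMap.smul_apply, map_zsmul, phi_phiProj, smul_smul, eps_erase_self,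
        eps_erase_self]
      congr 1
      have : ((p + 1).negOnePow : ℤ) * ((p + 1).negOnePow : ℤ) = 1 := by
        rw [← Units.val_mul, Int.units_mul_self, Units.val_one]
      linear_combination (eps i J * eps j (J.erase i)) * this
    rw [LinearMap.comp_apply, LinearMap.zero_apply, Pi.zero_apply]
    rw [partialPrime, LinearMap.pi_apply, LinearMap.sum_apply]
    refine (Finset.sum_congr rfl key).trans ?_
    refine sum_erase_eq_zero _ _ fun i hi j hj hij => ?_
    rw [eps_anti_erase hi hj hij,
      phiProj_congr R K n p (Finset.erase_right_comm (a := i) (b := j) (s := J)), neg_smul,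
      neg_add_cancel]

/-- The double homology `HH_*(Z_K) = H(CH_*(Z_K))`, bigraded. -/
noncomputable def HHhom : GradedObject (ℤ × ℤ) (ModuleCat.{u} R) :=
  fun n => (CHhom R K).homology n

end CH

end DoubleCohomology

open DoubleCohomology

/-! A simplex of the join is the disjoint union of a simplex of `K` and a simplex of `L`. Hence,
with the augmentation in degree `-1`, the (co)chains of a join are the tensor product of the
(co)chains of the factors, where degrees `p` and `q` combine to `p + q + 1`. Since the vertices of
`K` come first, the product satisfies the Leibniz rule with sign `(-1)^(p+1)`, the parity of the
number of vertices in front. Full subcomplexes of the join are joins of full subcomplexes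
(`isJoin_full`), so this applies to each pair `I`, `J`.

The Künneth theorem turns this into a decomposition of `H̃^r` of the full subcomplex on `I ⊔ J` as
the direct sum of `H̃^p(K_I) ⊗ H̃^q(L_J)` over `p + q + 1 = r`. Suppose that the homology of the
first factor `C` is projective. The terms of `C` are projective and vanish far along the
differential, so its boundaries are projective too (`projective_range_d`) and `C` deformation
retracts onto its homology (`Retraction.nonempty`). The product complex then retracts onto `H(C) ⊗
D` with differential `± 1 ⊗ d`, whose homology is `H(C) ⊗ H(D)` because `H(C)` is flat
(`Pairing.isCoprod_κ`). Nothing is required of `D`, and exchanging the factors covers the other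
case.

Summing over `I` and `J` gives an isomorphism of bigraded modules. By naturality of the product
under inclusions, it respects `d'` up to signs. On `H̃^p(K_I) ⊗ H̃^q(L_J)`, removing `j ∈ J` yields
the sign demanded by the Leibniz rule, because the total degree of the first factor is congruent to
`p + 1 + |I|` modulo 2. Removing `i ∈ I` is off by `(-1)^(q+1)`. Rescaling the product by
`(-1)^((q+1)|I|)` (`joinSign`) repairs the second case and leaves the first alone; this is
`dPrime_bigradedMul`, with `partialPrime_bigradedMul` for homology.

Over a field every module is projective, and the same abstract Künneth theorem, now for the bigraded
complexes `CH` and ordinary addition of degrees, computes the homology of the tensor product. -/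

namespace DoubleCohomology

/-! ### Direct sum decompositions -/

section IsCoprod

open scoped TensorProduct DirectSum

variable {R : Type*} [CommRing R]

open Classical in
/-- The maps `f i : M i → N` exhibit `N` as the direct sum of the modules `M i`. -/
def IsCoprod {ι : Type*} {M : ι → Type*} [∀ i, AddCommGroup (M i)] [∀ i, Module R (M i)]
    {N : Type*} [AddCommGroup N] [Module R N] (f : ∀ i, M i →ₗ[R] N) : Prop :=
  Function.Bijective (DirectSum.toModule R ι N f)

namespace IsCoprod

theorem iff_bijective {ι : Type*} [DecidableEq ι] {M : ι → Type*} [∀ i, AddCommGroup (M i)]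
    [∀ i, Module R (M i)] {N : Type*} [AddCommGroup N] [Module R N] {f : ∀ i, M i →ₗ[R] N} :
    IsCoprod f ↔ Function.Bijective (DirectSum.toModule R ι N f) := by
  obtain rfl : ‹DecidableEq ι› = fun a b => Classical.propDecidable (a = b) :=
    Subsingleton.elim _ _
  rfl

variable {ι κ : Type*} {M : ι → Type*} [∀ i, AddCommGroup (M i)] [∀ i, Module R (M i)]
  {N P : Type*} [AddCommGroup N] [Module R N] [AddCommGroup P] [Module R P]
  {f : ∀ i, M i →ₗ[R] N}

theorem congr (hf : IsCoprod f) {g : ∀ i, M i →ₗ[R] N} (h : ∀ i, g i = f i) : IsCoprod g := by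
  rwa [funext h]

open Classical in
/-- The decomposition map of a direct sum decomposition. -/
noncomputable def decomp (hf : IsCoprod f) : N →ₗ[R] ⨁ i, M i :=
  (LinearEquiv.ofBijective _ hf).symm.toLinearMap

theorem decomp_apply [DecidableEq ι] (hf : IsCoprod f) (i : ι) (x : M i) :
    hf.decomp (f i x) = DirectSum.lof R ι M i x := by
  obtain rfl : ‹DecidableEq ι› = fun a b => Classical.propDecidable (a = b) :=
    Subsingleton.elim _ _
  classical
  refine (LinearEquiv.symm_apply_eq _).2 ?_
  exact (DirectSum.toModule_lof R i x).symm

theorem toModule_decomp [DecidableEq ι] (hf : IsCoprod f) (x : N) :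
    DirectSum.toModule R ι N f (hf.decomp x) = x := by
  obtain rfl : ‹DecidableEq ι› = fun a b => Classical.propDecidable (a = b) :=
    Subsingleton.elim _ _
  classical
  exact (LinearEquiv.ofBijective _ hf).apply_symm_apply x

/-- The map out of a direct sum given by maps out of the summands. -/
noncomputable def desc (hf : IsCoprod f) (k : ∀ i, M i →ₗ[R] P) : N →ₗ[R] P := by
  classical
  exact DirectSum.toModule R ι P k ∘ₗ hf.decomp

@[simp]
theorem desc_apply (hf : IsCoprod f) (k : ∀ i, M i →ₗ[R] P) (i : ι) (x : M i) :
    hf.desc k (f i x) = k i x := by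
  classical
  simp only [desc, LinearMap.comp_apply, decomp_apply]
  convert DirectSum.toModule_lof R i x

theorem hom_ext (hf : IsCoprod f) {F G : N →ₗ[R] P} (h : ∀ i x, F (f i x) = G (f i x)) :
    F = G := by
  classical
  refine LinearMap.ext fun x => ?_
  have : F ∘ₗ DirectSum.toModule R ι N f = G ∘ₗ DirectSum.toModule R ι N f := by
    refine DirectSum.linearMap_ext R fun i => LinearMap.ext fun x => ?_
    simpa using h i x
  have h2 := LinearMap.congr_fun this (hf.decomp x)
  simpa only [LinearMap.comp_apply, hf.toModule_decomp] using h2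

/-- The images of the `M i` generate the direct sum, so it is enough to know `u` on each `f i x` for
it to be a left inverse. -/
theorem of_inverse [DecidableEq ι] (u : N →ₗ[R] ⨁ i, M i)
    (h₁ : ∀ i x, u (f i x) = DirectSum.lof R ι M i x)
    (h₂ : DirectSum.toModule R ι N f ∘ₗ u = LinearMap.id) : IsCoprod f := by
  obtain rfl : ‹DecidableEq ι› = fun a b => Classical.propDecidable (a = b) :=
    Subsingleton.elim _ _
  classical
  refine Function.bijective_iff_has_inverse.2 ⟨u, fun x => ?_, fun x => LinearMap.congr_fun h₂ x⟩
  have : u ∘ₗ DirectSum.toModule R ι N f = LinearMap.id := by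
    refine DirectSum.linearMap_ext R fun i => LinearMap.ext fun x => ?_
    simpa using h₁ i x
  exact LinearMap.congr_fun this x

open Classical in
-- The criterion by which the comparison maps out of tensor products are recognized as isomorphisms.
theorem bijective_of_comp (hf : IsCoprod f) {F : N →ₗ[R] P} (h : IsCoprod fun i => F ∘ₗ f i) :
    Function.Bijective F := by
  refine Function.bijective_iff_has_inverse.2 ⟨h.desc f, fun x => ?_, fun x => ?_⟩
  · exact LinearMap.congr_fun (hf.hom_ext (F := h.desc f ∘ₗ F) (G := LinearMap.id) fun i x => by
      simpa using h.desc_apply f i x) x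
  · exact LinearMap.congr_fun (h.hom_ext (F := F ∘ₗ h.desc f) (G := LinearMap.id) fun i x => by
      simpa using congrArg F (h.desc_apply f i x)) x

theorem sigma {α : ι → Type*} {Q : ∀ i, α i → Type*} [∀ i j, AddCommGroup (Q i j)]
    [∀ i j, Module R (Q i j)] {g : ∀ i j, Q i j →ₗ[R] M i} (hf : IsCoprod f)
    (hg : ∀ i, IsCoprod (g i)) : IsCoprod (fun x : Σ i, α i => f x.1 ∘ₗ g x.1 x.2) := by
  classical
  refine of_inverse (M := fun x : Σ i, α i => Q x.1 x.2)
    (hf.desc fun i => (hg i).desc fun j =>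
    DirectSum.lof R (Σ i, α i) (fun x => Q x.1 x.2) ⟨i, j⟩) (fun ⟨i, j⟩ y => by
      rw [LinearMap.comp_apply, desc_apply]; exact desc_apply _ _ j y) ?_
  refine hf.hom_ext fun i x => ?_
  rw [LinearMap.comp_apply, desc_apply, LinearMap.id_apply]
  have : (DirectSum.toModule R (Σ i, α i) N fun x => f x.1 ∘ₗ g x.1 x.2) ∘ₗ ((hg i).desc fun j =>
      DirectSum.lof R (Σ i, α i) (fun x => Q x.1 x.2) ⟨i, j⟩) = f i := ?_
  · have h := LinearMap.congr_fun this x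
    rw [LinearMap.comp_apply] at h
    exact h
  refine (hg i).hom_ext fun j y => ?_
  rw [LinearMap.comp_apply, desc_apply]
  exact DirectSum.toModule_lof R (M := fun x : Σ i, α i => Q x.1 x.2)
    (φ := fun x => f x.1 ∘ₗ g x.1 x.2) (⟨i, j⟩ : Σ i, α i) y

/-- Allows a decomposition to be checked on a refinement of its summands: down to single simplices
for (co)chains, and down to single pairs `(p, I)`, `(q, J)` for bigraded modules. -/
theorem of_sigma {α : ι → Type*} {Q : ∀ i, α i → Type*} [∀ i j, AddCommGroup (Q i j)]
    [∀ i j, Module R (Q i j)] {g : ∀ i j, Q i j →ₗ[R] M i}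
    (h : IsCoprod (fun x : Σ i, α i => f x.1 ∘ₗ g x.1 x.2))
    (hg : ∀ i, IsCoprod (g i)) : IsCoprod f := by
  classical
  have key : ∀ i x, (h.desc fun x => DirectSum.lof R ι M x.1 ∘ₗ g x.1 x.2) (f i x) =
      DirectSum.lof R ι M i x := fun i x =>
    LinearMap.congr_fun ((hg i).hom_ext
      (F := (h.desc fun x => DirectSum.lof R ι M x.1 ∘ₗ g x.1 x.2) ∘ₗ f i) fun j y =>
      h.desc_apply (fun x => DirectSum.lof R ι M x.1 ∘ₗ g x.1 x.2) ⟨i, j⟩ y) x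
  refine of_inverse _ key (h.hom_ext fun x y => ?_)
  simp only [LinearMap.comp_apply, key]
  simp

theorem reindex {e : κ → ι} (he : Function.Bijective e) (hf : IsCoprod f) :
    IsCoprod fun k => f (e k) := by
  classical
  -- On the summand `i` the inverse is the inclusion at the unique `k` with `e k = i`. Quantifying
  -- over this equation confines the transport of `x` to the specification of `F`.
  have key3 : ∀ i, ∃ F : M i →ₗ[R] ⨁ k, M (e k), ∀ x k (h : e k = i),
      F x = DirectSum.lof R κ (fun k => M (e k)) k (h ▸ x) := by
    intro i
    obtain ⟨k, rfl⟩ := he.2 i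
    refine ⟨DirectSum.lof R κ (fun k => M (e k)) k, fun x k' h' => ?_⟩
    obtain rfl := he.1 h'
    rfl
  choose F hF using key3
  refine of_inverse (hf.desc F) (fun k x => ?_) (hf.hom_ext fun i x => ?_)
  · rw [desc_apply, hF _ _ k rfl]
  · obtain ⟨k, rfl⟩ := he.2 i
    simp [hF _ _ k rfl]

theorem comp_equiv {Q : ι → Type*} [∀ i, AddCommGroup (Q i)] [∀ i, Module R (Q i)]
    (hf : IsCoprod f) (e : ∀ i, Q i ≃ₗ[R] M i) : IsCoprod fun i => f i ∘ₗ (e i).toLinearMap := by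
  classical
  refine of_inverse (hf.desc fun i => DirectSum.lof R ι Q i ∘ₗ (e i).symm.toLinearMap)
    (fun i x => by simp) (hf.hom_ext fun i x => by simp)

theorem tensor {M' : κ → Type*} [∀ i, AddCommGroup (M' i)] [∀ i, Module R (M' i)]
    {f' : ∀ i, M' i →ₗ[R] P} (hf : IsCoprod f) (hf' : IsCoprod f') :
    IsCoprod fun x : ι × κ => TensorProduct.map (f x.1) (f' x.2) := by
  classical
  refine of_inverse (M := fun x : ι × κ => M x.1 ⊗[R] M' x.2)
    ((TensorProduct.directSum R R M M').toLinearMap ∘ₗ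
    TensorProduct.map hf.decomp hf'.decomp) (fun i x => ?_) ?_
  · induction x with
    | zero => simp
    | add x y hx hy => rw [map_add, map_add, hx, hy, map_add]
    | tmul x y =>
      simp only [TensorProduct.map_tmul, LinearMap.comp_apply, decomp_apply]
      exact TensorProduct.directSum_lof_tmul_lof (R := R) R i.1 x i.2 y
  · refine TensorProduct.ext (hf.hom_ext fun i x => hf'.hom_ext fun j y => ?_)
    rw [LinearMap.compr₂ₛₗ_apply, LinearMap.compr₂ₛₗ_apply]
    change DirectSum.toModule R (ι × κ) (N ⊗[R] P) (fun x => TensorProduct.map (f x.1) (f' x.2))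
      (TensorProduct.directSum R R M M' (hf.decomp (f i x) ⊗ₜ hf'.decomp (f' j y))) = _
    rw [decomp_apply, decomp_apply, TensorProduct.directSum_lof_tmul_lof]
    exact (DirectSum.toModule_lof R (M := fun x : ι × κ => M x.1 ⊗[R] M' x.2)
      (φ := fun x => TensorProduct.map (f x.1) (f' x.2)) (i, j) (x ⊗ₜ y))

open Classical in
theorem pi_single [Finite ι] : IsCoprod (LinearMap.single R M) := by
  cases nonempty_fintype ι
  have h2 : (DirectSum.toModule R ι _ (LinearMap.single R M)) =
      (DirectSum.linearEquivFunOnFintype R ι M).toLinearMap :=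
    DirectSum.linearMap_ext R fun i => LinearMap.ext fun x => by
      simp
  unfold IsCoprod
  rw [h2]
  exact (DirectSum.linearEquivFunOnFintype R ι M).bijective

theorem finsupp_lsingle : IsCoprod fun _ : ι => (Finsupp.lsingle ‹ι› : N →ₗ[R] ι →₀ N) := by
  classical
  refine of_inverse (M := fun _ : ι => N)
    (Finsupp.lsum R (fun i => DirectSum.lof R ι (fun _ => N) i)) (fun i x => ?_) ?_
  · simp
  · refine Finsupp.lhom_ext fun i x => ?_
    simp

theorem of_isColimit {R : Type u} [CommRing R] {ι : Type} {X : ι → ModuleCat.{u} R}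
    (c : Limits.Cofan X)
    (hc : Limits.IsColimit c) : IsCoprod fun i => (c.inj i).hom := by
  classical
  have key (i) (x : X i) : (Limits.Cofan.IsColimit.desc hc fun i =>
        ModuleCat.ofHom (Y := ⨁ i, X i) (DirectSum.lof R ι (fun i => X i) i)).hom (c.inj i x) =
        DirectSum.lof R ι (fun i => X i) i x := by
    exact LinearMap.congr_fun (congrArg ModuleCat.Hom.hom
      (Limits.Cofan.IsColimit.fac hc _ i)) x
  refine of_inverse _ key ?_
  have := Limits.Cofan.IsColimit.hom_ext hc (f := (Limits.Cofan.IsColimit.desc hc fun i =>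
        ModuleCat.ofHom (Y := ⨁ i, X i) (DirectSum.lof R ι (fun i => X i) i)) ≫
        ModuleCat.ofHom (DirectSum.toModule R ι _ fun i => (c.inj i).hom)) (g := 𝟙 _) ?_
  · exact congrArg ModuleCat.Hom.hom this
  · intro i
    ext x
    have := congrArg (DirectSum.toModule R ι _ fun i => (c.inj i).hom) (key i x)
    simp

end IsCoprod

end IsCoprod

/-! ### Homology classes -/

section Classes

variable {R : Type u} [CommRing R] {ι : Type*} {c : ComplexShape ι}
  (C : HomologicalComplex (ModuleCat.{u} R) c)

/-- The cycles of a complex of modules, as a submodule. -/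
noncomputable def cyc (a : ι) : Submodule R (C.X a) := LinearMap.ker (C.d a (c.next a)).hom

theorem mem_cyc_iff {a b : ι} (h : c.Rel a b) {x : C.X a} : x ∈ cyc C a ↔ C.d a b x = 0 := by
  obtain rfl := c.next_eq' h
  rfl

theorem d_eq_zero_of_mem_cyc {a : ι} {x : C.X a} (h : x ∈ cyc C a) (b : ι) : C.d a b x = 0 := by
  by_cases hb : c.Rel a b
  · exact (mem_cyc_iff C hb).1 h
  · rw [C.shape _ _ hb]; rfl

theorem d_mem_cyc (a b : ι) (x : C.X a) : C.d a b x ∈ cyc C b := by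
  change (C.d b (c.next b)) (C.d a b x) = 0
  rw [← ConcreteCategory.comp_apply, C.d_comp_d]; rfl

/-- The inclusion of the cycles, with values in the categorical cycles. -/
noncomputable def toCyc (a : ι) : ModuleCat.of R (cyc C a) ⟶ C.cycles a :=
  C.liftCycles (ModuleCat.ofHom (cyc C a).subtype) _ rfl (by
    ext x; exact x.2)

theorem iCycles_toCyc (a : ι) (x : cyc C a) : C.iCycles a (toCyc C a x) = x.1 := by
  have := C.liftCycles_i (ModuleCat.ofHom (cyc C a).subtype) _ rfl (by
    ext x; exact x.2)
  exact LinearMap.congr_fun (congrArg ModuleCat.Hom.hom this) x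

theorem iCycles_injective (a : ι) : Function.Injective (C.iCycles a) :=
  (ModuleCat.mono_iff_injective _).1 inferInstance

/-- The homology class of a cycle. -/
noncomputable def cls (a : ι) : cyc C a →ₗ[R] C.homology a :=
  (toCyc C a ≫ C.homologyπ a).hom

theorem cls_surjective (a : ι) : Function.Surjective (cls C a) := by
  intro y
  obtain ⟨z, rfl⟩ := (ModuleCat.epi_iff_surjective (C.homologyπ a)).1 inferInstance y
  have hz : C.iCycles a z ∈ cyc C a := by
    change (C.iCycles a ≫ C.d a _) z = 0
    rw [C.iCycles_d]; rfl
  refine ⟨⟨C.iCycles a z, hz⟩, ?_⟩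
  change C.homologyπ a (toCyc C a ⟨C.iCycles a z, hz⟩) = _
  congr 1
  exact iCycles_injective C a (iCycles_toCyc C a _)

theorem cls_eq_zero_iff {a b : ι} (h : c.Rel b a) (z : cyc C a) :
    cls C a z = 0 ↔ ∃ y, C.d b a y = z.1 := by
  -- Homology is the cokernel of the map to cycles from the actual predecessor `b`.
  have ex : (ShortComplex.mk (C.toCycles b a) (C.homologyπ a) (by simp)).Exact :=
    ShortComplex.exact_of_g_is_cokernel _ (C.homologyIsCokernel b a (c.prev_eq' h))
  rw [ShortComplex.moduleCat_exact_iff] at ex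
  constructor
  · intro hz
    obtain ⟨y, hy⟩ := ex _ hz
    refine ⟨y, ?_⟩
    rw [← iCycles_toCyc C a z, ← C.toCycles_i b a]
    exact congrArg (C.iCycles a) hy
  · rintro ⟨y, hy⟩
    have : toCyc C a z = C.toCycles b a y := by
      apply iCycles_injective C a
      rw [iCycles_toCyc, ← hy, ← C.toCycles_i b a]
      rfl
    change C.homologyπ a (toCyc C a z) = 0
    rw [this, ← ConcreteCategory.comp_apply, C.toCycles_comp_homologyπ]
    rfl

theorem cls_d {b a : ι} (y : C.X b) : cls C a ⟨C.d b a y, d_mem_cyc C b a y⟩ = 0 := by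
  by_cases h : c.Rel b a
  · exact (cls_eq_zero_iff C h _).2 ⟨y, rfl⟩
  · have : (⟨C.d b a y, d_mem_cyc C b a y⟩ : cyc C a) = 0 := by
      ext; change C.d b a y = 0
      rw [C.shape _ _ h]; rfl
    rw [this, map_zero]

variable {C} in
theorem map_mem_cyc {D : HomologicalComplex (ModuleCat.{u} R) c} (φ : C ⟶ D) {a : ι} {z : C.X a}
    (hz : z ∈ cyc C a) : φ.f a z ∈ cyc D a := by
  change (φ.f a ≫ D.d a _) z = 0
  rw [φ.comm]
  change φ.f _ (C.d a _ z) = 0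
  rw [d_eq_zero_of_mem_cyc C hz, map_zero]

variable {C} in
theorem homologyMap_cls {D : HomologicalComplex (ModuleCat.{u} R) c} (φ : C ⟶ D) (a : ι)
    (z : cyc C a) : HomologicalComplex.homologyMap φ a (cls C a z) =
      cls D a ⟨φ.f a z.1, map_mem_cyc φ z.2⟩ := by
  change (C.homologyπ a ≫ HomologicalComplex.homologyMap φ a) (toCyc C a z) =
    D.homologyπ a (toCyc D a _)
  rw [HomologicalComplex.homologyπ_naturality]
  change D.homologyπ a _ = _
  congr 1
  apply iCycles_injective D a
  rw [iCycles_toCyc]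
  change (HomologicalComplex.cyclesMap φ a ≫ D.iCycles a) (toCyc C a z) = _
  rw [HomologicalComplex.cyclesMap_i]
  change φ.f a (C.iCycles a (toCyc C a z)) = _
  rw [iCycles_toCyc]

end Classes

/-! ### Splitting complexes with projective homology -/

section Retraction

variable {R : Type u} [CommRing R] {ι : Type*} {c : ComplexShape ι}

/-- A deformation retraction of a complex of modules onto its homology. -/
structure Retraction (C : HomologicalComplex (ModuleCat.{u} R) c) where
  f : ∀ a, C.homology a →ₗ[R] C.X a
  g : ∀ a, C.X a →ₗ[R] C.homology a
  h : ∀ a b, C.X a →ₗ[R] C.X b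
  f_mem : ∀ a x, f a x ∈ cyc C a
  cls_f : ∀ a x, cls C a ⟨f a x, f_mem a x⟩ = x
  g_f : ∀ a x, g a (f a x) = x
  g_d : ∀ a b x, g b (C.d a b x) = 0
  homotopy : ∀ a b e, c.Rel b a → c.Rel a e → ∀ x,
    x = f a (g a x) + C.d b a (h a b x) + h e a (C.d a e x)

/-- Subtracting the chosen representative of its class leaves a cycle of class zero. This is the
projection of the cycles onto the boundaries. -/
theorem cls_section_mem {C : HomologicalComplex (ModuleCat.{u} R) c} {a b : ι} (hab : c.Rel a b)
    {s : C.homology b →ₗ[R] cyc C b} (hs : ∀ x, cls C b (s x) = x) (z : cyc C b) :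
    (z - s (cls C b z)).1 ∈ LinearMap.range (C.d a b).hom :=
  (cls_eq_zero_iff C hab _).1 (by rw [map_sub, hs, sub_self])

theorem exists_cls_section (C : HomologicalComplex (ModuleCat.{u} R) c) (a : ι)
    [Module.Projective R (C.homology a)] :
    ∃ s : C.homology a →ₗ[R] cyc C a, ∀ x, cls C a (s x) = x := by
  obtain ⟨s, hs⟩ := Module.projective_lifting_property (cls C a) LinearMap.id (cls_surjective C a)
  exact ⟨s, fun x => LinearMap.congr_fun hs x⟩

theorem exists_d_section (C : HomologicalComplex (ModuleCat.{u} R) c) (a b : ι)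
    [Module.Projective R (LinearMap.range (C.d a b).hom)] :
    ∃ t : LinearMap.range (C.d a b).hom →ₗ[R] C.X a, ∀ y, C.d a b (t y) = y.1 := by
  obtain ⟨t, ht⟩ := Module.projective_lifting_property (C.d a b).hom.rangeRestrict LinearMap.id
    (LinearMap.surjective_rangeRestrict _)
  exact ⟨t, fun x => congrArg Subtype.val (LinearMap.congr_fun ht x)⟩

/-- Subtracting the chosen preimage `t (d x)` removes the non-cycle part of `x`; the resulting map
is a projection onto the cycles. -/
theorem sub_section_mem_cyc {C : HomologicalComplex (ModuleCat.{u} R) c} {a : ι}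
    {t : LinearMap.range (C.d a (c.next a)).hom →ₗ[R] C.X a}
    (ht : ∀ y, C.d a (c.next a) (t y) = y.1) (x : C.X a) :
    (LinearMap.id - t ∘ₗ (C.d a (c.next a)).hom.rangeRestrict : C.X a →ₗ[R] C.X a) x ∈
      cyc C a := by
  change C.d a (c.next a) _ = 0
  rw [LinearMap.sub_apply, map_sub, LinearMap.comp_apply, ht]
  exact sub_self _

/-- Projectivity provides sections `t` of the differentials and `s` of the class maps. They split
each term into representatives of homology, boundaries, and a complement mapped isomorphically to
the next boundaries. The homotopy is `t` on the boundary summand and zero on the other two. -/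
theorem Retraction.nonempty (C : HomologicalComplex (ModuleCat.{u} R) c)
    (hB : ∀ a b, Module.Projective R (LinearMap.range (C.d a b).hom))
    (hH : ∀ a, Module.Projective R (C.homology a)) : Nonempty (Retraction C) := by
  classical
  choose s hs using fun a => exists_cls_section C a
  choose t ht using fun a b => exists_d_section C a b
  -- The projection `x ↦ x - t (d x)` onto the cycles.
  let r (a : ι) : C.X a →ₗ[R] cyc C a := LinearMap.codRestrict _ _
    (sub_section_mem_cyc (ht a (c.next a)))
  have hr (a) (z : cyc C a) : r a z.1 = z := by
    ext
    change z.1 - t a _ ((C.d a (c.next a)).hom.rangeRestrict z.1) = z.1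
    have : (C.d a (c.next a)).hom.rangeRestrict z.1 = 0 := Subtype.ext z.2
    rw [this, map_zero, sub_zero]
  refine ⟨{
    f := fun a => (cyc C a).subtype ∘ₗ s a
    g := fun a => cls C a ∘ₗ r a
    h := fun b a => if hab : c.Rel a b then t a b ∘ₗ LinearMap.codRestrict _
        ((cyc C b).subtype ∘ₗ (r b - s b ∘ₗ cls C b ∘ₗ r b))
        (fun y => cls_section_mem hab (hs b) (r b y)) else 0
    f_mem := fun a x => (s a x).2
    cls_f := fun a x => hs a x
    g_f := fun a x => ?_
    g_d := fun a b x => ?_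
    homotopy := fun a b e hb he x => ?_ }⟩
  · change cls C a (r a (s a x).1) = x
    rw [hr, hs]
  · change cls C b (r b (C.d a b x)) = 0
    rw [hr b ⟨_, d_mem_cyc C a b x⟩, cls_d]
  · obtain rfl := c.next_eq' he
    rw [dif_pos hb, dif_pos he]
    have h1 : C.d b a (t b a ⟨(r a x - s a (cls C a (r a x))).1,
        cls_section_mem hb (hs a) (r a x)⟩) = (r a x).1 - (s a (cls C a (r a x))).1 := ht _ _ _
    -- A boundary is a cycle of class zero, so the projection onto the boundaries fixes it. Hence `h
    -- (d x) = t (d x) = x - r x`.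
    have h2 : (r _ (C.d a (c.next a) x) - s _ (cls C _ (r _ (C.d a (c.next a) x)))).1 =
        C.d a (c.next a) x := by
      rw [hr _ ⟨_, d_mem_cyc C a (c.next a) x⟩, cls_d, map_zero, sub_zero]
    have h3 : t a (c.next a) ⟨(r _ (C.d a (c.next a) x) -
        s _ (cls C _ (r _ (C.d a (c.next a) x)))).1,
        cls_section_mem he (hs _) (r _ (C.d a (c.next a) x))⟩ = x - (r a x).1 := by
      have : (r a x).1 = x - t a (c.next a) ⟨C.d a (c.next a) x, ⟨x, rfl⟩⟩ := rfl
      rw [this, sub_sub_cancel]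
      exact congrArg _ (Subtype.ext h2)
    change x = (s a (cls C a (r a x))).1 + C.d b a (t b a ⟨(r a x - s a (cls C a (r a x))).1,
        cls_section_mem hb (hs a) (r a x)⟩) + t a (c.next a) ⟨(r _ (C.d a (c.next a) x) -
        s _ (cls C _ (r _ (C.d a (c.next a) x)))).1,
        cls_section_mem he (hs _) (r _ (C.d a (c.next a) x))⟩
    rw [h1, h3]
    abel

/-- In a complex of projective modules with projective homology that vanishes in the direction of
the differential, the boundaries are projective. -/
theorem projective_range_d [AddCommGroup ι] {δ : ι} (hc : ∀ a b, c.Rel a b ↔ a + δ = b)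
    (C : HomologicalComplex (ModuleCat.{u} R) c)
    (hC : ∀ a, Module.Projective R (C.X a)) (hH : ∀ a, Module.Projective R (C.homology a))
    (hb : ∀ a, ∃ N : ℕ, Subsingleton (C.X (a + N • δ))) (a b : ι) :
    Module.Projective R (LinearMap.range (C.d a b).hom) := by
  -- Induction on the number of steps from `b` to a vanishing term. If the boundaries one step
  -- further are projective, the cycles split off from `C.X b`; projective homology splits the
  -- boundaries off from the cycles. So the boundaries are a direct summand of the projective module
  -- `C.X b`.
  have key : ∀ (N : ℕ) (b : ι), Subsingleton (C.X (b + N • δ)) → ∀ a,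
      Module.Projective R (LinearMap.range (C.d a b).hom) := by
    intro N
    induction N with
    | zero =>
      intro b hb a
      rw [zero_smul, add_zero] at hb
      infer_instance
    | succ N ih =>
      intro b hb a
      have hb' : c.Rel b (c.next b) := by
        have : c.Rel b (b + δ) := (hc _ _).2 rfl
        rwa [c.next_eq' this]
      have h1 := ih (c.next b) (by
        rw [← (hc _ _).1 hb']
        rwa [succ_nsmul', ← add_assoc] at hb) b
      obtain ⟨t, ht⟩ := exists_d_section C b (c.next b)
      obtain ⟨s, hs⟩ := exists_cls_section C b
      let r : C.X b →ₗ[R] cyc C b := LinearMap.codRestrict _ _ (sub_section_mem_cyc ht)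
      by_cases hab : c.Rel a b
      · refine Module.Projective.of_split (M := C.X b) (P := LinearMap.range (C.d a b).hom)
          (LinearMap.range (C.d a b).hom).subtype
          (LinearMap.codRestrict _ ((cyc C b).subtype ∘ₗ (r - s ∘ₗ cls C b ∘ₗ r))
            (fun x => cls_section_mem hab hs (r x))) (LinearMap.ext fun ⟨y, x, hx⟩ => ?_)
        ext
        have h2 : r y = ⟨C.d a b x, d_mem_cyc C a b x⟩ := by
          subst hx
          ext
          change C.d a b x - t ((C.d b (c.next b)).hom.rangeRestrict (C.d a b x)) = C.d a b x
          have : (C.d b (c.next b)).hom.rangeRestrict (C.d a b x) = 0 :=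
            Subtype.ext (d_mem_cyc C a b x)
          rw [this, map_zero, sub_zero]
        change (r y - s (cls C b (r y))).1 = y
        rw [h2, cls_d, map_zero, sub_zero]
        exact hx
      · rw [C.shape _ _ hab]
        have : LinearMap.range (0 : C.X a ⟶ C.X b).hom = ⊥ := LinearMap.range_zero
        rw [this]
        infer_instance
  obtain ⟨N, hN⟩ := hb b
  exact key N b hN a

end Retraction

/-! ### The Künneth theorem -/

section Kunneth

open scoped TensorProduct DirectSum

variable {R : Type u} [CommRing R] {ι : Type} [AddCommGroup ι] {c : ComplexShape ι}

/-- The complex shape `c` has differentials of degree `δ`, and `σ` and `χ` are the degrees and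
signs for products of complexes of that shape. -/
structure IsPairingShape (c : ComplexShape ι) (δ : ι) (σ : ι → ι → ι) (χ : ι → ℤˣ) : Prop where
  rel_iff : ∀ a b, c.Rel a b ↔ a + δ = b
  add_left : ∀ a b, σ (a + δ) b = σ a b + δ
  add_right : ∀ a b, σ a (b + δ) = σ a b + δ
  sign_add : ∀ a, χ (a + δ) = -χ a

/-- A product of complexes: maps `C a ⊗ D b → E (σ a b)` that satisfy the Leibniz rule. -/
structure Pairing (σ : ι → ι → ι) (χ : ι → ℤˣ)
    (C D E : HomologicalComplex (ModuleCat.{u} R) c) where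
  μ : ∀ a b n, σ a b = n → (C.X a ⊗[R] D.X b →ₗ[R] E.X n)
  leibniz : ∀ {a a' b b' n n'}, c.Rel a a' → c.Rel b b' → ∀ (h : σ a b = n) (h₁ : σ a' b = n')
    (h₂ : σ a b' = n') (x : C.X a) (y : D.X b), E.d n n' (μ a b n h (x ⊗ₜ y)) =
      μ a' b n' h₁ (C.d a a' x ⊗ₜ y) + χ a • μ a b' n' h₂ (x ⊗ₜ D.d b b' y)

namespace Pairing

variable {δ : ι} {σ : ι → ι → ι} {χ : ι → ℤˣ} (S : IsPairingShape c δ σ χ)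
  {C D E : HomologicalComplex (ModuleCat.{u} R) c} (P : Pairing σ χ C D E)

include S in
theorem _root_.DoubleCohomology.IsPairingShape.rel_succ (a : ι) : c.Rel a (a + δ) :=
  (S.rel_iff _ _).2 rfl

include S in
theorem μ_cyc {a b n : ι} (h : σ a b = n) {x : C.X a} {y : D.X b} (hx : x ∈ cyc C a)
    (hy : y ∈ cyc D b) : P.μ a b n h (x ⊗ₜ y) ∈ cyc E n := by
  rw [mem_cyc_iff E (S.rel_succ n), P.leibniz (S.rel_succ a) (S.rel_succ b) h
    (by rw [S.add_left, h]) (by rw [S.add_right, h]), d_eq_zero_of_mem_cyc C hx,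
    d_eq_zero_of_mem_cyc D hy]
  simp

include S in
theorem μ_d_left {a a' b n n' : ι} (ha : c.Rel a a') (h : σ a b = n) (h' : σ a' b = n')
    (x : C.X a) {y : D.X b} (hy : y ∈ cyc D b) :
    P.μ a' b n' h' (C.d a a' x ⊗ₜ y) = E.d n n' (P.μ a b n h (x ⊗ₜ y)) := by
  obtain rfl := (S.rel_iff _ _).1 ha
  rw [P.leibniz ha (S.rel_succ b) h h' (by rw [S.add_right, ← h', S.add_left]),
    d_eq_zero_of_mem_cyc D hy]
  simp

include S in
theorem μ_d_right {a b b' n n' : ι} (hb : c.Rel b b') (h : σ a b = n) (h' : σ a b' = n')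
    {x : C.X a} (hx : x ∈ cyc C a) (y : D.X b) :
    P.μ a b' n' h' (x ⊗ₜ D.d b b' y) = E.d n n' (χ a • P.μ a b n h (x ⊗ₜ y)) := by
  obtain rfl := (S.rel_iff _ _).1 hb
  rw [Units.smul_def, map_zsmul, ← Units.smul_def,
    P.leibniz (S.rel_succ a) hb h (by rw [S.add_left, ← h', S.add_right]) h',
    d_eq_zero_of_mem_cyc C hx]
  simp [smul_smul, Int.units_mul_self]

/-- The product of cycles. -/
noncomputable def cycMul (a b n : ι) (h : σ a b = n) :
    cyc C a ⊗[R] cyc D b →ₗ[R] cyc E n :=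
  LinearMap.codRestrict _ (P.μ a b n h ∘ₗ
    TensorProduct.map (cyc C a).subtype (cyc D b).subtype) fun z => by
    induction z with
    | zero => simp
    | add x y hx hy => rw [map_add]; exact add_mem hx hy
    | tmul x y => exact P.μ_cyc S h x.2 y.2

/-- The kernel of a tensor product of surjections is generated by the two kernels, and the product
of a boundary with a cycle, in either order, is a boundary. This is what makes the product descend
to homology. -/
theorem ker_map_cls_le (a b n : ι) (h : σ a b = n) :
    LinearMap.ker (TensorProduct.map (cls C a) (cls D b)) ≤
      LinearMap.ker (cls E n ∘ₗ P.cycMul S a b n h) := by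
  have h1 : σ (a - δ) b = n - δ := by rw [← h, eq_sub_iff_add_eq, ← S.add_left, sub_add_cancel]
  have h2 : σ a (b - δ) = n - δ := by rw [← h, eq_sub_iff_add_eq, ← S.add_right, sub_add_cancel]
  have hr (a : ι) : c.Rel (a - δ) a := (S.rel_iff _ _).2 (sub_add_cancel _ _)
  rw [TensorProduct.map_ker (LinearMap.exact_subtype_ker_map (cls C a)) (cls_surjective C a)
    (LinearMap.exact_subtype_ker_map (cls D b)) (cls_surjective D b), sup_le_iff]
  constructor
  · rintro _ ⟨z, rfl⟩
    induction z with
    | zero => simp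
    | add x y hx hy => rw [map_add]; exact add_mem hx hy
    | tmul x y =>
      obtain ⟨w, hw⟩ := (cls_eq_zero_iff D (hr b) _).1 y.2
      refine (cls_eq_zero_iff E (hr n) _).2 ⟨χ a • P.μ _ _ _ h2 (x.1 ⊗ₜ w), ?_⟩
      rw [← P.μ_d_right S (hr b) h2 h x.2, hw]
      rfl
  · rintro _ ⟨z, rfl⟩
    induction z with
    | zero => simp
    | add x y hx hy => rw [map_add]; exact add_mem hx hy
    | tmul x y =>
      obtain ⟨w, hw⟩ := (cls_eq_zero_iff C (hr a) _).1 x.2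
      refine (cls_eq_zero_iff E (hr n) _).2 ⟨P.μ _ _ _ h1 (w ⊗ₜ y.1), ?_⟩
      rw [← P.μ_d_left S (hr a) h1 h _ y.2, hw]
      rfl

/-- The product induced on homology. -/
noncomputable def κ (a b n : ι) (h : σ a b = n) :
    C.homology a ⊗[R] D.homology b →ₗ[R] E.homology n :=
  (LinearMap.ker (TensorProduct.map (cls C a) (cls D b))).liftQ _ (P.ker_map_cls_le S a b n h) ∘ₗ
    (LinearMap.quotKerEquivOfSurjective (TensorProduct.map (cls C a) (cls D b))
      (TensorProduct.map_surjective (cls_surjective C a) (cls_surjective D b))).symm.toLinearMap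

theorem κ_map_cls (a b n : ι) (h : σ a b = n) (z : cyc C a ⊗[R] cyc D b) :
    P.κ S a b n h (TensorProduct.map (cls C a) (cls D b) z) = cls E n (P.cycMul S a b n h z) := by
  have : (LinearMap.quotKerEquivOfSurjective (TensorProduct.map (cls C a) (cls D b))
      (TensorProduct.map_surjective (cls_surjective C a) (cls_surjective D b))).symm
      (TensorProduct.map (cls C a) (cls D b) z) = Submodule.Quotient.mk z := by
    rw [LinearEquiv.symm_apply_eq]; rfl
  rw [κ, LinearMap.comp_apply, LinearEquiv.coe_coe, this]
  rfl

theorem κ_cls_tmul (a b n : ι) (h : σ a b = n) (x : cyc C a) (y : cyc D b) :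
    P.κ S a b n h (cls C a x ⊗ₜ cls D b y) =
      cls E n ⟨P.μ a b n h (x.1 ⊗ₜ y.1), P.μ_cyc S h x.2 y.2⟩ :=
  P.κ_map_cls S a b n h (x ⊗ₜ y)

section Retract

variable (r : Retraction C) (hμ : ∀ n, IsCoprod
  fun x : {x : ι × ι // σ x.1 x.2 = n} => P.μ x.1.1 x.1.2 n x.2)

/-- The projection of the product complex to the product with the homology of the first factor. -/
noncomputable def retract (n : ι) :
    E.X n →ₗ[R] ⨁ x : {x : ι × ι // σ x.1 x.2 = n}, C.homology x.1.1 ⊗[R] D.X x.1.2 := by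
  classical
  exact (hμ n).desc fun x => DirectSum.lof R _
    (fun x : {x : ι × ι // σ x.1 x.2 = n} => C.homology x.1.1 ⊗[R] D.X x.1.2) x ∘ₗ
      LinearMap.rTensor _ (r.g x.1.1)

omit [AddCommGroup ι] in
open Classical in
theorem retract_μ (n a b : ι) (h : σ a b = n) (x : C.X a) (y : D.X b) :
    P.retract r hμ n (P.μ a b n h (x ⊗ₜ y)) = DirectSum.lof R _
      (fun x : {x : ι × ι // σ x.1 x.2 = n} => C.homology x.1.1 ⊗[R] D.X x.1.2) ⟨(a, b), h⟩
        (r.g a x ⊗ₜ y) :=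
  (hμ n).desc_apply _ ⟨(a, b), h⟩ (x ⊗ₜ y)

open Classical in
/-- The inclusion of the product with the homology of the first factor. -/
noncomputable def incl (n : ι) :
    (⨁ x : {x : ι × ι // σ x.1 x.2 = n}, C.homology x.1.1 ⊗[R] D.X x.1.2) →ₗ[R] E.X n :=
  DirectSum.toModule R _ _ fun x => P.μ x.1.1 x.1.2 n x.2 ∘ₗ LinearMap.rTensor _ (r.f x.1.1)

omit [AddCommGroup ι] in
open Classical in
theorem incl_lof (n : ι) (x : {x : ι × ι // σ x.1 x.2 = n}) (y : C.homology x.1.1 ⊗[R] D.X x.1.2) :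
    P.incl r n (DirectSum.lof R _
      (fun x : {x : ι × ι // σ x.1 x.2 = n} => C.homology x.1.1 ⊗[R] D.X x.1.2) x y) =
      P.μ x.1.1 x.1.2 n x.2 (LinearMap.rTensor _ (r.f x.1.1) y) :=
  DirectSum.toModule_lof R (M := fun x : {x : ι × ι // σ x.1 x.2 = n} =>
    C.homology x.1.1 ⊗[R] D.X x.1.2) x y

omit [AddCommGroup ι] in
theorem incl_retract_μ (n a b : ι) (h : σ a b = n) (x : C.X a) (y : D.X b) :
    P.incl r n (P.retract r hμ n (P.μ a b n h (x ⊗ₜ y))) =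
      P.μ a b n h (r.f a (r.g a x) ⊗ₜ y) := by
  rw [retract_μ]
  exact P.incl_lof r n ⟨(a, b), h⟩ (r.g a x ⊗ₜ y)

omit [AddCommGroup ι] in
theorem retract_incl (n : ι) (t) : P.retract r hμ n (P.incl r n t) = t := by
  classical
  refine LinearMap.congr_fun (f := P.retract r hμ n ∘ₗ P.incl r n) (g := LinearMap.id)
    (DirectSum.linearMap_ext R fun ⟨⟨a, b⟩, h⟩ => TensorProduct.ext' fun x y => ?_) t
  refine (congrArg (P.retract r hμ n) (P.incl_lof r n ⟨(a, b), h⟩ (x ⊗ₜ y))).trans ?_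
  refine (P.retract_μ r hμ n a b h (r.f a x) y).trans ?_
  rw [r.g_f]
  rfl

/-- The homotopy on the product complex. -/
noncomputable def homotopy (n n' : ι) : E.X n →ₗ[R] E.X n' := by
  classical
  exact (hμ n).desc fun x => if h : σ (x.1.1 - δ) x.1.2 = n' then
    P.μ (x.1.1 - δ) x.1.2 n' h ∘ₗ LinearMap.rTensor _ (r.h x.1.1 (x.1.1 - δ)) else 0

include S in
theorem homotopy_μ {n n' a a' b : ι} (ha : c.Rel a' a) (h : σ a b = n) (h' : σ a' b = n')
    (x : C.X a) (y : D.X b) : P.homotopy (δ := δ) r hμ n n' (P.μ a b n h (x ⊗ₜ y)) =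
      P.μ a' b n' h' (r.h a a' x ⊗ₜ y) := by
  obtain rfl : a' = a - δ := eq_sub_of_add_eq ((S.rel_iff _ _).1 ha)
  refine ((hμ n).desc_apply _ ⟨(a, b), h⟩ (x ⊗ₜ y)).trans ?_
  rw [dif_pos h']
  rfl

include S in
-- On a product of `x` and `y` this is the homotopy identity for `x`, multiplied by `y`. The two
-- terms containing `h x` and `d y` cancel because `χ (a + δ) = -χ a`.
theorem homotopy_eq {n n' n'' : ι} (hn : c.Rel n' n) (hn' : c.Rel n n'') (e : E.X n) :
    e = P.incl r n (P.retract r hμ n e) + E.d n' n (P.homotopy (δ := δ) r hμ n n' e) +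
      P.homotopy (δ := δ) r hμ n'' n (E.d n n'' e) := by
  refine LinearMap.congr_fun (f := LinearMap.id) (g := P.incl r n ∘ₗ P.retract r hμ n +
    (E.d n' n).hom ∘ₗ P.homotopy (δ := δ) r hμ n n' + P.homotopy (δ := δ) r hμ n'' n ∘ₗ
      (E.d n n'').hom) ((hμ n).hom_ext fun ⟨⟨a, b⟩, h⟩ z => LinearMap.congr_fun
        (f := LinearMap.id ∘ₗ P.μ a b n h) (g := (P.incl r n ∘ₗ P.retract r hμ n +
    (E.d n' n).hom ∘ₗ P.homotopy (δ := δ) r hμ n n' + P.homotopy (δ := δ) r hμ n'' n ∘ₗ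
      (E.d n n'').hom) ∘ₗ P.μ a b n h) (TensorProduct.ext' fun x y => ?_) z) e
  obtain rfl := (S.rel_iff _ _).1 hn'
  obtain ⟨a', rfl⟩ : ∃ a', a = a' + δ := ⟨a - δ, by simp⟩
  have ha : c.Rel a' (a' + δ) := S.rel_succ a'
  have hb := S.rel_succ b
  have h1 : σ a' b = n' := by
    have := (S.rel_iff _ _).1 hn
    change σ (a' + δ) b = n at h
    rw [S.add_left, ← this] at h
    exact add_right_cancel h
  have h2 : σ a' (b + δ) = n := by rw [S.add_right, h1, (S.rel_iff _ _).1 hn]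
  change P.μ (a' + δ) b n h (x ⊗ₜ y) = P.incl r n (P.retract r hμ n (P.μ _ b n h (x ⊗ₜ y))) +
    E.d n' n (P.homotopy (δ := δ) r hμ n n' (P.μ _ b n h (x ⊗ₜ y))) +
      P.homotopy (δ := δ) r hμ _ n (E.d n (n + δ) (P.μ _ b n h (x ⊗ₜ y)))
  rw [P.leibniz (S.rel_succ _) hb h (by rw [S.add_left, h]) (by rw [S.add_right, h]), map_add,
    P.incl_retract_μ r hμ, P.homotopy_μ S r hμ ha h h1, P.leibniz ha hb h1 h h2, S.sign_add,
    P.homotopy_μ S r hμ (S.rel_succ _) _ h, Units.smul_def (-χ a'), map_zsmul,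
    P.homotopy_μ S r hμ ha _ h2]
  nth_rewrite 1 [r.homotopy (a' + δ) a' _ ha (S.rel_succ _) x]
  rw [TensorProduct.add_tmul, TensorProduct.add_tmul, map_add, map_add, Units.smul_def,
    Units.val_neg, neg_smul]
  abel

include S in
-- The retraction kills boundaries of `C`, so of the two Leibniz terms only the one with the
-- differential of `D` survives.
theorem component_retract_d {n n' a b b' : ι} (hb : c.Rel b b') (h : σ a b = n)
    (h' : σ a b' = n') (e : E.X n) :
    P.retract r hμ n' (E.d n n' e) ⟨(a, b'), h'⟩ =
      χ a • LinearMap.lTensor (C.homology a) (D.d b b').hom (P.retract r hμ n e ⟨(a, b), h⟩) := by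
  classical
  let X (n : ι) (x : {x : ι × ι // σ x.1 x.2 = n}) := C.homology x.1.1 ⊗[R] D.X x.1.2
  refine LinearMap.congr_fun (f := DirectSum.component R _ (X n') ⟨(a, b'), h'⟩ ∘ₗ
    P.retract r hμ n' ∘ₗ (E.d n n').hom) (g := (χ a : ℤ) • LinearMap.lTensor (C.homology a)
      (D.d b b').hom ∘ₗ DirectSum.component R _ (X n) ⟨(a, b), h⟩ ∘ₗ P.retract r hμ n)
      ((hμ n).hom_ext fun ⟨⟨p, q⟩, hpq⟩ z => ?_) e
  change σ p q = n at hpq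
  have hn : c.Rel n n' := by
    rw [S.rel_iff, ← h, ← h', ← (S.rel_iff _ _).1 hb, S.add_right]
  obtain rfl := (S.rel_iff _ _).1 hn
  induction z with
  | zero => simp
  | add x y hx hy => rw [map_add, map_add, map_add, hx, hy]
  | tmul x y =>
    have e1 := P.leibniz (S.rel_succ p) (S.rel_succ q) hpq (by rw [S.add_left, hpq])
      (by rw [S.add_right, hpq]) x y
    change P.retract r hμ (n + δ) (E.d n (n + δ) (P.μ p q n hpq (x ⊗ₜ y))) ⟨(a, b'), h'⟩ =
      (χ a : ℤ) • LinearMap.lTensor (C.homology a) (D.d b b').hom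
        (P.retract r hμ n (P.μ p q n hpq (x ⊗ₜ y)) ⟨(a, b), h⟩)
    rw [e1, map_add, P.retract_μ r hμ, Units.smul_def, map_zsmul, P.retract_μ r hμ,
      P.retract_μ r hμ, r.g_d, TensorProduct.zero_tmul, map_zero, zero_add]
    -- A product from any other pair of degrees contributes to neither component, and both sides
    -- vanish.
    by_cases hab : p = a ∧ q = b
    · obtain ⟨rfl, rfl⟩ := hab
      obtain rfl := (S.rel_iff _ _).1 hb
      have e2 := DirectSum.component.lof_self R (M := X n) ⟨(p, q), hpq⟩ (r.g p x ⊗ₜ y)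
      have e3 := DirectSum.component.lof_self R (M := X (n + δ)) ⟨(p, q + δ), h'⟩
        (r.g p x ⊗ₜ D.d q (q + δ) y)
      exact (congrArg (fun z => (χ p : ℤ) • z) e3).trans
        (congrArg (fun z => (χ p : ℤ) • LinearMap.lTensor _ (D.d q (q + δ)).hom z) e2).symm
    · have e2 := DirectSum.component.of R (M := X n) ⟨(a, b), h⟩ ⟨(p, q), hpq⟩ (r.g p x ⊗ₜ y)
      have e3 := DirectSum.component.of R (M := X (n + δ)) ⟨(a, b'), h'⟩
        ⟨(p, q + δ), by rw [S.add_right, hpq]⟩ (r.g p x ⊗ₜ D.d q (q + δ) y)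
      rw [dif_neg (by simpa using hab)] at e2
      rw [dif_neg (by simpa [← (S.rel_iff _ _).1 hb] using hab)] at e3
      refine (congrArg (fun z => (χ p : ℤ) • z) e3).trans ?_
      refine Eq.trans ?_
        (congrArg (fun z => (χ a : ℤ) • LinearMap.lTensor _ (D.d b b').hom z) e2).symm
      simp

end Retract

end Pairing

end Kunneth

/-! ### Bijectivity of the product on homology, and exchange of the factors -/

section Kunneth

open scoped TensorProduct DirectSum

variable {R : Type u} [CommRing R] {ι : Type} [AddCommGroup ι] {c : ComplexShape ι}

namespace Pairing

variable {δ : ι} {σ : ι → ι → ι} {χ : ι → ℤˣ} (S : IsPairingShape c δ σ χ)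
  {C D E : HomologicalComplex (ModuleCat.{u} R) c} (P : Pairing σ χ C D E)

section Retract

variable (r : Retraction C) (hμ : ∀ n, IsCoprod
  fun x : {x : ι × ι // σ x.1 x.2 = n} => P.μ x.1.1 x.1.2 n x.2)

open Classical in
/-- The product of homology classes of `C` with cycles of `D`, as cycles of `E`. -/
noncomputable def cycIncl (n : ι) :
    (⨁ x : {x : ι × ι // σ x.1 x.2 = n}, C.homology x.1.1 ⊗[R] cyc D x.1.2) →ₗ[R] cyc E n :=
  DirectSum.toModule R _ _ fun x => P.cycMul S x.1.1 x.1.2 n x.2 ∘ₗ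
    LinearMap.rTensor _ (LinearMap.codRestrict (cyc C x.1.1) (r.f x.1.1) (r.f_mem x.1.1))

open Classical in
theorem cycIncl_lof (n : ι) (x : {x : ι × ι // σ x.1 x.2 = n}) (y : C.homology x.1.1)
    (z : cyc D x.1.2) : P.cycIncl S r n (DirectSum.lof R _
      (fun x : {x : ι × ι // σ x.1 x.2 = n} => C.homology x.1.1 ⊗[R] cyc D x.1.2) x (y ⊗ₜ z)) =
      P.cycMul S x.1.1 x.1.2 n x.2 (⟨r.f x.1.1 y, r.f_mem _ y⟩ ⊗ₜ z) :=
  DirectSum.toModule_lof R (M := fun x : {x : ι × ι // σ x.1 x.2 = n} =>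
    C.homology x.1.1 ⊗[R] cyc D x.1.2) x (y ⊗ₜ z)

theorem cycIncl_val (n : ι) (w) : (P.cycIncl S r n w).1 = P.incl r n (DirectSum.lmap
    (fun x : {x : ι × ι // σ x.1 x.2 = n} =>
      LinearMap.lTensor (C.homology x.1.1) (cyc D x.1.2).subtype) w) := by
  classical
  refine LinearMap.congr_fun (f := (cyc E n).subtype ∘ₗ P.cycIncl S r n)
    (g := P.incl r n ∘ₗ DirectSum.lmap (fun x : {x : ι × ι // σ x.1 x.2 = n} =>
      LinearMap.lTensor (C.homology x.1.1) (cyc D x.1.2).subtype))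
    (DirectSum.linearMap_ext R fun x => TensorProduct.ext' fun y z => ?_) w
  refine (congrArg Subtype.val (P.cycIncl_lof S r n x y z)).trans ?_
  refine Eq.trans ?_ (congrArg (P.incl r n) (DirectSum.lmap_lof (R := R)
    (M := fun x : {x : ι × ι // σ x.1 x.2 = n} => C.homology x.1.1 ⊗[R] cyc D x.1.2)
    (fun x : {x : ι × ι // σ x.1 x.2 = n} =>
      LinearMap.lTensor (C.homology x.1.1) (cyc D x.1.2).subtype) x (y ⊗ₜ z))).symm
  exact (P.incl_lof r n x (y ⊗ₜ z.1)).symm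

open Classical in
-- Together with `cycIncl_val` this reduces statements about `κ` to statements about `H(C) ⊗ cyc D`
-- inside `H(C) ⊗ D`.
theorem cls_cycIncl (n : ι) (w) : cls E n (P.cycIncl S r n w) =
    DirectSum.toModule R _ _ (fun x : {x : ι × ι // σ x.1 x.2 = n} => P.κ S x.1.1 x.1.2 n x.2)
    (DirectSum.lmap (fun x : {x : ι × ι // σ x.1 x.2 = n} =>
      LinearMap.lTensor (C.homology x.1.1) (cls D x.1.2)) w) := by
  refine LinearMap.congr_fun (f := cls E n ∘ₗ P.cycIncl S r n)
    (g := DirectSum.toModule R _ _ (fun x : {x : ι × ι // σ x.1 x.2 = n} =>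
      P.κ S x.1.1 x.1.2 n x.2) ∘ₗ DirectSum.lmap (fun x : {x : ι × ι // σ x.1 x.2 = n} =>
      LinearMap.lTensor (C.homology x.1.1) (cls D x.1.2)))
    (DirectSum.linearMap_ext R fun x => TensorProduct.ext' fun y z => ?_) w
  refine (congrArg (cls E n) (P.cycIncl_lof S r n x y z)).trans ?_
  refine Eq.trans ?_ (congrArg (DirectSum.toModule R _ _
    (fun x : {x : ι × ι // σ x.1 x.2 = n} => P.κ S x.1.1 x.1.2 n x.2)) (DirectSum.lmap_lof (R := R)
    (M := fun x : {x : ι × ι // σ x.1 x.2 = n} => C.homology x.1.1 ⊗[R] cyc D x.1.2)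
    (fun x : {x : ι × ι // σ x.1 x.2 = n} =>
      LinearMap.lTensor (C.homology x.1.1) (cls D x.1.2)) x (y ⊗ₜ z))).symm
  refine Eq.trans ?_ (DirectSum.toModule_lof R (M := fun x : {x : ι × ι // σ x.1 x.2 = n} =>
    C.homology x.1.1 ⊗[R] D.homology x.1.2) x (y ⊗ₜ cls D x.1.2 z)).symm
  rw [← κ_map_cls, TensorProduct.map_tmul, r.cls_f]

include r hμ in
/-- The Künneth theorem for a complex that retracts onto its flat homology. -/
theorem isCoprod_κ (hC : ∀ a, Module.Flat R (C.homology a)) (n : ι) :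
    IsCoprod fun x : {x : ι × ι // σ x.1 x.2 = n} => P.κ S x.1.1 x.1.2 n x.2 := by
  classical
  have hr (a : ι) : c.Rel (a - δ) a := (S.rel_iff _ _).2 (sub_add_cancel _ _)
  rw [IsCoprod.iff_bijective]
  constructor
  · rw [← LinearMap.ker_eq_bot, LinearMap.ker_eq_bot']
    intro u hu
    -- Injectivity: `u` is represented by a sum `w` of classes of `C` tensored with cycles of `D`,
    -- whose product is a boundary `d e`. Retracting this equation shows each component of `w` to be
    -- `± (1 ⊗ d)` of a component of the retraction of `e`.
    obtain ⟨w, rfl⟩ := (DirectSum.lmap_surjective (R := R)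
      (fun x : {x : ι × ι // σ x.1 x.2 = n} =>
        LinearMap.lTensor (C.homology x.1.1) (cls D x.1.2))).2
      (fun x => LinearMap.lTensor_surjective _ (cls_surjective D _)) u
    rw [← P.cls_cycIncl S r n w, cls_eq_zero_iff E (hr n)] at hu
    obtain ⟨e, he⟩ := hu
    rw [P.cycIncl_val S r n] at he
    have hw := P.retract_incl r hμ n (DirectSum.lmap
      (fun x : {x : ι × ι // σ x.1 x.2 = n} =>
        LinearMap.lTensor (C.homology x.1.1) (cyc D x.1.2).subtype) w)
    rw [← he] at hw
    refine DFinsupp.ext fun ⟨⟨a, b⟩, h⟩ => ?_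
    have h' : σ a (b - δ) = n - δ := by
      change σ a b = n at h
      rw [← h, eq_sub_iff_add_eq, ← S.add_right, sub_add_cancel]
    have h2 := P.component_retract_d S r hμ (hr b) h' h e
    rw [hw] at h2
    change LinearMap.lTensor (C.homology a) (cyc D b).subtype (w ⟨(a, b), h⟩) = _ at h2
    let dc : D.X (b - δ) →ₗ[R] cyc D b :=
      LinearMap.codRestrict _ (D.d (b - δ) b).hom (d_mem_cyc D _ _)
    have h3 : (D.d (b - δ) b).hom = (cyc D b).subtype ∘ₗ dc := rfl
    have h4 : cls D b ∘ₗ dc = 0 := LinearMap.ext fun y => cls_d D y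
    rw [h3, LinearMap.lTensor_comp, LinearMap.comp_apply, Units.smul_def, ← map_zsmul] at h2
    -- So far the equation holds in `H(C) ⊗ D`; flatness cancels the inclusion of `H(C) ⊗ cyc D`,
    -- where classes can be taken.
    have h5 := Module.Flat.lTensor_preserves_injective_linearMap (M := C.homology a) _
      (cyc D b).injective_subtype h2
    change LinearMap.lTensor (C.homology a) (cls D b) (w ⟨(a, b), h⟩) = 0
    rw [h5, map_zsmul, ← LinearMap.comp_apply, ← LinearMap.lTensor_comp, h4,
      LinearMap.lTensor_zero, LinearMap.zero_apply, smul_zero]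
  · intro y
    obtain ⟨e, rfl⟩ := cls_surjective E n y
    -- Surjectivity: the retraction of a cycle is killed by `1 ⊗ d`, and by flatness the kernel of
    -- `1 ⊗ d` is the image of `H(C) ⊗ cyc D`.
    obtain ⟨w, hw⟩ : P.retract r hμ n e.1 ∈ LinearMap.range (DirectSum.lmap
        (fun x : {x : ι × ι // σ x.1 x.2 = n} =>
          LinearMap.lTensor (C.homology x.1.1) (cyc D x.1.2).subtype)) := by
      rw [DirectSum.range_lmap]
      rintro ⟨⟨a, b⟩, h⟩ -
      have h2 := P.component_retract_d S r hμ (S.rel_succ b) h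
        (n' := n + δ) (by rw [S.add_right]; exact congrArg (· + δ) h) e.1
      rw [d_eq_zero_of_mem_cyc E e.2, map_zero] at h2
      have ex : Function.Exact (cyc D b).subtype (D.d b (b + δ)).hom := fun z => by
        rw [← mem_cyc_iff D (S.rel_succ b)]
        simp
      refine (Module.Flat.lTensor_exact (C.homology a) ex _).1 ?_
      rw [Units.smul_def] at h2
      have h3 := congrArg (fun z => (χ a : ℤ) • z) h2
      simp only [smul_smul, ← Units.val_mul, Int.units_mul_self, Units.val_one, one_smul] at h3
      refine h3.symm.trans ?_
      exact smul_zero _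
    refine ⟨DirectSum.lmap (fun x : {x : ι × ι // σ x.1 x.2 = n} =>
      LinearMap.lTensor (C.homology x.1.1) (cls D x.1.2)) w, ?_⟩
    rw [← P.cls_cycIncl S r n w]
    -- The homotopy shows that `e` differs from the product of cycles `w` by a boundary.
    have he := P.homotopy_eq S r hμ (hr n) (S.rel_succ n) e.1
    rw [d_eq_zero_of_mem_cyc E e.2, map_zero, add_zero, ← hw, ← P.cycIncl_val S r n] at he
    have he' : e = P.cycIncl S r n w + ⟨_, d_mem_cyc E (n - δ) n
      (P.homotopy (δ := δ) r hμ n (n - δ) e.1)⟩ := Subtype.ext he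
    rw [he', map_add, cls_d, add_zero]

end Retract

/-- The product with the factors exchanged. -/
noncomputable def flip (τ : ι → ι → ℤˣ) (hl : ∀ a b, τ (a + δ) b = χ b * τ a b)
    (hr : ∀ a b, τ a (b + δ) = χ a * τ a b) : Pairing (fun b a => σ a b) χ D C E where
  μ b a n h := (τ a b : ℤ) • P.μ a b n h ∘ₗ (TensorProduct.comm R (D.X b) (C.X a)).toLinearMap
  leibniz {b b' a a' n n'} hb ha h h₁ h₂ y x := by
    obtain rfl := (S.rel_iff _ _).1 ha
    obtain rfl := (S.rel_iff _ _).1 hb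
    change E.d n n' ((τ a b : ℤ) • P.μ a b n h (x ⊗ₜ y)) =
      (τ a (b + δ) : ℤ) • P.μ a (b + δ) n' h₁ (x ⊗ₜ D.d b (b + δ) y) +
      χ b • ((τ (a + δ) b : ℤ) • P.μ (a + δ) b n' h₂ (C.d a (a + δ) x ⊗ₜ y))
    rw [map_zsmul, P.leibniz ha hb h h₂ h₁, hl, hr, Units.smul_def, Units.smul_def, smul_add,
      smul_smul, smul_smul, ← Units.val_mul, ← Units.val_mul, ← mul_assoc, Int.units_mul_self,
      one_mul, add_comm, mul_comm (τ a b)]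

include S in
theorem isCoprod_flip (τ : ι → ι → ℤˣ) (hl : ∀ a b, τ (a + δ) b = χ b * τ a b)
    (hr : ∀ a b, τ a (b + δ) = χ a * τ a b) (n : ι)
    (hμ : IsCoprod fun x : {x : ι × ι // σ x.1 x.2 = n} => P.μ x.1.1 x.1.2 n x.2) :
    IsCoprod fun x : {x : ι × ι // σ x.2 x.1 = n} =>
      (P.flip S τ hl hr).μ x.1.1 x.1.2 n x.2 := by
  let e : {x : ι × ι // σ x.2 x.1 = n} ≃ {x : ι × ι // σ x.1 x.2 = n} :=
    (Equiv.prodComm ι ι).subtypeEquiv fun _ => Iff.rfl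
  have h := (hμ.reindex e.bijective).comp_equiv (fun x => (LinearEquiv.smulOfUnit
    (Units.map (Int.castRingHom R).toMonoidHom (τ x.1.2 x.1.1))).trans
      (TensorProduct.comm R (D.X x.1.1) (C.X x.1.2)))
  convert h using 2 with x
  refine LinearMap.ext fun z => ?_
  change (τ x.1.2 x.1.1 : ℤ) • P.μ _ _ _ _ (TensorProduct.comm R _ _ z) =
    P.μ _ _ _ _ (TensorProduct.comm R _ _ (((τ x.1.2 x.1.1 : ℤ) : R) • z))
  rw [map_smul, map_smul, Int.cast_smul_eq_zsmul]

theorem κ_flip (τ : ι → ι → ℤˣ) (hl : ∀ a b, τ (a + δ) b = χ b * τ a b)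
    (hr : ∀ a b, τ a (b + δ) = χ a * τ a b) (S' : IsPairingShape c δ (fun b a => σ a b) χ)
    (a b n : ι) (h : σ a b = n) (z : C.homology a ⊗[R] D.homology b) :
    (P.flip S τ hl hr).κ S' b a n h (TensorProduct.comm R _ _ z) =
      (τ a b : ℤ) • P.κ S a b n h z := by
  induction z with
  | zero => simp
  | add x y hx hy => simp only [map_add, hx, hy, smul_add]
  | tmul x y =>
    obtain ⟨x, rfl⟩ := cls_surjective C a x
    obtain ⟨y, rfl⟩ := cls_surjective D b y
    rw [TensorProduct.comm_tmul, κ_cls_tmul, κ_cls_tmul, ← map_zsmul]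
    rfl

/-- Transfers the Künneth theorem to the case where the second factor is the one that retracts onto
its homology. The signs `τ` are units and do not affect the decomposition. -/
theorem isCoprod_κ_of_flip (τ : ι → ι → ℤˣ) (hl : ∀ a b, τ (a + δ) b = χ b * τ a b)
    (hr : ∀ a b, τ a (b + δ) = χ a * τ a b) (r : Retraction D) (hμ : ∀ n, IsCoprod
      fun x : {x : ι × ι // σ x.1 x.2 = n} => P.μ x.1.1 x.1.2 n x.2)
    (hD : ∀ a, Module.Flat R (D.homology a)) (n : ι) :
    IsCoprod fun x : {x : ι × ι // σ x.1 x.2 = n} => P.κ S x.1.1 x.1.2 n x.2 := by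
  have S' : IsPairingShape c δ (fun b a => σ a b) χ :=
    ⟨S.rel_iff, fun a b => S.add_right b a, fun a b => S.add_left b a, S.sign_add⟩
  have h1 := (P.flip S τ hl hr).isCoprod_κ S' r
    (fun n => P.isCoprod_flip S τ hl hr n (hμ n)) hD n
  let e : {x : ι × ι // σ x.1 x.2 = n} ≃ {x : ι × ι // σ x.2 x.1 = n} :=
    (Equiv.prodComm ι ι).subtypeEquiv fun _ => Iff.rfl
  have h := (h1.reindex e.bijective).comp_equiv (fun x => (LinearEquiv.smulOfUnit
    (Units.map (Int.castRingHom R).toMonoidHom (τ x.1.1 x.1.2))).trans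
      (TensorProduct.comm R (C.homology x.1.1) (D.homology x.1.2)))
  convert h using 2 with x
  refine LinearMap.ext fun z => ?_
  refine ((P.κ_flip S τ hl hr S' x.1.1 x.1.2 n x.2 (((τ x.1.1 x.1.2 : ℤ) : R) • z)).trans ?_).symm
  rw [Int.cast_smul_eq_zsmul, map_zsmul, smul_smul, ← Units.val_mul,
    Int.units_mul_self, Units.val_one, one_smul]

end Pairing

end Kunneth

/-! ### Tensor products of complexes of modules -/

section TensorComplex

open scoped TensorProduct
open HomologicalComplex
open scoped MonoidalCategory

variable {R : Type u} [CommRing R] {ι : Type} [AddCommGroup ι] [DecidableEq ι]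
  {c : ComplexShape ι} [c.TensorSigns]

theorem isCoprod_ιMapObj {I J : Type} (X : GradedObject I (ModuleCat.{u} R)) (p : I → J)
    [X.HasMap p] (n : J) :
    IsCoprod fun i : {i // p i = n} => (X.ιMapObj p i.1 n i.2).hom :=
  IsCoprod.of_isColimit (X.cofanMapObj p n) (X.isColimitCofanMapObj p n)

omit [DecidableEq ι] in
theorem isPairingShape_add {δ : ι} (hc : ∀ a b, c.Rel a b ↔ a + δ = b) :
    IsPairingShape c δ (· + ·) c.ε where
  rel_iff := hc
  add_left _ _ := add_right_comm _ _ _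
  add_right _ _ := (add_assoc _ _ _).symm
  sign_add _ := c.ε_succ ((hc _ _).2 rfl)

variable (C D E : HomologicalComplex (ModuleCat.{u} R) c)

/-- The canonical product of two complexes with values in their tensor product. -/
noncomputable def tensorPairing : Pairing (· + ·) c.ε C D (tensorObj C D) where
  μ a b n h := (ιTensorObj C D a b n h).hom
  leibniz {a a' b b' n n'} ha hb h h₁ h₂ x y := by
    have e : ιTensorObj C D a b n h ≫ (tensorObj C D).d n n' =
        (C.d a a' ▷ D.X b) ≫ ιTensorObj C D a' b n' h₁ +
          (c.ε a : ℤ) • (C.X a ◁ D.d b b') ≫ ιTensorObj C D a b' n' h₂ := by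
      rw [mapBifunctor.d_eq, Preadditive.comp_add, mapBifunctor.ι_D₁, mapBifunctor.ι_D₂,
        mapBifunctor.d₁_eq _ _ _ _ ha _ _ h₁, mapBifunctor.d₂_eq _ _ _ _ _ hb _ h₂,
        ← Units.smul_def]
      congr 1
      -- In the total complex the differential of the first factor carries the sign 1.
      exact one_smul ℤˣ _
    exact LinearMap.congr_fun (congrArg ModuleCat.Hom.hom e) (x ⊗ₜ y)

theorem isCoprod_tensorPairing (n : ι) : IsCoprod fun x : {x : ι × ι // x.1 + x.2 = n} =>
    (tensorPairing C D).μ x.1.1 x.1.2 n x.2 :=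
  isCoprod_ιMapObj (((GradedObject.mapBifunctor (MonoidalCategory.curriedTensor (ModuleCat.{u} R))
    ι ι).obj C.X).obj D.X) (fun x => x.1 + x.2) n

variable {C D E}

/-- The map out of the tensor product of complexes given by a product of complexes. -/
noncomputable def Pairing.tensorMap (P : Pairing (· + ·) c.ε C D E) (n : ι) :
    (tensorObj C D).X n ⟶ E.X n :=
  mapBifunctorDesc (K₁ := C) (K₂ := D) (F := MonoidalCategory.curriedTensor _) (c := c)
    fun a b h => (ModuleCat.ofHom (P.μ a b n h) : C.X a ⊗ D.X b ⟶ E.X n)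

theorem Pairing.tensorMap_comp_μ (P : Pairing (· + ·) c.ε C D E) {n a b : ι} (h : a + b = n) :
    (P.tensorMap n).hom ∘ₗ (tensorPairing C D).μ a b n h = P.μ a b n h :=
  congrArg ModuleCat.Hom.hom (ι_mapBifunctorDesc (K₁ := C) (K₂ := D)
    (F := MonoidalCategory.curriedTensor _) (c := c)
    (fun a b h => (ModuleCat.ofHom (P.μ a b n h) : C.X a ⊗ D.X b ⟶ E.X n)) a b h)

/-- The morphism out of the tensor product of complexes given by a product of complexes. -/
noncomputable def Pairing.tensorHom {δ : ι} (hc : ∀ a b, c.Rel a b ↔ a + δ = b)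
    (P : Pairing (· + ·) c.ε C D E) : tensorObj C D ⟶ E where
  f := P.tensorMap
  comm' n n' hn := by
    have S := isPairingShape_add hc
    have hμ {n a b} (h) (x : C.X a) (y : D.X b) :
        P.tensorMap n ((tensorPairing C D).μ a b n h (x ⊗ₜ y)) = P.μ a b n h (x ⊗ₜ y) :=
      LinearMap.congr_fun (P.tensorMap_comp_μ h) (x ⊗ₜ y)
    refine ModuleCat.hom_ext ((isCoprod_tensorPairing C D n).hom_ext fun ⟨⟨a, b⟩, h⟩ z => ?_)
    change a + b = n at h
    obtain rfl := (hc _ _).1 hn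
    induction z with
    | zero => simp
    | add x y hx hy => rw [map_add, map_add, map_add, hx, hy]
    | tmul x y =>
      have h₁ := (S.add_left a b).trans (congrArg (· + δ) h)
      have h₂ := (S.add_right a b).trans (congrArg (· + δ) h)
      change E.d n (n + δ) (P.tensorMap n ((tensorPairing C D).μ a b n h (x ⊗ₜ y))) =
        P.tensorMap (n + δ)
          ((tensorObj C D).d n (n + δ) ((tensorPairing C D).μ a b n h (x ⊗ₜ y)))
      rw [hμ, P.leibniz (S.rel_succ a) (S.rel_succ b) h h₁ h₂,
        (tensorPairing C D).leibniz (S.rel_succ a) (S.rel_succ b) h h₁ h₂, map_add,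
        Units.smul_def, Units.smul_def, map_zsmul, hμ, hμ]

/-- A complex with a product that decomposes its terms is the tensor product. -/
theorem Pairing.nonempty_iso {δ : ι} (hc : ∀ a b, c.Rel a b ↔ a + δ = b)
    (P : Pairing (· + ·) c.ε C D E) (hP : ∀ n, IsCoprod fun x : {x : ι × ι // x.1 + x.2 = n} =>
      P.μ x.1.1 x.1.2 n x.2) : Nonempty (E ≅ tensorObj C D) := by
  have (n : ι) : IsIso ((P.tensorHom hc).f n) := by
    have h : Function.Bijective ((P.tensorHom hc).f n).hom := by
      refine (isCoprod_tensorPairing C D n).bijective_of_comp ?_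
      exact (hP n).congr fun x => P.tensorMap_comp_μ x.2
    exact (ConcreteCategory.isIso_iff_bijective _).2 h
  have := HomologicalComplex.Hom.isIso_of_components (P.tensorHom hc)
  exact ⟨(asIso (P.tensorHom hc)).symm⟩

/-- The Künneth theorem over a field. -/
theorem nonempty_homology_tensorObj_iso {F : Type u} [Field F] {δ : ι}
    (hc : ∀ a b, c.Rel a b ↔ a + δ = b) (C D : HomologicalComplex (ModuleCat.{u} F) c) :
    Nonempty ((fun n => (tensorObj C D).homology n : GradedObject ι (ModuleCat.{u} F)) ≅
      GradedObject.Monoidal.tensorObj (fun n => C.homology n) (fun n => D.homology n)) := by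
  -- Over a field boundaries and homology are projective, so no boundedness is needed.
  obtain ⟨r⟩ := Retraction.nonempty C (fun _ _ => inferInstance) (fun _ => inferInstance)
  have hκ := (tensorPairing C D).isCoprod_κ (isPairingShape_add hc) r (isCoprod_tensorPairing C D)
    (fun _ => inferInstance)
  let Ψ (n a b : ι) (h : a + b = n) : C.homology a ⊗ D.homology b ⟶ (tensorObj C D).homology n :=
    ModuleCat.ofHom ((tensorPairing C D).κ (isPairingShape_add hc) a b n h)
  let φ (n : ι) : (GradedObject.Monoidal.tensorObj (fun n => C.homology n)
      (fun n => D.homology n) : GradedObject ι (ModuleCat.{u} F)) n ⟶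
      (tensorObj C D).homology n := GradedObject.Monoidal.tensorObjDesc (Ψ n)
  have (n : ι) : IsIso (φ n) := by
    have h : Function.Bijective (φ n).hom := by
      refine (isCoprod_ιMapObj (((GradedObject.mapBifunctor
        (MonoidalCategory.curriedTensor (ModuleCat.{u} F)) ι ι).obj fun n => C.homology n).obj
          fun n => D.homology n) (fun x => x.1 + x.2) n).bijective_of_comp ?_
      refine (hκ n).congr fun x => ?_
      exact congrArg ModuleCat.Hom.hom
        (GradedObject.Monoidal.ι_tensorObjDesc (Ψ n) x.1.1 x.1.2 x.2)
    exact (ConcreteCategory.isIso_iff_bijective _).2 h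
  exact ⟨(GradedObject.isoMk _ _ fun n => asIso (φ n)).symm⟩

end TensorComplex

/-! ### Joins of simplices -/

set_option linter.unusedSectionVars false

section Join

variable {V W : Type} [LinearOrder V] [LinearOrder W]

/-- The disjoint union `A ⊔ B ⊆ V ⊔ W`. -/
def dsum (A : Finset V) (B : Finset W) : Finset (Lex (V ⊕ W)) :=
  (A.disjSum B).map toLex.toEmbedding

@[simp]
theorem inl_mem_dsum {A : Finset V} {B : Finset W} {v : V} :
    toLex (Sum.inl v) ∈ dsum A B ↔ v ∈ A := by
  simp [dsum]

@[simp]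
theorem inr_mem_dsum {A : Finset V} {B : Finset W} {w : W} :
    toLex (Sum.inr w) ∈ dsum A B ↔ w ∈ B := by
  simp [dsum]

theorem ext_sum {S T : Finset (Lex (V ⊕ W))}
    (hl : ∀ v, toLex (Sum.inl v) ∈ S ↔ toLex (Sum.inl v) ∈ T)
    (hr : ∀ w, toLex (Sum.inr w) ∈ S ↔ toLex (Sum.inr w) ∈ T) : S = T := by
  ext x
  obtain ⟨x, rfl⟩ := toLex.surjective x
  rcases x with v | w
  · exact hl v
  · exact hr w

theorem card_dsum (A : Finset V) (B : Finset W) : (dsum A B).card = A.card + B.card := by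
  simp [dsum]

theorem sum_dsum {M : Type*} [AddCommMonoid M] (A : Finset V) (B : Finset W)
    (f : Lex (V ⊕ W) → M) : ∑ m ∈ dsum A B, f m =
      ∑ i ∈ A, f (toLex (Sum.inl i)) + ∑ j ∈ B, f (toLex (Sum.inr j)) := by
  simp [dsum, Finset.sum_disjSum]

theorem erase_inl [DecidableEq (Lex (V ⊕ W))] (A : Finset V) (B : Finset W) (i : V) :
    (dsum A B).erase (toLex (Sum.inl i)) = dsum (A.erase i) B :=
  ext_sum (by simp) (by simp)

theorem erase_inr [DecidableEq (Lex (V ⊕ W))] (A : Finset V) (B : Finset W) (j : W) :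
    (dsum A B).erase (toLex (Sum.inr j)) = dsum A (B.erase j) :=
  ext_sum (by simp) (by simp)

theorem insert_inl [DecidableEq (Lex (V ⊕ W))] (A : Finset V) (B : Finset W) (i : V) :
    insert (toLex (Sum.inl i)) (dsum A B) = dsum (insert i A) B :=
  ext_sum (by simp) (by simp)

theorem insert_inr [DecidableEq (Lex (V ⊕ W))] (A : Finset V) (B : Finset W) (j : W) :
    insert (toLex (Sum.inr j)) (dsum A B) = dsum A (insert j B) :=
  ext_sum (by simp) (by simp)

theorem eps_inl (A : Finset V) (B : Finset W) (i : V) :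
    eps (toLex (Sum.inl i)) (dsum A B) = eps i A := by
  unfold eps
  have : (dsum A B).filter (· < toLex (Sum.inl i)) = dsum (A.filter (· < i)) ∅ :=
    ext_sum (by simp) (by simp)
  rw [this, card_dsum, Finset.card_empty, add_zero]

/-- All of `A` precedes `j`. This factor is the origin of the Leibniz sign, both for (co)chains and
for `d'` and `∂'`. -/
theorem eps_inr (A : Finset V) (B : Finset W) (j : W) :
    eps (toLex (Sum.inr j)) (dsum A B) = (-1) ^ A.card * eps j B := by
  unfold eps
  have : (dsum A B).filter (· < toLex (Sum.inr j)) = dsum A (B.filter (· < j)) :=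
    ext_sum (by simp) (by simp)
  rw [this, card_dsum, pow_add]

theorem dsum_subset_iff {A A' : Finset V} {B B' : Finset W} :
    dsum A B ⊆ dsum A' B' ↔ A ⊆ A' ∧ B ⊆ B' := by
  refine ⟨fun h => ⟨fun v hv => ?_, fun w hw => ?_⟩, fun h => ?_⟩
  · exact inl_mem_dsum.1 (h (inl_mem_dsum.2 hv))
  · exact inr_mem_dsum.1 (h (inr_mem_dsum.2 hw))
  · exact Finset.map_subset_map.2 (Finset.disjSum_mono h.1 h.2)

theorem dsum_eq_empty_iff {A : Finset V} {B : Finset W} : dsum A B = ∅ ↔ A = ∅ ∧ B = ∅ := by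
  simp [dsum]

theorem dsum_inj {A A' : Finset V} {B B' : Finset W} :
    dsum A B = dsum A' B' ↔ A = A' ∧ B = B' := by
  refine ⟨fun h => ?_, fun h => by rw [h.1, h.2]⟩
  have h1 := dsum_subset_iff.1 h.le
  have h2 := dsum_subset_iff.1 h.ge
  exact ⟨h1.1.antisymm h2.1, h1.2.antisymm h2.2⟩

theorem neg_one_pow_card {S : Type} (A : Finset S) {p : ℤ} (h : (A.card : ℤ) = p) :
    ((-1) ^ A.card : ℤ) = (p.negOnePow : ℤ) := by
  rw [← h]
  simp [Int.negOnePow]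

variable [Fintype V] [Fintype W]

@[simp]
theorem leftPart_dsum (A : Finset V) (B : Finset W) : leftPart (dsum A B) = A := by
  ext; simp [leftPart]

@[simp]
theorem rightPart_dsum (A : Finset V) (B : Finset W) : rightPart (dsum A B) = B := by
  ext; simp [rightPart]

@[simp]
theorem dsum_leftPart_rightPart (S : Finset (Lex (V ⊕ W))) :
    dsum (leftPart S) (rightPart S) = S :=
  ext_sum (by simp [leftPart]) (by simp [rightPart])

/-- The complex `M` on `V ⊔ W` is the join of `K` and `L`. -/
def IsJoin (M : PreAbstractSimplicialComplex (Lex (V ⊕ W))) (K : PreAbstractSimplicialComplex V)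
    (L : PreAbstractSimplicialComplex W) : Prop :=
  ∀ A B, (dsum A B = ∅ ∨ dsum A B ∈ M.faces) ↔ (A = ∅ ∨ A ∈ K.faces) ∧ (B = ∅ ∨ B ∈ L.faces)

theorem mem_full_iff {S : Type} (K : PreAbstractSimplicialComplex S) (I A : Finset S) :
    (A = ∅ ∨ A ∈ (full K I).faces) ↔ (A = ∅ ∨ A ∈ K.faces) ∧ A ⊆ I := by
  change (A = ∅ ∨ A ∈ K.faces ∧ A ⊆ I) ↔ _
  constructor
  · rintro (rfl | h)
    · simp
    · exact ⟨Or.inr h.1, h.2⟩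
  · rintro ⟨h | h, hI⟩
    · exact Or.inl h
    · exact Or.inr ⟨h, hI⟩

theorem isJoin_join (K : PreAbstractSimplicialComplex V) (L : PreAbstractSimplicialComplex W) :
    IsJoin (join K L) K L := by
  intro A B
  change (_ ∨ (dsum A B).Nonempty ∧ (leftPart (dsum A B) = ∅ ∨ leftPart (dsum A B) ∈ K.faces) ∧
    (rightPart (dsum A B) = ∅ ∨ rightPart (dsum A B) ∈ L.faces)) ↔ _
  rw [leftPart_dsum, rightPart_dsum, Finset.nonempty_iff_ne_empty, Ne, dsum_eq_empty_iff]
  tauto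

/-- Stating this through the predicate `IsJoin` lets the products take values in the (co)chains of
the full subcomplex itself, without transport along an equality of complexes. -/
theorem isJoin_full (K : PreAbstractSimplicialComplex V) (L : PreAbstractSimplicialComplex W)
    (I : Finset V) (J : Finset W) :
    IsJoin (full (join K L) (dsum I J)) (full K I) (full L J) := by
  intro A B
  rw [mem_full_iff, mem_full_iff, mem_full_iff, isJoin_join K L A B, dsum_subset_iff]
  tauto

variable {M : PreAbstractSimplicialComplex (Lex (V ⊕ W))} {K : PreAbstractSimplicialComplex V}
  {L : PreAbstractSimplicialComplex W}

/-- The join of two simplices. -/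
def joinSimp (hM : IsJoin M K L) {p q n : ℤ} (h : p + q + 1 = n) (s : Simp K p) (t : Simp L q) :
    Simp M n :=
  ⟨dsum s.1 t.1, (hM _ _).2 ⟨s.2.1, t.2.1⟩, by
    have h1 := s.2.2
    have h2 := t.2.2
    rw [card_dsum]
    push_cast
    omega⟩

theorem joinSimp_bijective (hM : IsJoin M K L) (n : ℤ) : Function.Bijective
    fun x : Σ x : {x : ℤ × ℤ // x.1 + x.2 + 1 = n}, Simp K x.1.1 × Simp L x.1.2 =>
      joinSimp hM x.1.2 x.2.1 x.2.2 := by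
  constructor
  · rintro ⟨⟨⟨p, q⟩, h⟩, ⟨A, hA⟩, ⟨B, hB⟩⟩ ⟨⟨⟨p', q'⟩, h'⟩, ⟨A', hA'⟩, ⟨B', hB'⟩⟩ he
    have he : dsum A B = dsum A' B' := congrArg Subtype.val he
    obtain rfl : A = A' := by simpa using congrArg leftPart he
    obtain rfl : B = B' := by simpa using congrArg rightPart he
    obtain rfl : p = p' := by
      have h1 := hA.2.symm.trans hA'.2
      simpa using h1
    obtain rfl : q = q' := by
      have h1 := hB.2.symm.trans hB'.2
      simpa using h1
    rfl
  · rintro ⟨S, hS, hn⟩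
    rw [← dsum_leftPart_rightPart S, hM] at hS
    rw [← dsum_leftPart_rightPart S, card_dsum] at hn
    push_cast at hn
    -- An empty part is the simplex of dimension `-1`.
    refine ⟨⟨⟨((leftPart S).card - 1, (rightPart S).card - 1), by dsimp only; omega⟩,
      ⟨leftPart S, hS.1, by simp⟩, ⟨rightPart S, hS.2, by simp⟩⟩, ?_⟩
    exact Subtype.ext (dsum_leftPart_rightPart S)

end Join

/-! ### Naturality of products -/

section Naturality

open scoped TensorProduct

variable {R : Type u} [CommRing R] {ι : Type} [AddCommGroup ι] {c : ComplexShape ι}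
  {δ : ι} {σ : ι → ι → ι} {χ : ι → ℤˣ} (S : IsPairingShape c δ σ χ)
  {C D E C' D' E' : HomologicalComplex (ModuleCat.{u} R) c} (P : Pairing σ χ C D E)
  (P' : Pairing σ χ C' D' E')

theorem Pairing.homologyMap_κ (f : C ⟶ C') (g : D ⟶ D') (k : E ⟶ E') {a b n : ι} (h : σ a b = n)
    (hk : ∀ x y, k.f n (P.μ a b n h (x ⊗ₜ y)) = P'.μ a b n h (f.f a x ⊗ₜ g.f b y))
    (x : C.homology a) (y : D.homology b) :
    HomologicalComplex.homologyMap k n (P.κ S a b n h (x ⊗ₜ y)) =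
      P'.κ S a b n h (HomologicalComplex.homologyMap f a x ⊗ₜ
        HomologicalComplex.homologyMap g b y) := by
  obtain ⟨x, rfl⟩ := cls_surjective C a x
  obtain ⟨y, rfl⟩ := cls_surjective D b y
  rw [homologyMap_cls, homologyMap_cls, P.κ_cls_tmul, P'.κ_cls_tmul, homologyMap_cls]
  exact congrArg _ (Subtype.ext (hk _ _))

end Naturality

/-- Numbers of vertices add under joins, which gives dimension `p + q + 1`; the sign counts the `p +
1` vertices in front. -/
theorem isPairingShape_up : IsPairingShape (ComplexShape.up ℤ) 1 (fun p q => p + q + 1)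
    (fun p => (p + 1).negOnePow) where
  rel_iff _ _ := Iff.rfl
  add_left _ _ := by ring
  add_right _ _ := by ring
  sign_add p := Int.negOnePow_succ (p + 1)

theorem isPairingShape_down : IsPairingShape (ComplexShape.down ℤ) (-1) (fun p q => p + q + 1)
    (fun p => (p + 1).negOnePow) where
  rel_iff a b := by
    change b + 1 = a ↔ _
    omega
  add_left _ _ := by ring
  add_right _ _ := by ring
  sign_add p := by
    have := Int.negOnePow_succ p
    rw [neg_add_cancel_right, this, neg_neg]

/-! ### The product of cochains on a join -/

section Cochains

open scoped TensorProduct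

variable (R : Type u) [CommRing R] {V W : Type} [LinearOrder V] [LinearOrder W] [Fintype V]
  [Fintype W] {M : PreAbstractSimplicialComplex (Lex (V ⊕ W))} {K : PreAbstractSimplicialComplex V}
  {L : PreAbstractSimplicialComplex W}

theorem evalAt_of_simp {S : Type} [LinearOrder S] {K : PreAbstractSimplicialComplex S} {p : ℤ}
    {A : Finset S} (h : (A = ∅ ∨ A ∈ K.faces) ∧ (A.card : ℤ) = p + 1) (α : Simp K p → R) :
    evalAt R K p A α = α ⟨A, h⟩ := by
  rw [evalAt, dif_pos h]; rfl

theorem evalAt_of_not_simp {S : Type} [LinearOrder S] {K : PreAbstractSimplicialComplex S} {p : ℤ}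
    {A : Finset S} (h : ¬ ((A = ∅ ∨ A ∈ K.faces) ∧ (A.card : ℤ) = p + 1)) (α : Simp K p → R) :
    evalAt R K p A α = 0 := by
  rw [evalAt, dif_neg h]; rfl

/-- The cardinality of `A` is left free: if it is not `p' + 1`, both sides vanish. -/
theorem evalAt_coboundary {S : Type} [LinearOrder S] (K : PreAbstractSimplicialComplex S) {p p' : ℤ}
    (hp : p + 1 = p') {A : Finset S} (hA : A = ∅ ∨ A ∈ K.faces) (α : Simp K p → R) :
    evalAt R K p' A (coboundary R K p p' α) =
      ∑ j ∈ A, eps j A • evalAt R K p (A.erase j) α := by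
  by_cases h : (A.card : ℤ) = p' + 1
  · rw [evalAt_of_simp R ⟨hA, h⟩]
    simp [coboundary]
  · rw [evalAt_of_not_simp R (fun h' => h h'.2)]
    refine (Finset.sum_eq_zero fun j hj => ?_).symm
    rw [evalAt_of_not_simp R, smul_zero]
    rintro ⟨-, h2⟩
    have := Finset.card_erase_add_one hj
    omega

/-- Restriction of cochains in a single degree. -/
noncomputable def restrictMap {S : Type} {K' K : PreAbstractSimplicialComplex S} (h : K' ≤ K)
    (p : ℤ) : (Simp K p → R) →ₗ[R] (Simp K' p → R) :=
  LinearMap.funLeft R R fun L => ⟨L.1, L.2.1.imp id (fun hL => h hL), L.2.2⟩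

theorem evalAt_single {S : Type} [LinearOrder S] {K : PreAbstractSimplicialComplex S} {p : ℤ}
    [DecidableEq (Simp K p)] (A : Finset S) (s : Simp K p) :
    evalAt R K p A (Pi.single s 1) = if A = s.1 then 1 else 0 := by
  split_ifs with h
  · subst h
    rw [evalAt_of_simp R s.2, Pi.single_eq_same]
  · by_cases h' : (A = ∅ ∨ A ∈ K.faces) ∧ (A.card : ℤ) = p + 1
    · rw [evalAt_of_simp R h', Pi.single_eq_of_ne]
      exact fun h2 => h (congrArg Subtype.val h2)
    · rw [evalAt_of_not_simp R h']

theorem evalAt_restrict {S : Type} [LinearOrder S] {K' K : PreAbstractSimplicialComplex S}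
    (h : K' ≤ K) (p : ℤ) {A : Finset S} (hA : A = ∅ ∨ A ∈ K'.faces) (α : Simp K p → R) :
    evalAt R K' p A (restrictMap R h p α) = evalAt R K p A α := by
  by_cases hc : (A.card : ℤ) = p + 1
  · rw [evalAt_of_simp R ⟨hA, hc⟩, evalAt_of_simp R ⟨hA.imp id fun x => h x, hc⟩]
    rfl
  · rw [evalAt_of_not_simp R (fun h' => hc h'.2), evalAt_of_not_simp R (fun h' => hc h'.2)]

/-- The product of cochains on a join. -/
noncomputable def cochainMul (M : PreAbstractSimplicialComplex (Lex (V ⊕ W)))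
    (K : PreAbstractSimplicialComplex V) (L : PreAbstractSimplicialComplex W) (p q n : ℤ) :
    (Simp K p → R) ⊗[R] (Simp L q → R) →ₗ[R] (Simp M n → R) :=
  LinearMap.pi fun S => LinearMap.mul' R R ∘ₗ
    TensorProduct.map (evalAt R K p (leftPart S.1)) (evalAt R L q (rightPart S.1))

/-- If `A` or `B` is not a simplex of the right dimension, both sides vanish. So the formula applies
to every term of a coboundary without further case distinctions. -/
theorem evalAt_cochainMul (hM : IsJoin M K L) {p q n : ℤ} (h : p + q + 1 = n) (A : Finset V)
    (B : Finset W) (α : Simp K p → R) (β : Simp L q → R) :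
    evalAt R M n (dsum A B) (cochainMul R M K L p q n (α ⊗ₜ β)) =
      evalAt R K p A α * evalAt R L q B β := by
  by_cases hA : (A = ∅ ∨ A ∈ K.faces) ∧ (A.card : ℤ) = p + 1
  · by_cases hB : (B = ∅ ∨ B ∈ L.faces) ∧ (B.card : ℤ) = q + 1
    · have hs : (dsum A B = ∅ ∨ dsum A B ∈ M.faces) ∧ ((dsum A B).card : ℤ) = n + 1 :=
        (joinSimp hM h ⟨A, hA⟩ ⟨B, hB⟩).2
      rw [evalAt_of_simp R hs]
      simp [cochainMul]
    · rw [evalAt_of_not_simp R hB, mul_zero, evalAt_of_not_simp]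
      rw [hM, card_dsum]
      push_cast
      exact fun h' => hB ⟨h'.1.2, by have := h'.2; have := hA.2; omega⟩
  · rw [evalAt_of_not_simp R hA, zero_mul]
    by_cases hs : (dsum A B = ∅ ∨ dsum A B ∈ M.faces) ∧ ((dsum A B).card : ℤ) = n + 1
    · rw [evalAt_of_simp R hs]
      simp [cochainMul, evalAt_of_not_simp R hA]
    · rw [evalAt_of_not_simp R hs]

theorem coboundary_cochainMul (hM : IsJoin M K L) {p p' q q' n n' : ℤ} (hp : p + 1 = p')
    (hq : q + 1 = q') (h : p + q + 1 = n) (h₁ : p' + q + 1 = n') (h₂ : p + q' + 1 = n')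
    (α : Simp K p → R) (β : Simp L q → R) :
    coboundary R M n n' (cochainMul R M K L p q n (α ⊗ₜ β)) =
      cochainMul R M K L p' q n' (coboundary R K p p' α ⊗ₜ β) +
        ((p + 1).negOnePow : ℤ) • cochainMul R M K L p q' n' (α ⊗ₜ coboundary R L q q' β) := by
  refine funext fun S => ?_
  obtain ⟨S, hS, hn⟩ := S
  obtain ⟨A, B, rfl⟩ : ∃ A B, S = dsum A B := ⟨_, _, (dsum_leftPart_rightPart S).symm⟩
  have hA := ((hM _ _).1 hS).1
  have hB := ((hM _ _).1 hS).2
  have e1 : ∀ γ : Simp M n' → R, γ ⟨dsum A B, hS, hn⟩ = evalAt R M n' (dsum A B) γ :=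
    fun γ => (evalAt_of_simp R _ γ).symm
  refine (e1 _).trans (Eq.trans ?_ (e1 _).symm)
  rw [map_add, map_zsmul, evalAt_cochainMul R hM h₁, evalAt_cochainMul R hM h₂,
    evalAt_coboundary R M (by omega) hS, evalAt_coboundary R K hp hA,
    evalAt_coboundary R L hq hB, sum_dsum, Finset.sum_mul]
  congr 1
  · refine Finset.sum_congr rfl fun i _ => ?_
    rw [erase_inl, evalAt_cochainMul R hM h, eps_inl, smul_mul_assoc]
  -- The sign `(-1)^|A|` equals `(-1)^(p+1)` only if `A` has dimension `p`; otherwise `α` evaluates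
  -- to zero on `A` and the sign is irrelevant.
  · by_cases hc : (A.card : ℤ) = p + 1
    · rw [Finset.mul_sum, Finset.smul_sum]
      refine Finset.sum_congr rfl fun j _ => ?_
      rw [erase_inr, evalAt_cochainMul R hM h, eps_inr, neg_one_pow_card A hc, mul_smul,
        mul_smul_comm]
    · have h0 := evalAt_of_not_simp R (K := K) (fun h' => hc h'.2) α
      rw [h0, zero_mul, smul_zero]
      refine Finset.sum_eq_zero fun j _ => ?_
      rw [erase_inr, evalAt_cochainMul R hM h, h0, zero_mul, smul_zero]

/-- The product of cochains on a join satisfies the Leibniz rule. -/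
noncomputable def cochainPairing (hM : IsJoin M K L) :
    Pairing (fun p q => p + q + 1) (fun p => (p + 1).negOnePow)
      (cochains R K) (cochains R L) (cochains R M) where
  μ p q n _ := cochainMul R M K L p q n
  leibniz hp hq h h₁ h₂ α β := coboundary_cochainMul R hM hp hq h h₁ h₂ α β

/-- For free modules it suffices that the products of basis elements run bijectively through a basis
of the target. -/
theorem isCoprod_of_basis {ι κ : Type} {α β : ι → Type} {N : Type*} [AddCommGroup N] [Module R N]
    {C D : ι → Type*} [∀ i, AddCommGroup (C i)] [∀ i, Module R (C i)] [∀ i, AddCommGroup (D i)]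
    [∀ i, Module R (D i)] {b : ∀ i, α i → R →ₗ[R] C i} {b' : ∀ i, β i → R →ₗ[R] D i}
    {e : κ → R →ₗ[R] N} (hb : ∀ i, IsCoprod (b i)) (hb' : ∀ i, IsCoprod (b' i)) (he : IsCoprod e)
    {j : (Σ i, α i × β i) → κ} (hj : Function.Bijective j) {f : ∀ i, C i ⊗[R] D i →ₗ[R] N}
    (h : ∀ x, f x.1 (b x.1 x.2.1 1 ⊗ₜ b' x.1 x.2.2 1) = e (j x) 1) : IsCoprod f := by
  refine IsCoprod.of_sigma (α := fun i => α i × β i)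
    (g := fun i x => TensorProduct.map (b i x.1) (b' i x.2)) ?_
    fun i => (hb i).tensor (hb' i)
  refine ((he.reindex hj).comp_equiv fun _ => TensorProduct.lid R R).congr fun x =>
    TensorProduct.ext (LinearMap.ext_ring (LinearMap.ext_ring ?_))
  simpa using h x

theorem isCoprod_single {α : Type} [Finite α] [DecidableEq α] :
    IsCoprod fun a : α => (LinearMap.single R (fun _ => R) a : R →ₗ[R] α → R) := by
  obtain rfl : ‹DecidableEq α› = fun a b => Classical.propDecidable (a = b) :=
    Subsingleton.elim _ _
  exact IsCoprod.pi_single (M := fun _ : α => R)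

/-- Since `V` and `W` are finite, indicator functions of simplices form bases of the cochains; the
product of two indicators is the indicator of the join. -/
theorem isCoprod_cochainPairing (hM : IsJoin M K L) (n : ℤ) :
    IsCoprod fun x : {x : ℤ × ℤ // x.1 + x.2 + 1 = n} =>
      (cochainPairing R hM).μ x.1.1 x.1.2 n x.2 := by
  classical
  refine isCoprod_of_basis R
    (b := fun x : {x : ℤ × ℤ // x.1 + x.2 + 1 = n} => LinearMap.single R fun _ : Simp K x.1.1 => R)
    (b' := fun x : {x : ℤ × ℤ // x.1 + x.2 + 1 = n} => LinearMap.single R fun _ : Simp L x.1.2 => R)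
    (e := LinearMap.single R fun _ : Simp M n => R)
    (fun x => isCoprod_single R) (fun x => isCoprod_single R) (isCoprod_single R)
    (joinSimp_bijective hM n) ?_
  rintro ⟨⟨⟨p, q⟩, h⟩, s, t⟩
  refine funext fun S => ?_
  obtain ⟨⟨⟨⟨p', q'⟩, h'⟩, s', t'⟩, rfl⟩ := (joinSimp_bijective hM n).2 S
  change (cochainMul R M K L p q n (Pi.single s 1 ⊗ₜ Pi.single t 1) : Simp M n → R)
    (joinSimp hM h' s' t') = (Pi.single (joinSimp hM h s t) 1 : Simp M n → R)
      (joinSimp hM h' s' t')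
  have e1 (γ : Simp M n → R) : γ (joinSimp hM h' s' t') = evalAt R M n (dsum s'.1 t'.1) γ :=
    (evalAt_of_simp R (joinSimp hM h' s' t').2 γ).symm
  refine (e1 _).trans (Eq.trans ?_ (e1 _).symm)
  rw [evalAt_cochainMul R hM h, evalAt_single, evalAt_single, evalAt_single]
  have e2 : (joinSimp hM h s t).1 = dsum s.1 t.1 := rfl
  simp only [e2, dsum_inj]
  split_ifs <;> simp_all

theorem restrictMap_cochainMul {M' : PreAbstractSimplicialComplex (Lex (V ⊕ W))}
    {K' : PreAbstractSimplicialComplex V} {L' : PreAbstractSimplicialComplex W}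
    (hM : IsJoin M K L) (hM' : IsJoin M' K' L') (h : M' ≤ M) (hK : K' ≤ K) (hL : L' ≤ L)
    {p q n : ℤ} (hn : p + q + 1 = n) (α : Simp K p → R) (β : Simp L q → R) :
    restrictMap R h n (cochainMul R M K L p q n (α ⊗ₜ β)) =
      cochainMul R M' K' L' p q n (restrictMap R hK p α ⊗ₜ restrictMap R hL q β) := by
  refine funext fun S => ?_
  obtain ⟨S, hS, hc⟩ := S
  obtain ⟨A, B, rfl⟩ : ∃ A B, S = dsum A B := ⟨_, _, (dsum_leftPart_rightPart S).symm⟩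
  have hA := (hM' _ _).1 hS
  have e1 : ∀ γ : Simp M' n → R, γ ⟨dsum A B, hS, hc⟩ = evalAt R M' n (dsum A B) γ :=
    fun γ => (evalAt_of_simp R _ γ).symm
  refine (e1 _).trans (Eq.trans ?_ (e1 _).symm)
  rw [evalAt_restrict R h n hS, evalAt_cochainMul R hM hn, evalAt_cochainMul R hM' hn,
    evalAt_restrict R hK p hA.1, evalAt_restrict R hL q hA.2]

end Cochains

/-! ### The product of chains on a join -/

section Chains

open scoped TensorProduct

variable (R : Type u) [CommRing R] {V W : Type} [LinearOrder V] [LinearOrder W] [Fintype V]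
  [Fintype W] {M : PreAbstractSimplicialComplex (Lex (V ⊕ W))} {K : PreAbstractSimplicialComplex V}
  {L : PreAbstractSimplicialComplex W}

theorem basisChain_of_simp {S : Type} [LinearOrder S] {K : PreAbstractSimplicialComplex S} {p : ℤ}
    {A : Finset S} (h : (A = ∅ ∨ A ∈ K.faces) ∧ (A.card : ℤ) = p + 1) :
    basisChain R K p A = Finsupp.single ⟨A, h⟩ 1 := by
  rw [basisChain, dif_pos h]

/-- The product of chains with values in the chains of a join. -/
noncomputable def chainMul (M : PreAbstractSimplicialComplex (Lex (V ⊕ W)))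
    (K : PreAbstractSimplicialComplex V) (L : PreAbstractSimplicialComplex W) (p q n : ℤ) :
    (Simp K p →₀ R) ⊗[R] (Simp L q →₀ R) →ₗ[R] (Simp M n →₀ R) :=
  TensorProduct.lift (Finsupp.linearCombination R fun s : Simp K p =>
    Finsupp.linearCombination R fun t : Simp L q => basisChain R M n (dsum s.1 t.1))

theorem chainMul_single (p q n : ℤ) (s : Simp K p) (t : Simp L q) :
    chainMul R M K L p q n (Finsupp.single s 1 ⊗ₜ Finsupp.single t 1) =
      basisChain R M n (dsum s.1 t.1) := by
  simp [chainMul]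

theorem chainMul_basisChain {p q : ℤ} (n : ℤ) {A : Finset V} {B : Finset W}
    (hA : (A = ∅ ∨ A ∈ K.faces) ∧ (A.card : ℤ) = p + 1)
    (hB : (B = ∅ ∨ B ∈ L.faces) ∧ (B.card : ℤ) = q + 1) :
    chainMul R M K L p q n (basisChain R K p A ⊗ₜ basisChain R L q B) =
      basisChain R M n (dsum A B) := by
  rw [basisChain_of_simp R hA, basisChain_of_simp R hB, chainMul_single]

theorem chain_bilinear_ext {α β : Type*} {N : Type*} [AddCommGroup N] [Module R N]
    {f g : (α →₀ R) ⊗[R] (β →₀ R) →ₗ[R] N} (h : ∀ a b,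
      f (Finsupp.single a 1 ⊗ₜ Finsupp.single b 1) = g (Finsupp.single a 1 ⊗ₜ Finsupp.single b 1)) :
    f = g :=
  TensorProduct.ext (Finsupp.lhom_ext' fun a => LinearMap.ext_ring (Finsupp.lhom_ext' fun b =>
    LinearMap.ext_ring (h a b)))

theorem map_zsmul_tmul {A B N : Type*} [AddCommGroup A] [Module R A] [AddCommGroup B] [Module R B]
    [AddCommGroup N] [Module R N] (f : A ⊗[R] B →ₗ[R] N) (k : ℤ) (x : A) (y : B) :
    f ((k • x) ⊗ₜ y) = k • f (x ⊗ₜ y) :=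
  map_zsmul (LinearMap.applyₗ y ∘ₗ TensorProduct.curry f) k x

theorem map_tmul_zsmul {A B N : Type*} [AddCommGroup A] [Module R A] [AddCommGroup B] [Module R B]
    [AddCommGroup N] [Module R N] (f : A ⊗[R] B →ₗ[R] N) (k : ℤ) (x : A) (y : B) :
    f (x ⊗ₜ (k • y)) = k • f (x ⊗ₜ y) :=
  map_zsmul (TensorProduct.curry f x) k y

theorem boundary_chainMul (hM : IsJoin M K L) {p p' q q' n n' : ℤ} (hp : p' + 1 = p)
    (hq : q' + 1 = q) (h : p + q + 1 = n)
    (x : Simp K p →₀ R) (y : Simp L q →₀ R) :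
    boundary R M n n' (chainMul R M K L p q n (x ⊗ₜ y)) =
      chainMul R M K L p' q n' (boundary R K p p' x ⊗ₜ y) +
        ((p + 1).negOnePow : ℤ) • chainMul R M K L p q' n' (x ⊗ₜ boundary R L q q' y) := by
  refine LinearMap.congr_fun (f := boundary R M n n' ∘ₗ chainMul R M K L p q n)
    (g := chainMul R M K L p' q n' ∘ₗ TensorProduct.map (boundary R K p p') LinearMap.id +
      ((p + 1).negOnePow : ℤ) • chainMul R M K L p q' n' ∘ₗ
        TensorProduct.map LinearMap.id (boundary R L q q'))
    (chain_bilinear_ext R fun s t => ?_) (x ⊗ₜ y)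
  have hs : (dsum s.1 t.1 = ∅ ∨ dsum s.1 t.1 ∈ M.faces) ∧ ((dsum s.1 t.1).card : ℤ) = n + 1 :=
    (joinSimp hM h s t).2
  simp only [LinearMap.comp_apply, LinearMap.add_apply, LinearMap.smul_apply,
    TensorProduct.map_tmul, LinearMap.id_apply]
  rw [chainMul_single, basisChain_of_simp R hs, boundary_single, boundary_single,
    boundary_single, sum_dsum, TensorProduct.sum_tmul, TensorProduct.tmul_sum, map_sum, map_sum,
    Finset.smul_sum]
  congr 1
  · refine Finset.sum_congr rfl fun i hi => ?_
    rw [erase_inl, eps_inl, map_zsmul_tmul,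
      ← basisChain_of_simp R t.2, chainMul_basisChain R n' (erase_mem K hp s hi) t.2]
  · refine Finset.sum_congr rfl fun j hj => ?_
    rw [erase_inr, eps_inr, map_tmul_zsmul, smul_smul,
      ← basisChain_of_simp R s.2, chainMul_basisChain R n' s.2 (erase_mem L hq t hj),
      neg_one_pow_card s.1 s.2.2]

/-- The product of chains on a join satisfies the Leibniz rule. -/
noncomputable def chainPairing (hM : IsJoin M K L) :
    Pairing (fun p q => p + q + 1) (fun p => (p + 1).negOnePow)
      (chains R K) (chains R L) (chains R M) where
  μ p q n _ := chainMul R M K L p q n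
  leibniz {p p' q q' n n'} hp hq h h₁ h₂ x y := by
    change p' + 1 = p at hp
    change q' + 1 = q at hq
    exact boundary_chainMul R hM hp hq h x y

theorem isCoprod_chainPairing (hM : IsJoin M K L) (n : ℤ) :
    IsCoprod fun x : {x : ℤ × ℤ // x.1 + x.2 + 1 = n} =>
      (chainPairing R hM).μ x.1.1 x.1.2 n x.2 := by
  refine isCoprod_of_basis R
    (b := fun x : {x : ℤ × ℤ // x.1 + x.2 + 1 = n} =>
      fun s : Simp K x.1.1 => (Finsupp.lsingle s : R →ₗ[R] _))
    (b' := fun x : {x : ℤ × ℤ // x.1 + x.2 + 1 = n} =>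
      fun s : Simp L x.1.2 => (Finsupp.lsingle s : R →ₗ[R] _))
    (e := fun s : Simp M n => (Finsupp.lsingle s : R →ₗ[R] _))
    (fun x => IsCoprod.finsupp_lsingle) (fun x => IsCoprod.finsupp_lsingle)
    IsCoprod.finsupp_lsingle (joinSimp_bijective hM n) ?_
  rintro ⟨⟨⟨p, q⟩, h⟩, s, t⟩
  exact (chainMul_single R p q n s t).trans (basisChain_of_simp R (joinSimp hM h s t).2)

theorem extend_chainMul {M' : PreAbstractSimplicialComplex (Lex (V ⊕ W))}
    {K' : PreAbstractSimplicialComplex V} {L' : PreAbstractSimplicialComplex W}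
    (hM' : IsJoin M' K' L') (h : M' ≤ M) (hK : K' ≤ K) (hL : L' ≤ L)
    {p q n : ℤ} (hn : p + q + 1 = n) (x : Simp K' p →₀ R) (y : Simp L' q →₀ R) :
    ((extend R h).f n).hom (chainMul R M' K' L' p q n (x ⊗ₜ y)) =
      chainMul R M K L p q n (((extend R hK).f p).hom x ⊗ₜ ((extend R hL).f q).hom y) := by
  have e1 {S : Type} [LinearOrder S] {K' K : PreAbstractSimplicialComplex S} (h : K' ≤ K) (p : ℤ)
      (s : Simp K' p) : ((extend R h).f p).hom (Finsupp.single s (1 : R)) =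
        basisChain R K p s.1 := by
    rw [basisChain_of_simp R ⟨s.2.1.imp id fun x => h x, s.2.2⟩]
    exact Finsupp.mapDomain_single
  refine LinearMap.congr_fun (f := ((extend R h).f n).hom ∘ₗ chainMul R M' K' L' p q n)
    (g := chainMul R M K L p q n ∘ₗ TensorProduct.map ((extend R hK).f p).hom
      ((extend R hL).f q).hom) (chain_bilinear_ext R fun s t => ?_) (x ⊗ₜ y)
  refine (congrArg ((extend R h).f n).hom ((chainMul_single R p q n s t).trans
    (basisChain_of_simp R (joinSimp hM' hn s t).2))).trans ?_
  refine (e1 h n (joinSimp hM' hn s t)).trans ?_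
  refine Eq.trans ?_ (congrArg₂ (fun a b => chainMul R M K L p q n (a ⊗ₜ b))
    (e1 hK p s) (e1 hL q t)).symm
  exact (chainMul_basisChain R n ⟨s.2.1.imp id fun x => hK x, s.2.2⟩
    ⟨t.2.1.imp id fun x => hL x, t.2.2⟩).symm

end Chains

/-! ### The Künneth theorem for joins -/

section JoinKunneth

variable (R : Type u) [CommRing R] {V W : Type} [LinearOrder V] [LinearOrder W] [Fintype V]
  [Fintype W] {M : PreAbstractSimplicialComplex (Lex (V ⊕ W))} {K : PreAbstractSimplicialComplex V}
  {L : PreAbstractSimplicialComplex W}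

omit [LinearOrder V] in
theorem isEmpty_simp_of_card_le (K : PreAbstractSimplicialComplex V) {p : ℤ}
    (h : (Fintype.card V : ℤ) ≤ p) : IsEmpty (Simp K p) :=
  ⟨fun s => by
    have h1 := s.2.2
    have h2 := Finset.card_le_univ s.1
    omega⟩

omit [LinearOrder V] [Fintype V] in
theorem isEmpty_simp_of_lt (K : PreAbstractSimplicialComplex V) {p : ℤ} (h : p < -1) :
    IsEmpty (Simp K p) :=
  ⟨fun s => by
    have h1 := s.2.2
    omega⟩

theorem nonempty_retraction_cochains (K : PreAbstractSimplicialComplex V)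
    (hK : ∀ p, Module.Projective R ((cochains R K).homology p)) :
    Nonempty (Retraction (cochains R K)) := by
  -- Cochains vanish from degree `|V|` on, since a simplex of that dimension would have `|V| + 1`
  -- vertices.
  refine Retraction.nonempty _ (fun a b => projective_range_d (δ := 1) (fun _ _ => Iff.rfl) _
    (fun p => ?_) hK (fun a => ⟨(Fintype.card V - a).toNat, ?_⟩) a b) hK
  · exact inferInstanceAs (Module.Projective R (Simp K p → R))
  · have := isEmpty_simp_of_card_le K (p := a + (Fintype.card V - a).toNat • 1) (by
      rw [nsmul_one]
      have := Int.self_le_toNat (Fintype.card V - a)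
      omega)
    exact inferInstanceAs (Subsingleton (Simp K (a + (Fintype.card V - a).toNat • 1) → R))

theorem nonempty_retraction_chains {V : Type} [LinearOrder V] (K : PreAbstractSimplicialComplex V)
    (hK : ∀ p, Module.Projective R ((chains R K).homology p)) :
    Nonempty (Retraction (chains R K)) := by
  -- Chains vanish below degree `-1`; at least `a + 2` steps down from `a` lead to degree `-2` or
  -- lower.
  refine Retraction.nonempty _ (fun a b => projective_range_d (δ := -1)
    isPairingShape_down.rel_iff _
    (fun p => ?_) hK (fun a => ⟨(a + 2).toNat, ?_⟩) a b) hK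
  · exact inferInstanceAs (Module.Projective R (Simp K p →₀ R))
  · have := isEmpty_simp_of_lt K (p := a + (a + 2).toNat • (-1)) (by
      rw [nsmul_eq_mul]
      have := Int.self_le_toNat (a + 2)
      omega)
    exact inferInstanceAs (Subsingleton (Simp K (a + (a + 2).toNat • (-1)) →₀ R))

theorem isCoprod_κ_cochainPairing (hM : IsJoin M K L)
    (h : (∀ p, Module.Projective R ((cochains R K).homology p)) ∨
      (∀ p, Module.Projective R ((cochains R L).homology p))) (n : ℤ) :
    IsCoprod fun x : {x : ℤ × ℤ // x.1 + x.2 + 1 = n} =>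
      (cochainPairing R hM).κ isPairingShape_up x.1.1 x.1.2 n x.2 := by
  rcases h with h | h
  · obtain ⟨r⟩ := nonempty_retraction_cochains R K h
    exact (cochainPairing R hM).isCoprod_κ isPairingShape_up r (isCoprod_cochainPairing R hM)
      (fun a => inferInstance) n
  · obtain ⟨r⟩ := nonempty_retraction_cochains R L h
    -- The sign `(-1)^((p+1)(q+1))` is that of moving `p + 1` vertices past `q + 1` vertices.
    refine (cochainPairing R hM).isCoprod_κ_of_flip isPairingShape_up
      (fun p q => ((p + 1) * (q + 1)).negOnePow) (fun a b => ?_) (fun a b => ?_) r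
      (isCoprod_cochainPairing R hM) (fun a => inferInstance) n
    all_goals
      rw [← Int.negOnePow_add]
      congr 1
      ring

theorem isCoprod_κ_chainPairing (hM : IsJoin M K L)
    (h : (∀ p, Module.Projective R ((chains R K).homology p)) ∨
      (∀ p, Module.Projective R ((chains R L).homology p))) (n : ℤ) :
    IsCoprod fun x : {x : ℤ × ℤ // x.1 + x.2 + 1 = n} =>
      (chainPairing R hM).κ isPairingShape_down x.1.1 x.1.2 n x.2 := by
  rcases h with h | h
  · obtain ⟨r⟩ := nonempty_retraction_chains R K h
    exact (chainPairing R hM).isCoprod_κ isPairingShape_down r (isCoprod_chainPairing R hM)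
      (fun a => inferInstance) n
  · obtain ⟨r⟩ := nonempty_retraction_chains R L h
    refine (chainPairing R hM).isCoprod_κ_of_flip isPairingShape_down
      (fun p q => ((p + 1) * (q + 1)).negOnePow) (fun a b => ?_) (fun a b => ?_) r
      (isCoprod_chainPairing R hM) (fun a => inferInstance) n
    all_goals
      rw [← Int.negOnePow_add, Int.negOnePow_eq_iff]
    -- As the differential lowers degrees, the exponents differ by `-2 (b + 1)` and agree only
    -- modulo 2.
    · exact ⟨-(b + 1), by ring⟩
    · exact ⟨-(a + 1), by ring⟩

end JoinKunneth

/-! ### Sums over the full subcomplexes -/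

section Bigraded

open scoped TensorProduct

theorem IsCoprod.of_reindex {R : Type*} [CommRing R] {ι κ : Type*} {M : ι → Type*}
    [∀ i, AddCommGroup (M i)] [∀ i, Module R (M i)] {N : Type*} [AddCommGroup N] [Module R N]
    {f : ∀ i, M i →ₗ[R] N} {e : κ → ι} (he : Function.Bijective e)
    (hf : IsCoprod fun k => f (e k)) : IsCoprod f := by
  have key : ∀ g : ι → ι, g = id → IsCoprod (fun i => f (g i)) → IsCoprod f := by
    rintro _ rfl h
    exact h
  exact key (e ∘ (Equiv.ofBijective e he).symm)
    (funext (Equiv.ofBijective e he).apply_symm_apply)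
    (hf.reindex (f := fun k => f (e k)) (Equiv.ofBijective e he).symm.bijective)

theorem bideg_eq_iff {V : Type} {p q : ℤ} {I : Finset V} (h : bideg (p, I) = bideg (q, I)) :
    p = q := by
  have := congrArg Prod.fst h
  simpa [bideg] using this

/-- The set `I` and the bidegree determine `p`. Finiteness makes the product over the summands a
direct sum. -/
instance {V : Type} [Finite V] (n : ℤ × ℤ) : Finite {x : ℤ × Finset V // bideg x = n} :=
  Finite.of_injective (fun x => x.1.2) fun ⟨⟨p, I⟩, hx⟩ ⟨⟨q, J⟩, hy⟩ h => by
    obtain rfl : I = J := h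
    obtain rfl := bideg_eq_iff (hx.trans hy.symm)
    rfl

variable (R : Type u) [CommRing R]

section Inc

variable {V : Type} (A : ℤ × Finset V → Type u) [∀ x, AddCommGroup (A x)] [∀ x, Module R (A x)]

open Classical in
/-- The inclusion of the summand `A x` in bidegree `n`; zero if `x` has another bidegree. -/
noncomputable def inc (n : ℤ × ℤ) (x : ℤ × Finset V) :
    A x →ₗ[R] ∀ y : {y : ℤ × Finset V // bideg y = n}, A y.1 :=
  if h : bideg x = n then
    LinearMap.single R (fun y : {y : ℤ × Finset V // bideg y = n} => A y.1) ⟨x, h⟩ else 0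

open Classical in
theorem inc_same {n : ℤ × ℤ} {x : ℤ × Finset V} (h : bideg x = n) (a : A x) :
    inc R A n x a ⟨x, h⟩ = a := by
  rw [inc, dif_pos h]
  exact Pi.single_eq_same (M := fun y : {y : ℤ × Finset V // bideg y = n} => A y.1) ⟨x, h⟩ a

open Classical in
theorem inc_ne {n : ℤ × ℤ} {x y : ℤ × Finset V} (h : bideg y = n) (hxy : y ≠ x) (a : A x) :
    inc R A n x a ⟨y, h⟩ = 0 := by
  rw [inc]
  split_ifs with hx
  · exact Pi.single_eq_of_ne (M := fun y : {y : ℤ × Finset V // bideg y = n} => A y.1)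
      (i := ⟨x, hx⟩) (i' := ⟨y, h⟩) (fun h => hxy (congrArg Subtype.val h)) a
  · rfl

theorem isCoprod_inc [Finite V] (n : ℤ × ℤ) :
    IsCoprod fun x : {x : ℤ × Finset V // bideg x = n} => inc R A n x.1 :=
  (IsCoprod.pi_single (M := fun y : {y : ℤ × Finset V // bideg y = n} => A y.1)).congr
    fun x => by rw [inc, dif_pos x.2]; congr!

/-- Each summand is a retract of the component in its bidegree. This passes the projectivity
hypothesis from the moment-angle complex to the individual full subcomplexes. -/
theorem projective_of_forall_bidegree (h : ∀ n, Module.Projective R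
      (∀ y : {y : ℤ × Finset V // bideg y = n}, A y.1)) (x : ℤ × Finset V) :
    Module.Projective R (A x) :=
  have := h (bideg x)
  Module.Projective.of_split (inc R A (bideg x) x) (LinearMap.proj
    (φ := fun y : {y : ℤ × Finset V // bideg y = bideg x} => A y.1) ⟨x, rfl⟩)
    (LinearMap.ext fun a => inc_same R A rfl a)

end Inc

variable {V W : Type} [LinearOrder V] [LinearOrder W]

/-- The index of the product of two summands. -/
def joinIndex (x : ℤ × Finset V) (y : ℤ × Finset W) : ℤ × Finset (Lex (V ⊕ W)) :=
  (x.1 + y.1 + 1, dsum x.2 y.2)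

theorem bideg_joinIndex (x : ℤ × Finset V) (y : ℤ × Finset W) :
    bideg (joinIndex x y) = bideg x + bideg y := by
  simp only [bideg, joinIndex, card_dsum, Prod.mk_add_mk, Prod.mk.injEq]
  push_cast
  constructor <;> ring

/-- Summands of the product in bidegree `n` correspond to pairs of summands of the factors. -/
def joinIndexEquiv (n : ℤ × ℤ) :
    (Σ i : {x : (ℤ × ℤ) × (ℤ × ℤ) // x.1 + x.2 = n},
      {x : ℤ × Finset V // bideg x = i.1.1} × {y : ℤ × Finset W // bideg y = i.1.2}) ≃
    Σ z : {z : ℤ × Finset (Lex (V ⊕ W)) // bideg z = n},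
      {x : (ℤ × Finset V) × (ℤ × Finset W) // joinIndex x.1 x.2 = z.1} where
  toFun i := ⟨⟨joinIndex i.2.1.1 i.2.2.1, by
        rw [bideg_joinIndex, i.2.1.2, i.2.2.2, i.1.2]⟩, ⟨(i.2.1.1, i.2.2.1), rfl⟩⟩
  invFun j := ⟨⟨(bideg j.2.1.1, bideg j.2.1.2), by
        rw [← bideg_joinIndex, j.2.2, j.1.2]⟩, (⟨j.2.1.1, rfl⟩, ⟨j.2.1.2, rfl⟩)⟩
  left_inv := by
        rintro ⟨⟨⟨n₁, n₂⟩, h⟩, ⟨x, hx⟩, ⟨y, hy⟩⟩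
        dsimp only at hx hy
        subst hx hy
        rfl
  right_inv := by
        rintro ⟨⟨z, hz⟩, ⟨⟨x, y⟩, h⟩⟩
        dsimp only at h
        subst h
        rfl

variable [Fintype V] [Fintype W]
  {A : ℤ × Finset V → Type u} [∀ x, AddCommGroup (A x)] [∀ x, Module R (A x)]
  {B : ℤ × Finset W → Type u} [∀ x, AddCommGroup (B x)] [∀ x, Module R (B x)]
  {C : ℤ × Finset (Lex (V ⊕ W)) → Type u} [∀ x, AddCommGroup (C x)] [∀ x, Module R (C x)]
  (m : ∀ x y z, joinIndex x y = z → (A x ⊗[R] B y →ₗ[R] C z))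

/-- The product of bigraded modules given by products of their summands. -/
noncomputable def bigradedMul (n₁ n₂ n : ℤ × ℤ) :
    (∀ x : {x : ℤ × Finset V // bideg x = n₁}, A x.1) ⊗[R]
      (∀ y : {y : ℤ × Finset W // bideg y = n₂}, B y.1) →ₗ[R]
      ∀ z : {z : ℤ × Finset (Lex (V ⊕ W)) // bideg z = n}, C z.1 :=
  ((isCoprod_inc R A n₁).tensor (isCoprod_inc R B n₂)).desc fun x =>
    inc R C n (joinIndex x.1.1 x.2.1) ∘ₗ m x.1.1 x.2.1 _ rfl

omit [LinearOrder V] [LinearOrder W] in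
theorem bigradedMul_inc {n₁ n₂ n : ℤ × ℤ} {x : ℤ × Finset V} {y : ℤ × Finset W}
    (hx : bideg x = n₁) (hy : bideg y = n₂) {z : ℤ × Finset (Lex (V ⊕ W))}
    (hz : joinIndex x y = z) (a : A x) (b : B y) :
    bigradedMul R m n₁ n₂ n (inc R A n₁ x a ⊗ₜ inc R B n₂ y b) =
      inc R C n z (m x y z hz (a ⊗ₜ b)) := by
  subst hz
  exact ((isCoprod_inc R A n₁).tensor (isCoprod_inc R B n₂)).desc_apply (fun x =>
    inc R C n (joinIndex x.1.1 x.2.1) ∘ₗ m x.1.1 x.2.1 _ rfl) (⟨x, hx⟩, ⟨y, hy⟩) (a ⊗ₜ b)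

/-- Splitting both sides into single summands leaves a reindexing: grouping pairs of summands by
their two bidegrees, or by the summand in which their product lies. -/
theorem isCoprod_bigradedMul (hm : ∀ z, IsCoprod
      fun x : {x : (ℤ × Finset V) × (ℤ × Finset W) // joinIndex x.1 x.2 = z} =>
        m x.1.1 x.1.2 z x.2) (n : ℤ × ℤ) :
    IsCoprod fun x : {x : (ℤ × ℤ) × (ℤ × ℤ) // x.1 + x.2 = n} =>
      bigradedMul R m x.1.1 x.1.2 n := by
  have h1 := (isCoprod_inc R C n).sigma fun z => hm z.1
  have h2 := h1.reindex (joinIndexEquiv (V := V) (W := W) n).bijective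
  have h3 : IsCoprod fun i : Σ i : {x : (ℤ × ℤ) × (ℤ × ℤ) // x.1 + x.2 = n},
      {x : ℤ × Finset V // bideg x = i.1.1} × {y : ℤ × Finset W // bideg y = i.1.2} =>
      bigradedMul R m i.1.1.1 i.1.1.2 n ∘ₗ
        TensorProduct.map (inc R A i.1.1.1 i.2.1.1) (inc R B i.1.1.2 i.2.2.1) := by
    refine h2.congr fun i => TensorProduct.ext' fun a b => ?_
    exact bigradedMul_inc R m i.2.1.2 i.2.2.2 rfl a b
  exact h3.of_sigma fun i => (isCoprod_inc R A i.1.1).tensor (isCoprod_inc R B i.1.2)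

theorem bigraded_bilinear_ext {V W : Type} [Finite V] [Finite W] {A : ℤ × Finset V → Type u}
    [∀ x, AddCommGroup (A x)] [∀ x, Module R (A x)] {B : ℤ × Finset W → Type u}
    [∀ x, AddCommGroup (B x)] [∀ x, Module R (B x)] {n₁ n₂ : ℤ × ℤ} {N : Type*} [AddCommGroup N]
    [Module R N] {f g : (∀ x : {x : ℤ × Finset V // bideg x = n₁}, A x.1) ⊗[R]
      (∀ y : {y : ℤ × Finset W // bideg y = n₂}, B y.1) →ₗ[R] N}
    (h : ∀ p I q J, bideg (p, I) = n₁ → bideg (q, J) = n₂ → ∀ (a : A (p, I)) (b : B (q, J)),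
      f (inc R A n₁ (p, I) a ⊗ₜ inc R B n₂ (q, J) b) =
        g (inc R A n₁ (p, I) a ⊗ₜ inc R B n₂ (q, J) b)) : f = g :=
  ((isCoprod_inc R A n₁).tensor (isCoprod_inc R B n₂)).hom_ext fun x t => by
    induction t with
    | zero => simp
    | add s t hs ht => simp only [map_add, hs, ht]
    | tmul a b => exact h _ _ _ _ x.1.2 x.2.2 a b

/-- The sign in the product of the summands with indices `x` and `y`. -/
def joinSign (x : ℤ × Finset V) (y : ℤ × Finset W) : ℤˣ :=
  ((y.1 + 1) * x.2.card).negOnePow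

/-- A subset of `V ⊔ W` determines its two parts, so the pairs over `(r, I ⊔ J)` are just the `(p,
q)` with `p + q + 1 = r`. The signs are units. -/
theorem isCoprod_joinSign_smul (hm : ∀ I J r,
      IsCoprod fun x : {x : ℤ × ℤ // x.1 + x.2 + 1 = r} =>
        m (x.1.1, I) (x.1.2, J) (r, dsum I J) (Prod.ext x.2 rfl))
    (z : ℤ × Finset (Lex (V ⊕ W))) :
    IsCoprod fun x : {x : (ℤ × Finset V) × (ℤ × Finset W) // joinIndex x.1 x.2 = z} =>
      (joinSign x.1.1 x.1.2 : ℤ) • m x.1.1 x.1.2 z x.2 := by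
  obtain ⟨r, M⟩ := z
  obtain ⟨I, J, rfl⟩ : ∃ I J, M = dsum I J := ⟨_, _, (dsum_leftPart_rightPart M).symm⟩
  let e (x : {x : ℤ × ℤ // x.1 + x.2 + 1 = r}) :
      {x : (ℤ × Finset V) × (ℤ × Finset W) // joinIndex x.1 x.2 = (r, dsum I J)} :=
    ⟨((x.1.1, I), (x.1.2, J)), Prod.ext x.2 rfl⟩
  have he : Function.Bijective e := by
    constructor
    · rintro ⟨⟨p, q⟩, h⟩ ⟨⟨p', q'⟩, h'⟩ hh
      have h1 := congrArg (fun x => (x.1.1.1, x.1.2.1)) hh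
      exact Subtype.ext h1
    · rintro ⟨⟨⟨p, I'⟩, ⟨q, J'⟩⟩, h⟩
      obtain ⟨rfl, rfl⟩ := dsum_inj.1 (congrArg Prod.snd h)
      exact ⟨⟨(p, q), congrArg Prod.fst h⟩, rfl⟩
  have h2 : IsCoprod fun x : {x : (ℤ × Finset V) × (ℤ × Finset W) //
      joinIndex x.1 x.2 = (r, dsum I J)} => m x.1.1 x.1.2 (r, dsum I J) x.2 :=
    IsCoprod.of_reindex he (hm I J r)
  refine (h2.comp_equiv fun x => LinearEquiv.smulOfUnit
    (Units.map (Int.castRingHom R).toMonoidHom (joinSign x.1.1 x.1.2))).congr fun x =>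
      LinearMap.ext fun a => ?_
  change (joinSign x.1.1 x.1.2 : ℤ) • m _ _ _ x.2 a =
    m _ _ _ x.2 (((joinSign x.1.1 x.1.2 : ℤ) : R) • a)
  rw [map_smul, Int.cast_smul_eq_zsmul]

end Bigraded

/-! ### The product on the cohomology of moment-angle complexes -/

section Coh

open scoped TensorProduct

variable (R : Type u) [CommRing R] {V W : Type} [LinearOrder V] [LinearOrder W] [Fintype V]
  [Fintype W] (K : PreAbstractSimplicialComplex V) (L : PreAbstractSimplicialComplex W)

theorem isJoin_full_of_joinIndex {x : ℤ × Finset V} {y : ℤ × Finset W}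
    {z : ℤ × Finset (Lex (V ⊕ W))} (h : joinIndex x y = z) :
    IsJoin (full (join K L) z.2) (full K x.2) (full L y.2) := by
  have := isJoin_full K L x.2 y.2
  rwa [show dsum x.2 y.2 = z.2 from congrArg Prod.snd h] at this

/-- The cohomology `H̃^p(K_I)` as a family indexed by pairs `(p, I)`. -/
abbrev redCohFamily (x : ℤ × Finset V) : Type u := redCohomology R K x.1 x.2

/-- The product `H̃^p(K_I) ⊗ H̃^q(L_J) → H̃^(p+q+1)((K * L)_{I ⊔ J})`. -/
noncomputable def cohCross (x : ℤ × Finset V) (y : ℤ × Finset W)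
    (z : ℤ × Finset (Lex (V ⊕ W))) (h : joinIndex x y = z) :
    redCohFamily R K x ⊗[R] redCohFamily R L y →ₗ[R] redCohFamily R (join K L) z :=
  (cochainPairing R (isJoin_full_of_joinIndex K L h)).κ isPairingShape_up x.1 y.1 z.1
    (congrArg Prod.fst h)

omit [Fintype V] in
theorem psi_refl (p : ℤ) {I : Finset V} (h : I ⊆ I) (a : redCohomology R K p I) :
    psi R K p h a = a := by
  have : restrict R (full_mono K h) = 𝟙 (cochains R (full K I)) := rfl
  rw [psi, this, HomologicalComplex.homologyMap_id]
  rfl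

theorem psi_cohCross {p q r : ℤ} {I I' : Finset V} {J J' : Finset W}
    {M M' : Finset (Lex (V ⊕ W))} (h : joinIndex (p, I) (q, J) = (r, M))
    (h' : joinIndex (p, I') (q, J') = (r, M')) (hI : I' ⊆ I) (hJ : J' ⊆ J) (hM : M' ⊆ M)
    (a : redCohomology R K p I) (b : redCohomology R L q J) :
    psi R (join K L) r hM (cohCross R K L (p, I) (q, J) (r, M) h (a ⊗ₜ b)) =
      cohCross R K L (p, I') (q, J') (r, M') h' (psi R K p hI a ⊗ₜ psi R L q hJ b) :=
  Pairing.homologyMap_κ isPairingShape_up (cochainPairing R (isJoin_full_of_joinIndex K L h))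
    (cochainPairing R (isJoin_full_of_joinIndex K L h')) (restrict R (full_mono K hI))
    (restrict R (full_mono L hJ)) (restrict R (full_mono (join K L) hM)) (congrArg Prod.fst h)
    (fun x y => restrictMap_cochainMul R (isJoin_full_of_joinIndex K L h)
      (isJoin_full_of_joinIndex K L h') (full_mono (join K L) hM) (full_mono K hI)
      (full_mono L hJ) (congrArg Prod.fst h) x y) a b

omit [Fintype V] in
theorem psiProj_inc {n : ℤ × ℤ} {p : ℤ} {I J : Finset V} (hIJ : I ⊆ J) (h : bideg (p, J) = n)
    (a : redCohomology R K p J) :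
    psiProj R K n p hIJ (inc R (redCohFamily R K) n (p, J) a) = psi R K p hIJ a := by
  rw [psiProj, dif_pos h]
  exact congrArg (psi R K p hIJ) (inc_same R (redCohFamily R K) h a)

omit [Fintype V] in
theorem psiProj_inc_of_ne {n : ℤ × ℤ} {p : ℤ} {I J : Finset V} (hIJ : I ⊆ J) {x : ℤ × Finset V}
    (hx : (p, J) ≠ x) (a : redCohFamily R K x) :
    psiProj R K n p hIJ (inc R (redCohFamily R K) n x a) = 0 := by
  rw [psiProj]
  split_ifs with h
  · exact (congrArg (psi R K p hIJ) (inc_ne R (redCohFamily R K) h hx a)).trans (map_zero _)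
  · rfl

omit [Fintype V] in
theorem inc_psi {n : ℤ × ℤ} {p : ℤ} {I J J' : Finset V} (hJ : J ⊆ I) (hJ' : J' ⊆ I) (e : J = J')
    (h : bideg (p, J') = n) (a : redCohomology R K p I) :
    inc R (redCohFamily R K) n (p, J) (psi R K p hJ a) ⟨(p, J'), h⟩ = psi R K p hJ' a := by
  subst e
  exact inc_same R (redCohFamily R K) h _

/-- Passes from the components of `d'` at each target summand to its values on each source summand,
the form in which it can be applied to products. -/
theorem dPrime_inc (n n' : ℤ × ℤ) (p : ℤ) (I : Finset V) (h : bideg (p, I) = n)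
    (a : redCohomology R K p I) :
    dPrime R K n n' (inc R (redCohFamily R K) n (p, I) a) =
      ∑ i ∈ I, (((p + 1).negOnePow : ℤ) * eps i I) •
        inc R (redCohFamily R K) n' (p, I.erase i) (psi R K p (Finset.erase_subset i I) a) := by
  refine funext fun ⟨⟨p', I'⟩, hy⟩ => ?_
  rw [dPrime, LinearMap.pi_apply, LinearMap.sum_apply, Finset.sum_apply]
  dsimp only
  -- Only targets with `I'` equal to `I` minus one element receive a contribution, and then `i` is
  -- unique and both sums reduce to its term.
  by_cases hx : p' = p ∧ ∃ i, i ∉ I' ∧ insert i I' = I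
  · obtain ⟨rfl, i, hi, rfl⟩ := hx
    rw [Finset.sum_eq_single i, Finset.sum_eq_single i]
    · rw [LinearMap.smul_apply, psiProj_inc R K _ h, Pi.smul_apply,
        inc_psi R K _ _ (Finset.erase_insert hi)]
    · intro j hj hij
      rw [Pi.smul_apply, inc_ne, smul_zero]
      intro hh
      have := congrArg Prod.snd hh
      dsimp only at this
      rw [Finset.ext_iff] at this
      have := this i
      simp [hi, hij.symm] at this
    · simp
    · intro j hj hij
      rw [LinearMap.smul_apply, psiProj_inc_of_ne, smul_zero]
      intro hh
      have := congrArg Prod.snd hh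
      dsimp only at this
      rw [Finset.ext_iff] at this
      have := this j
      simp [hij, (Finset.mem_sdiff.1 hj).2] at this
    · simp [hi]
  · rw [Finset.sum_eq_zero, Finset.sum_eq_zero]
    · intro i hi
      rw [Pi.smul_apply, inc_ne, smul_zero]
      intro hh
      obtain ⟨rfl, rfl⟩ := Prod.mk.inj hh
      exact hx ⟨rfl, i, by simp, Finset.insert_erase hi⟩
    · intro i hi
      rw [LinearMap.smul_apply, psiProj_inc_of_ne, smul_zero]
      intro hh
      obtain ⟨rfl, hI⟩ := Prod.mk.inj hh
      exact hx ⟨rfl, i, (Finset.mem_sdiff.1 hi).2, hI⟩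

/-- The product of the summands of the cohomology of moment-angle complexes, with signs. -/
noncomputable def cohSummandMul (x : ℤ × Finset V) (y : ℤ × Finset W)
    (z : ℤ × Finset (Lex (V ⊕ W))) (h : joinIndex x y = z) :
    redCohFamily R K x ⊗[R] redCohFamily R L y →ₗ[R] redCohFamily R (join K L) z :=
  (joinSign x y : ℤ) • cohCross R K L x y z h

theorem inc_psi_cohSummandMul {n : ℤ × ℤ} {p q r : ℤ} {I I' : Finset V} {J J' : Finset W}
    {M M' : Finset (Lex (V ⊕ W))} (h : joinIndex (p, I) (q, J) = (r, M))
    (hI : I' ⊆ I) (hJ : J' ⊆ J) (hM : M' ⊆ M) (e : M' = dsum I' J') {n₁ n₂ : ℤ × ℤ}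
    (hn₁ : bideg (p, I') = n₁) (hn₂ : bideg (q, J') = n₂)
    (a : redCohomology R K p I) (b : redCohomology R L q J) :
    inc R (redCohFamily R (join K L)) n (r, M') (psi R (join K L) r hM
      (cohSummandMul R K L (p, I) (q, J) (r, M) h (a ⊗ₜ b))) =
      ((joinSign (p, I) (q, J) : ℤ) * joinSign (p, I') (q, J')) •
      bigradedMul R (cohSummandMul R K L) n₁ n₂ n
        (inc R (redCohFamily R K) n₁ (p, I') (psi R K p hI a) ⊗ₜ
          inc R (redCohFamily R L) n₂ (q, J') (psi R L q hJ b)) := by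
  have h' : joinIndex (p, I') (q, J') = (r, M') :=
    Prod.ext (congrArg Prod.fst h : p + q + 1 = r) e.symm
  rw [bigradedMul_inc R (cohSummandMul R K L) hn₁ hn₂ h', cohSummandMul, cohSummandMul,
    LinearMap.smul_apply, LinearMap.smul_apply, map_zsmul, map_zsmul, map_zsmul,
    psi_cohCross R K L h h' hI hJ hM, smul_smul, mul_assoc, ← Units.val_mul (joinSign _ _),
    Int.units_mul_self, Units.val_one, mul_one]

omit [LinearOrder W] [Fintype V] [Fintype W] in
-- The purpose of `joinSign`: shrinking `I` by one element changes it by exactly the factor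
-- `(-1)^(q+1)` by which the unscaled product fails the Leibniz rule.
theorem joinSign_mul_joinSign_erase (p q : ℤ) {I : Finset V} (J : Finset W) {i : V} (hi : i ∈ I) :
    (joinSign (p, I) (q, J) : ℤ) * joinSign (p, I.erase i) (q, J) = ((q + 1).negOnePow : ℤ) := by
  rw [← Units.val_mul, joinSign, joinSign, ← Int.negOnePow_add, Units.val_inj,
    Int.negOnePow_eq_iff, ← Finset.card_erase_add_one hi]
  push_cast
  exact ⟨(q + 1) * (I.erase i).card, by ring⟩

omit [LinearOrder V] [LinearOrder W] [Fintype V] [Fintype W] in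
-- The sign depends on `|I|` and `q` but not on `J`, so the second Leibniz term, already correct, is
-- not disturbed.
theorem joinSign_mul_joinSign_right (p q : ℤ) (I : Finset V) (J J' : Finset W) :
    (joinSign (p, I) (q, J) : ℤ) * joinSign (p, I) (q, J') = 1 := by
  change (joinSign (p, I) (q, J) : ℤ) * joinSign (p, I) (q, J) = 1
  rw [← Units.val_mul, Int.units_mul_self, Units.val_one]

theorem negOnePow_join (p q : ℤ) :
    ((p + q + 1 + 1).negOnePow : ℤ) = ((p + 1).negOnePow : ℤ) * (q + 1).negOnePow := by
  rw [← Units.val_mul, ← Int.negOnePow_add]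
  congr 2
  ring

theorem negOnePow_mul_self (p : ℤ) : (p.negOnePow : ℤ) * p.negOnePow = 1 := by
  rw [← Units.val_mul, Int.units_mul_self, Units.val_one]

theorem totalSign_bideg {V : Type} (p : ℤ) (I : Finset V) :
    (totalSign (Multiplicative.ofAdd (bideg (p, I))) : ℤ) =
      ((p + 1).negOnePow : ℤ) * (-1) ^ I.card := by
  rw [neg_one_pow_card I rfl, ← Units.val_mul, ← Int.negOnePow_add]
  change ((p + 1 - I.card + 2 * I.card).negOnePow : ℤ) = _
  congr 2
  ring

theorem dPrime_bigradedMul {n₁ n₁' n₂ n₂' : ℤ × ℤ} (h₁ : n₁ + (1, -2) = n₁')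
    (h₂ : n₂ + (1, -2) = n₂') (n n' : ℤ × ℤ) (hn : n₁ + n₂ = n) (x : CohX R K n₁)
    (y : CohX R L n₂) :
    dPrime R (join K L) n n' (bigradedMul R (cohSummandMul R K L) n₁ n₂ n (x ⊗ₜ y)) =
      bigradedMul R (cohSummandMul R K L) n₁' n₂ n' (dPrime R K n₁ n₁' x ⊗ₜ y) +
        (totalSign (Multiplicative.ofAdd n₁) : ℤ) •
          bigradedMul R (cohSummandMul R K L) n₁ n₂' n' (x ⊗ₜ dPrime R L n₂ n₂' y) := by
  refine LinearMap.congr_fun (f := dPrime R (join K L) n n' ∘ₗ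
      bigradedMul R (cohSummandMul R K L) n₁ n₂ n)
    (g := bigradedMul R (cohSummandMul R K L) n₁' n₂ n' ∘ₗ
        TensorProduct.map (dPrime R K n₁ n₁') LinearMap.id +
      (totalSign (Multiplicative.ofAdd n₁) : ℤ) • bigradedMul R (cohSummandMul R K L) n₁ n₂' n' ∘ₗ
        TensorProduct.map LinearMap.id (dPrime R L n₂ n₂'))
    (bigraded_bilinear_ext R fun p I q J hp hq a b => ?_) (x ⊗ₜ y)
  simp only [LinearMap.comp_apply, LinearMap.add_apply, LinearMap.smul_apply,
    TensorProduct.map_tmul, LinearMap.id_apply]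
  have hb : bideg (p + q + 1, dsum I J) = n := by
    rw [← hn, ← hp, ← hq]
    exact bideg_joinIndex (p, I) (q, J)
  have hz : joinIndex (p, I) (q, J) = (p + q + 1, dsum I J) := rfl
  have e1 : bigradedMul R (cohSummandMul R K L) n₁ n₂ n (inc R (redCohFamily R K) n₁ (p, I) a ⊗ₜ
      inc R (redCohFamily R L) n₂ (q, J) b) = inc R (redCohFamily R (join K L)) n
        (p + q + 1, dsum I J)
        (cohSummandMul R K L (p, I) (q, J) (p + q + 1, dsum I J) hz (a ⊗ₜ b)) :=
    bigradedMul_inc R (cohSummandMul R K L) hp hq hz a b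
  have hI {i : V} (hi : i ∈ I) : bideg (p, I.erase i) = n₁' := by
    rw [← h₁, ← hp, ← bideg_erase p hi, add_assoc]
    exact (add_zero _).symm
  have hJ {j : W} (hj : j ∈ J) : bideg (q, J.erase j) = n₂' := by
    rw [← h₂, ← hq, ← bideg_erase q hj, add_assoc]
    exact (add_zero _).symm
  rw [e1, dPrime_inc R (join K L) n n' _ _ hb, dPrime_inc R K n₁ n₁' p I hp,
    dPrime_inc R L n₂ n₂' q J hq, sum_dsum, TensorProduct.sum_tmul, TensorProduct.tmul_sum,
    map_sum, map_sum, Finset.smul_sum]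
  congr 1
  -- The sign `(-1)^(p+q+2)` of `d'` on the join and the factor `(-1)^(q+1)` from `joinSign` leave
  -- `(-1)^(p+1)`, the sign of `d'` on `H̃^p(K_I)`.
  · refine Finset.sum_congr rfl fun i hi => ?_
    refine (congrArg ((((p + q + 1 + 1).negOnePow : ℤ) *
      eps (toLex (Sum.inl i)) (dsum I J)) • ·) (inc_psi_cohSummandMul R K L hz
        (Finset.erase_subset i I) (Finset.Subset.refl J) _ (erase_inl I J i) (hI hi) hq a b)).trans
      ?_
    rw [psi_refl, map_zsmul_tmul, smul_smul,
      joinSign_mul_joinSign_erase p q J hi, eps_inl, negOnePow_join]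
    congr 1
    linear_combination (((p + 1).negOnePow : ℤ) * eps i I) * negOnePow_mul_self (q + 1)
  -- Here `ε` contributes `(-1)^|I|`, which with `(-1)^(p+1)` is the sign of the total degree of the
  -- first factor; `(-1)^(q+1)` remains for `d'` on `H̃^q(L_J)`.
  · refine Finset.sum_congr rfl fun j hj => ?_
    refine (congrArg ((((p + q + 1 + 1).negOnePow : ℤ) *
      eps (toLex (Sum.inr j)) (dsum I J)) • ·) (inc_psi_cohSummandMul R K L hz
        (Finset.Subset.refl I) (Finset.erase_subset j J) _ (erase_inr I J j) hp (hJ hj) a b)).trans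
      ?_
    rw [psi_refl, map_tmul_zsmul, smul_smul, smul_smul,
      joinSign_mul_joinSign_right p q I J, eps_inr, negOnePow_join, ← hp, totalSign_bideg]
    congr 1
    ring

/-- The product on the complexes `CH^*` of simplicial complexes with values in that of the join. -/
noncomputable def cohPairing : Pairing (· + ·) cohShape.ε (CHcoh R K) (CHcoh R L)
    (CHcoh R (join K L)) where
  μ n₁ n₂ n _ := bigradedMul R (cohSummandMul R K L) n₁ n₂ n
  leibniz h₁ h₂ hn _ _ x y := dPrime_bigradedMul R K L h₁ h₂ _ _ hn x y

theorem isCoprod_cohPairing (h : (∀ n, Module.Projective R ((CHcoh R K).X n)) ∨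
      (∀ n, Module.Projective R ((CHcoh R L).X n))) (n : ℤ × ℤ) :
    IsCoprod fun x : {x : (ℤ × ℤ) × (ℤ × ℤ) // x.1 + x.2 = n} =>
      (cohPairing R K L).μ x.1.1 x.1.2 n x.2 := by
  have h' : (∀ x, Module.Projective R (redCohFamily R K x)) ∨
      (∀ x, Module.Projective R (redCohFamily R L x)) :=
    h.imp (fun h => projective_of_forall_bidegree R (redCohFamily R K) h)
      (fun h => projective_of_forall_bidegree R (redCohFamily R L) h)
  exact isCoprod_bigradedMul R (cohSummandMul R K L) (isCoprod_joinSign_smul R (cohCross R K L)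
    fun I J r => isCoprod_κ_cochainPairing R (isJoin_full K L I J)
      (h'.imp (fun h p => h (p, I)) (fun h p => h (p, J))) r) n

theorem nonempty_CHcoh_join_iso (h : (∀ n, Module.Projective R ((CHcoh R K).X n)) ∨
      (∀ n, Module.Projective R ((CHcoh R L).X n))) :
    Nonempty (CHcoh R (join K L) ≅
      HomologicalComplex.tensorObj (CHcoh R K) (CHcoh R L)) :=
  (cohPairing R K L).nonempty_iso (δ := (1, -2)) (fun _ _ => Iff.rfl)
    (isCoprod_cohPairing R K L h)

theorem nonempty_HHcoh_join_iso (F : Type u) [Field F] :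
    Nonempty (HHcoh F (join K L) ≅
      GradedObject.Monoidal.tensorObj (HHcoh F K) (HHcoh F L)) := by
  obtain ⟨e⟩ := nonempty_CHcoh_join_iso F K L (Or.inl fun n => inferInstance)
  obtain ⟨e'⟩ := nonempty_homology_tensorObj_iso (δ := (1, -2)) (fun _ _ => Iff.rfl)
    (CHcoh F K) (CHcoh F L)
  exact ⟨GradedObject.isoMk _ _ (fun n => HomologicalComplex.homologyMapIso e n) ≪≫ e'⟩

end Coh

/-! ### The product on the homology of moment-angle complexes -/

section Hom

open scoped TensorProduct

variable (R : Type u) [CommRing R] {V W : Type} [LinearOrder V] [LinearOrder W] [Fintype V]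
  [Fintype W] (K : PreAbstractSimplicialComplex V) (L : PreAbstractSimplicialComplex W)

theorem univ_sdiff_dsum [Fintype (Lex (V ⊕ W))] [DecidableEq (Lex (V ⊕ W))] (I : Finset V)
    (J : Finset W) : Finset.univ \ dsum I J = dsum (Finset.univ \ I) (Finset.univ \ J) :=
  ext_sum (by simp) (by simp)

/-- The homology `H̃_p(K_I)` as a family indexed by pairs `(p, I)`. -/
abbrev redHomFamily (x : ℤ × Finset V) : Type u := redHomology R K x.1 x.2

/-- The product `H̃_p(K_I) ⊗ H̃_q(L_J) → H̃_(p+q+1)((K * L)_{I ⊔ J})`. -/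
noncomputable def homCross (x : ℤ × Finset V) (y : ℤ × Finset W)
    (z : ℤ × Finset (Lex (V ⊕ W))) (h : joinIndex x y = z) :
    redHomFamily R K x ⊗[R] redHomFamily R L y →ₗ[R] redHomFamily R (join K L) z :=
  (chainPairing R (isJoin_full_of_joinIndex K L h)).κ isPairingShape_down x.1 y.1 z.1
    (congrArg Prod.fst h)

omit [Fintype V] in
theorem phi_refl (p : ℤ) {I : Finset V} (h : I ⊆ I) (a : redHomology R K p I) :
    phi R K p h a = a := by
  have : extend R (full_mono K h) = 𝟙 (chains R (full K I)) := by
    ext p : 1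
    exact ModuleCat.hom_ext (LinearMap.ext fun x => Finsupp.mapDomain_id (v := x))
  rw [phi, this, HomologicalComplex.homologyMap_id]
  rfl

theorem phi_homCross {p q r : ℤ} {I I' : Finset V} {J J' : Finset W}
    {M M' : Finset (Lex (V ⊕ W))} (h : joinIndex (p, I) (q, J) = (r, M))
    (h' : joinIndex (p, I') (q, J') = (r, M')) (hI : I ⊆ I') (hJ : J ⊆ J') (hM : M ⊆ M')
    (a : redHomology R K p I) (b : redHomology R L q J) :
    phi R (join K L) r hM (homCross R K L (p, I) (q, J) (r, M) h (a ⊗ₜ b)) =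
      homCross R K L (p, I') (q, J') (r, M') h' (phi R K p hI a ⊗ₜ phi R L q hJ b) :=
  Pairing.homologyMap_κ isPairingShape_down (chainPairing R (isJoin_full_of_joinIndex K L h))
    (chainPairing R (isJoin_full_of_joinIndex K L h')) (extend R (full_mono K hI))
    (extend R (full_mono L hJ)) (extend R (full_mono (join K L) hM)) (congrArg Prod.fst h)
    (fun x y => extend_chainMul R (isJoin_full_of_joinIndex K L h) (full_mono (join K L) hM)
      (full_mono K hI) (full_mono L hJ) (congrArg Prod.fst h) x y) a b

omit [Fintype V] in
theorem phiProj_inc {n : ℤ × ℤ} {p : ℤ} {I J : Finset V} (hIJ : I ⊆ J) (h : bideg (p, I) = n)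
    (a : redHomology R K p I) :
    phiProj R K n p hIJ (inc R (redHomFamily R K) n (p, I) a) = phi R K p hIJ a := by
  rw [phiProj, dif_pos h]
  exact congrArg (phi R K p hIJ) (inc_same R (redHomFamily R K) h a)

omit [Fintype V] in
theorem phiProj_inc_of_ne {n : ℤ × ℤ} {p : ℤ} {I J : Finset V} (hIJ : I ⊆ J) {x : ℤ × Finset V}
    (hx : (p, I) ≠ x) (a : redHomFamily R K x) :
    phiProj R K n p hIJ (inc R (redHomFamily R K) n x a) = 0 := by
  rw [phiProj]
  split_ifs with h
  · exact (congrArg (phi R K p hIJ) (inc_ne R (redHomFamily R K) h hx a)).trans (map_zero _)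
  · rfl

omit [Fintype V] in
theorem inc_phi {n : ℤ × ℤ} {p : ℤ} {I J J' : Finset V} (hJ : I ⊆ J) (hJ' : I ⊆ J') (e : J = J')
    (h : bideg (p, J') = n) (a : redHomology R K p I) :
    inc R (redHomFamily R K) n (p, J) (phi R K p hJ a) ⟨(p, J'), h⟩ = phi R K p hJ' a := by
  subst e
  exact inc_same R (redHomFamily R K) h _

/-- Counterpart of `dPrime_inc`: a target summand receives a contribution only if its vertex set is
`I` with one element added. -/
theorem partialPrime_inc (n n' : ℤ × ℤ) (p : ℤ) (I : Finset V) (h : bideg (p, I) = n)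
    (a : redHomology R K p I) :
    partialPrime R K n n' (inc R (redHomFamily R K) n (p, I) a) =
      ∑ i ∈ Finset.univ \ I, (((p + 1).negOnePow : ℤ) * eps i I) •
        inc R (redHomFamily R K) n' (p, insert i I) (phi R K p (Finset.subset_insert i I) a) := by
  refine funext fun ⟨⟨p', I'⟩, hy⟩ => ?_
  rw [partialPrime, LinearMap.pi_apply, LinearMap.sum_apply, Finset.sum_apply]
  dsimp only
  by_cases hx : p' = p ∧ ∃ i, i ∈ I' ∧ I'.erase i = I
  · obtain ⟨rfl, i, hi, rfl⟩ := hx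
    rw [Finset.sum_eq_single i, Finset.sum_eq_single i]
    · rw [LinearMap.smul_apply, phiProj_inc R K _ h, Pi.smul_apply,
        inc_phi R K _ _ (Finset.insert_erase hi)]
    · intro j hj hij
      rw [Pi.smul_apply, inc_ne, smul_zero]
      intro hh
      have := congrArg Prod.snd hh
      dsimp only at this
      rw [Finset.ext_iff] at this
      have := this i
      simp [hi, hij.symm] at this
    · simp
    · intro j hj hij
      rw [LinearMap.smul_apply, phiProj_inc_of_ne, smul_zero]
      intro hh
      have := congrArg Prod.snd hh
      dsimp only at this
      rw [Finset.ext_iff] at this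
      have := this j
      simp [hij, hj] at this
    · simp [hi]
  · rw [Finset.sum_eq_zero, Finset.sum_eq_zero]
    · intro i hi
      rw [Pi.smul_apply, inc_ne, smul_zero]
      intro hh
      obtain ⟨rfl, rfl⟩ := Prod.mk.inj hh
      exact hx ⟨rfl, i, by simp, Finset.erase_insert (Finset.mem_sdiff.1 hi).2⟩
    · intro i hi
      rw [LinearMap.smul_apply, phiProj_inc_of_ne, smul_zero]
      intro hh
      obtain ⟨rfl, hI⟩ := Prod.mk.inj hh
      exact hx ⟨rfl, i, hi, hI⟩

/-- The product of the summands of the homology of moment-angle complexes, with signs. -/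
noncomputable def homSummandMul (x : ℤ × Finset V) (y : ℤ × Finset W)
    (z : ℤ × Finset (Lex (V ⊕ W))) (h : joinIndex x y = z) :
    redHomFamily R K x ⊗[R] redHomFamily R L y →ₗ[R] redHomFamily R (join K L) z :=
  (joinSign x y : ℤ) • homCross R K L x y z h

theorem inc_phi_homSummandMul {n : ℤ × ℤ} {p q r : ℤ} {I I' : Finset V} {J J' : Finset W}
    {M M' : Finset (Lex (V ⊕ W))} (h : joinIndex (p, I) (q, J) = (r, M))
    (hI : I ⊆ I') (hJ : J ⊆ J') (hM : M ⊆ M') (e : M' = dsum I' J') {n₁ n₂ : ℤ × ℤ}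
    (hn₁ : bideg (p, I') = n₁) (hn₂ : bideg (q, J') = n₂)
    (a : redHomology R K p I) (b : redHomology R L q J) :
    inc R (redHomFamily R (join K L)) n (r, M') (phi R (join K L) r hM
      (homSummandMul R K L (p, I) (q, J) (r, M) h (a ⊗ₜ b))) =
      ((joinSign (p, I) (q, J) : ℤ) * joinSign (p, I') (q, J')) •
      bigradedMul R (homSummandMul R K L) n₁ n₂ n
        (inc R (redHomFamily R K) n₁ (p, I') (phi R K p hI a) ⊗ₜ
          inc R (redHomFamily R L) n₂ (q, J') (phi R L q hJ b)) := by
  have h' : joinIndex (p, I') (q, J') = (r, M') :=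
    Prod.ext (congrArg Prod.fst h : p + q + 1 = r) e.symm
  rw [bigradedMul_inc R (homSummandMul R K L) hn₁ hn₂ h', homSummandMul, homSummandMul,
    LinearMap.smul_apply, LinearMap.smul_apply, map_zsmul, map_zsmul, map_zsmul,
    phi_homCross R K L h h' hI hJ hM, smul_smul, mul_assoc, ← Units.val_mul (joinSign _ _),
    Int.units_mul_self, Units.val_one, mul_one]

omit [LinearOrder W] [Fintype V] [Fintype W] in
theorem joinSign_mul_joinSign_insert (p q : ℤ) {I : Finset V} (J : Finset W) {i : V}
    (hi : i ∉ I) :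
    (joinSign (p, I) (q, J) : ℤ) * joinSign (p, insert i I) (q, J) = ((q + 1).negOnePow : ℤ) := by
  have := joinSign_mul_joinSign_erase p q J (Finset.mem_insert_self i I)
  rwa [Finset.erase_insert hi, mul_comm] at this

theorem partialPrime_bigradedMul {n₁ n₁' n₂ n₂' : ℤ × ℤ} (h₁ : n₁ + (-1, 2) = n₁')
    (h₂ : n₂ + (-1, 2) = n₂') (n n' : ℤ × ℤ) (hn : n₁ + n₂ = n) (x : HomX R K n₁)
    (y : HomX R L n₂) :
    partialPrime R (join K L) n n' (bigradedMul R (homSummandMul R K L) n₁ n₂ n (x ⊗ₜ y)) =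
      bigradedMul R (homSummandMul R K L) n₁' n₂ n' (partialPrime R K n₁ n₁' x ⊗ₜ y) +
        (totalSign (Multiplicative.ofAdd n₁) : ℤ) •
          bigradedMul R (homSummandMul R K L) n₁ n₂' n' (x ⊗ₜ partialPrime R L n₂ n₂' y) := by
  refine LinearMap.congr_fun (f := partialPrime R (join K L) n n' ∘ₗ
      bigradedMul R (homSummandMul R K L) n₁ n₂ n)
    (g := bigradedMul R (homSummandMul R K L) n₁' n₂ n' ∘ₗ
        TensorProduct.map (partialPrime R K n₁ n₁') LinearMap.id +
      (totalSign (Multiplicative.ofAdd n₁) : ℤ) • bigradedMul R (homSummandMul R K L) n₁ n₂' n' ∘ₗ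
        TensorProduct.map LinearMap.id (partialPrime R L n₂ n₂'))
    (bigraded_bilinear_ext R fun p I q J hp hq a b => ?_) (x ⊗ₜ y)
  simp only [LinearMap.comp_apply, LinearMap.add_apply, LinearMap.smul_apply,
    TensorProduct.map_tmul, LinearMap.id_apply]
  have hb : bideg (p + q + 1, dsum I J) = n := by
    rw [← hn, ← hp, ← hq]
    exact bideg_joinIndex (p, I) (q, J)
  have hz : joinIndex (p, I) (q, J) = (p + q + 1, dsum I J) := rfl
  have e1 : bigradedMul R (homSummandMul R K L) n₁ n₂ n (inc R (redHomFamily R K) n₁ (p, I) a ⊗ₜ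
      inc R (redHomFamily R L) n₂ (q, J) b) = inc R (redHomFamily R (join K L)) n
        (p + q + 1, dsum I J)
        (homSummandMul R K L (p, I) (q, J) (p + q + 1, dsum I J) hz (a ⊗ₜ b)) :=
    bigradedMul_inc R (homSummandMul R K L) hp hq hz a b
  have hI {i : V} (hi : i ∉ I) : bideg (p, insert i I) = n₁' := by
    rw [← h₁, ← hp, ← bideg_insert p hi, add_assoc]
    exact (add_zero _).symm
  have hJ {j : W} (hj : j ∉ J) : bideg (q, insert j J) = n₂' := by
    rw [← h₂, ← hq, ← bideg_insert q hj, add_assoc]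
    exact (add_zero _).symm
  rw [e1, partialPrime_inc R (join K L) n n' _ _ hb, partialPrime_inc R K n₁ n₁' p I hp,
    partialPrime_inc R L n₂ n₂' q J hq, univ_sdiff_dsum, sum_dsum, TensorProduct.sum_tmul,
    TensorProduct.tmul_sum, map_sum, map_sum, Finset.smul_sum]
  congr 1
  -- Enlarging `I` by one element changes the parity of `|I|` just as removing one does, so the same
  -- `joinSign` corrects `∂'`.
  · refine Finset.sum_congr rfl fun i hi => ?_
    refine (congrArg ((((p + q + 1 + 1).negOnePow : ℤ) *
      eps (toLex (Sum.inl i)) (dsum I J)) • ·) (inc_phi_homSummandMul R K L hz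
        (Finset.subset_insert i I) (Finset.Subset.refl J) _
        (insert_inl I J i) (hI (Finset.mem_sdiff.1 hi).2) hq a b)).trans ?_
    rw [phi_refl, map_zsmul_tmul, smul_smul,
      joinSign_mul_joinSign_insert p q J (Finset.mem_sdiff.1 hi).2, eps_inl, negOnePow_join]
    congr 1
    linear_combination (((p + 1).negOnePow : ℤ) * eps i I) * negOnePow_mul_self (q + 1)
  · refine Finset.sum_congr rfl fun j hj => ?_
    refine (congrArg ((((p + q + 1 + 1).negOnePow : ℤ) *
      eps (toLex (Sum.inr j)) (dsum I J)) • ·) (inc_phi_homSummandMul R K L hz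
        (Finset.Subset.refl I) (Finset.subset_insert j J) _
        (insert_inr I J j) hp (hJ (Finset.mem_sdiff.1 hj).2) a b)).trans ?_
    rw [phi_refl, map_tmul_zsmul, smul_smul, smul_smul,
      joinSign_mul_joinSign_right p q I J, eps_inr, negOnePow_join, ← hp, totalSign_bideg]
    congr 1
    ring

/-- The product on the complexes `CH_*` of simplicial complexes with values in that of the join. -/
noncomputable def homPairing : Pairing (· + ·) homShape.ε (CHhom R K) (CHhom R L)
    (CHhom R (join K L)) where
  μ n₁ n₂ n _ := bigradedMul R (homSummandMul R K L) n₁ n₂ n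
  leibniz h₁ h₂ hn _ _ x y := partialPrime_bigradedMul R K L h₁ h₂ _ _ hn x y

theorem isCoprod_homPairing (h : (∀ n, Module.Projective R ((CHhom R K).X n)) ∨
      (∀ n, Module.Projective R ((CHhom R L).X n))) (n : ℤ × ℤ) :
    IsCoprod fun x : {x : (ℤ × ℤ) × (ℤ × ℤ) // x.1 + x.2 = n} =>
      (homPairing R K L).μ x.1.1 x.1.2 n x.2 := by
  have h' : (∀ x, Module.Projective R (redHomFamily R K x)) ∨
      (∀ x, Module.Projective R (redHomFamily R L x)) :=
    h.imp (fun h => projective_of_forall_bidegree R (redHomFamily R K) h)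
      (fun h => projective_of_forall_bidegree R (redHomFamily R L) h)
  exact isCoprod_bigradedMul R (homSummandMul R K L) (isCoprod_joinSign_smul R (homCross R K L)
    fun I J r => isCoprod_κ_chainPairing R (isJoin_full K L I J)
      (h'.imp (fun h p => h (p, I)) (fun h p => h (p, J))) r) n

theorem nonempty_CHhom_join_iso (h : (∀ n, Module.Projective R ((CHhom R K).X n)) ∨
      (∀ n, Module.Projective R ((CHhom R L).X n))) :
    Nonempty (CHhom R (join K L) ≅
      HomologicalComplex.tensorObj (CHhom R K) (CHhom R L)) :=
  (homPairing R K L).nonempty_iso (δ := (-1, 2)) (fun _ _ => Iff.rfl)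
    (isCoprod_homPairing R K L h)

theorem nonempty_HHhom_join_iso (F : Type u) [Field F] :
    Nonempty (HHhom F (join K L) ≅
      GradedObject.Monoidal.tensorObj (HHhom F K) (HHhom F L)) := by
  obtain ⟨e⟩ := nonempty_CHhom_join_iso F K L (Or.inl fun n => inferInstance)
  obtain ⟨e'⟩ := nonempty_homology_tensorObj_iso (δ := (-1, 2)) (fun _ _ => Iff.rfl)
    (CHhom F K) (CHhom F L)
  exact ⟨GradedObject.isoMk _ _ (fun n => HomologicalComplex.homologyMapIso e n) ≪≫ e'⟩

end Hom

end DoubleCohomology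

theorem theorem6p4 {V W : Type} [Fintype V] [LinearOrder V] [Fintype W] [LinearOrder W]
    (K : PreAbstractSimplicialComplex V) (L : PreAbstractSimplicialComplex W) :
    (∀ (R : Type u) [CommRing R],
      ((∀ n, Module.Projective R ((CHcoh R K).X n)) ∨
        (∀ n, Module.Projective R ((CHcoh R L).X n))) →
      Nonempty (CHcoh R (join K L) ≅
        HomologicalComplex.tensorObj (CHcoh R K) (CHcoh R L))) ∧
    (∀ (F : Type u) [Field F],
      Nonempty (HHcoh F (join K L) ≅
        GradedObject.Monoidal.tensorObj (HHcoh F K) (HHcoh F L))) ∧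
    (∀ (R : Type u) [CommRing R],
      ((∀ n, Module.Projective R ((CHhom R K).X n)) ∨
        (∀ n, Module.Projective R ((CHhom R L).X n))) →
      Nonempty (CHhom R (join K L) ≅
        HomologicalComplex.tensorObj (CHhom R K) (CHhom R L))) ∧
    (∀ (F : Type u) [Field F],
      Nonempty (HHhom F (join K L) ≅
        GradedObject.Monoidal.tensorObj (HHhom F K) (HHhom F L))) := by
  exact ⟨fun R _ h => nonempty_CHcoh_join_iso R K L h, fun F _ => nonempty_HHcoh_join_iso K L F,
    fun R _ h => nonempty_CHhom_join_iso R K L h, fun F _ => nonempty_HHhom_join_iso K L F⟩
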